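/- All graphs are finite and simple. A graph is $p$-connected if it has more than $p$ vertices and remains connected after deleting any set of fewer than $p$ vertices. A linear decomposition of $G$ of length $L\ge 1$ is a family $\mathcal W=(W_0,\dots,W_L)$ of sets of vertices such that (L1) $\bigcup_i W_i=V(G)$ and every edge of $G$ has both ends in some $W_i$; (L2) $W_i\cap W_k\subseteq W_j$ whenever $0\le i\le j\le k\le L$. It has adhesion $q$ if (L3) $|W_{i-1}\cap W_i|=q$ for $i=1,\dots,L$. A linkage from $A$ to $B$ is a set of pairwise disjoint paths, each with one end in $A$ and the other in $B$. If (L3) holds, a foundational linkage for $\mathcal W$ is a linkage $\mathcal P$ in $G$ of cardinality $q$ from $W_0\cap W_1$ to $W_{L-1}\cap W_L$. A path is trivial if it has exactly one vertex. Write $V(\mathcal P_1)$ for the union of the vertex sets of the paths in $\mathcal P_1\subseteq\mathcal P$, and $P[W_i]$ for the restriction of $P$ to $W_i$. A $\mathcal P$-bridge in $G[W_i]$ is a subgraph of $G[W_i]$ that consists either of one edge that is not an edge of a path in $\mathcal P$ and has both ends in $V(\mathcal P)$, together with its ends, or of a component $C$ of $G[W_i]\setminus V(\mathcal P)$, all edges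 of $G[W_i]$ with at least one end in $C$, and the ends of these edges. Its attachments are its vertices in $V(\mathcal P)$. Distinct $P,P'\in\mathcal P$ are bridge adjacent in $W_i$ if some $\mathcal P$-bridge in $G[W_i]$ has an attachment in both. For a given integer $p$ consider the following properties. (L4) $W_{i-1}\ne W_{i-1}\cap W_i\ne W_i$ for $i=1,\dots,L$. (L5) $\mathcal P$ is a foundational linkage for $\mathcal W$. (L6) For all $i\in\{1,\dots,L-1\}$ and all non-trivial $P\in\mathcal P$: if some $\mathcal P$-bridge of $G[W_i]$, other than a single edge joining $P$ to a trivial member of $\mathcal P$, has at least one attachment in $P$ and no attachment in a non-trivial member of $\mathcal P$ other than $P$, then $P$ is bridge adjacent in $W_i$ to at least $p-2$ trivial members of $\mathcal P$. (L7) For every $P\in\mathcal P$, if $P[W_i]$ is trivial for some $i\in\{1,\dots,L-1\}$, then $P[W_k]$ is trivial for all $k\in\{1,\dots,L-1\}$. (L8) For all distinct $P,P'\in\mathcal P$, if $P,P'$ are bridge adjacent in $W_k$ for some $k\in\{1,\dots,L-1\}$, then they are bridge adjacent in $W_{k'}$ for all $k'\in\{1,\dots,L-1\}$. (L9) For all $\mathcal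 P_1\subseteq\mathcal P_2\subseteq\mathcal P$ such that $|\mathcal P_1|+|\mathcal P_2|\le p$ and each member of $\mathcal P_1$ is non-trivial, there is a linkage in $G$ of cardinality $|\mathcal P_1|$ from $W_0\cap W_1\cap V(\mathcal P_1)$ to $W_{L-1}\cap W_L\cap V(\mathcal P_1)$ whose graph is a subgraph of $G[W_0\cup W_L]\cup\bigcup_{P\in\mathcal P\setminus\mathcal P_2}P$. Theorem. For all integers $k,l,p,w\ge 0$ there is an integer $N$ such that every $p$-connected graph $G$ of tree-width at most $w$ with at least $N$ vertices either has a minor isomorphic to $K_{p,k}$, or has a linear decomposition $\mathcal W$ of length at least $l$ and adhesion at most $w$ and a linkage $\mathcal P$ such that (L1)–(L9) hold. Corollary. For all integers $l,w\ge 0$ there is an integer $N$ such that every $6$-connected graph $G$ of tree-width at most $w$ with at least $N$ vertices either has a minor isomorphic to $K_6$, or has a linear decomposition $\mathcal W$ of length at least $l$ and adhesion at most $w$ and a linkage $\mathcal P$ such that (L1)–(L9) hold for $p=6$. -/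

import Mathlib

/-! Graphs are finite and simple. -/

section GraphNotions

universe u v

variable {V : Type u}

/-- `G` is `p`-connected: it has more than `p` vertices, and deleting fewer than `p` vertices
leaves a connected graph. -/
def IsVertexConnected (p : ℕ) (G : SimpleGraph V) : Prop :=
  p < Nat.card V ∧ ∀ X : Finset V, X.card < p → (G.induce {x | x ∉ X}).Connected

/-- `H` is (isomorphic to) a minor of `G`: the vertices of `H` are represented by disjoint
connected non-empty branch sets of `G`, with an edge of `G` between the branch sets of any two
adjacent vertices of `H`. -/
def IsMinorOf {U : Type v} (H : SimpleGraph U) (G : SimpleGraph V) : Prop :=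
  ∃ branch : U → Set V,
    (∀ a, (G.induce (branch a)).Connected) ∧
    (∀ a b, a ≠ b → Disjoint (branch a) (branch b)) ∧
    (∀ a b, H.Adj a b → ∃ x ∈ branch a, ∃ y ∈ branch b, G.Adj x y)

/-- `(T, Y)` is a tree-decomposition of `G`. -/
structure IsTreeDecomposition (G : SimpleGraph V) {U : Type v} (T : SimpleGraph U)
    (Y : U → Set V) : Prop where
  isTree : T.IsTree
  vertex_mem : ∀ x : V, ∃ t, x ∈ Y t
  edge_mem : ∀ x y : V, G.Adj x y → ∃ t, x ∈ Y t ∧ y ∈ Y t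
  inter_subset : ∀ (t t' t'' : U) (R : T.Walk t t''), R.IsPath → t' ∈ R.support →
    Y t ∩ Y t'' ⊆ Y t'

/-- `G` has tree-width at most `w`, i.e. a tree-decomposition into bags of size at most `w + 1`
over a finite tree. -/
def TreewidthAtMost (w : ℕ) (G : SimpleGraph V) : Prop :=
  ∃ (n : ℕ) (T : SimpleGraph (Fin n)) (Y : Fin n → Set V),
    IsTreeDecomposition G T Y ∧ ∀ t, (Y t).encard ≤ w + 1

/-- A linkage from `A` to `B` of cardinality `n`: `n` disjoint paths `0, …, n - 1` of `G`, each
with one end in `A` and the other end in `B`. The paths are traversed from `A` to `B`. -/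
structure Linkage (G : SimpleGraph V) (A B : Set V) (n : ℕ) where
  src : Fin n → V
  tgt : Fin n → V
  path : ∀ j, G.Walk (src j) (tgt j)
  isPath : ∀ j, (path j).IsPath
  src_mem : ∀ j, src j ∈ A
  tgt_mem : ∀ j, tgt j ∈ B
  disjoint : ∀ i j, i ≠ j → ∀ x, x ∈ (path i).support → x ∉ (path j).support

namespace Linkage

variable {G : SimpleGraph V} {A B : Set V} {n : ℕ}

/-- The vertex set of the `j`-th path. -/
def verts (P : Linkage G A B n) (j : Fin n) : Set V := {x | x ∈ (P.path j).support}

/-- The union of the paths with index in `J`, as a subgraph of `G`. -/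
def graphOf (P : Linkage G A B n) (J : Set (Fin n)) : G.Subgraph :=
  ⨆ j ∈ J, (P.path j).toSubgraph

/-- The graph of the linkage. -/
def graph (P : Linkage G A B n) : G.Subgraph := P.graphOf Set.univ

/-- The `j`-th path has exactly one vertex. -/
def IsTrivial (P : Linkage G A B n) (j : Fin n) : Prop := ∃ x, P.verts j = {x}

/-- The restriction of the `j`-th path to the vertex set `X` has exactly one vertex. -/
def IsTrivialOn (P : Linkage G A B n) (X : Set V) (j : Fin n) : Prop :=
  ∃ x, P.verts j ∩ X = {x}

end Linkage

variable {G : SimpleGraph V}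

/-- `B` consists of an edge of `K` that is not in `S` and has both ends in `S`. -/
def IsEdgeBridge (K S B : G.Subgraph) : Prop :=
  ∃ (x y : V) (h : G.Adj x y), K.Adj x y ∧ ¬ S.Adj x y ∧ x ∈ S.verts ∧ y ∈ S.verts ∧
    B = G.subgraphOfAdj h

/-- For some component `C` of `K \ V(S)`, the graph `B` consists of `C`, all edges of `K` with at
least one end in `C`, and the ends of these edges. -/
def IsComponentBridge (K S B : G.Subgraph) : Prop :=
  ∃ (c : (K.deleteVerts S.verts).coe.ConnectedComponent) (C : Set V),
    C = Subtype.val '' c.supp ∧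
    B.verts = {x | x ∈ C ∨ ∃ y ∈ C, K.Adj x y} ∧
    ∀ x y, B.Adj x y ↔ K.Adj x y ∧ (x ∈ C ∨ y ∈ C)

/-- `B` is an `S`-bridge in the graph `K`, where `S` is a subgraph of `K`. -/
def IsBridgeIn (K S B : G.Subgraph) : Prop :=
  IsEdgeBridge K S B ∨ IsComponentBridge K S B

/-- The induced subgraph `G[X]`. -/
def inducedOn (G : SimpleGraph V) (X : Set V) : G.Subgraph := (⊤ : G.Subgraph).induce X

namespace Linkage

variable {A B : Set V} {n : ℕ}

/-- `D` is a bridge of the linkage in `G[X]`. -/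
def IsBridge (P : Linkage G A B n) (X : Set V) (D : G.Subgraph) : Prop :=
  IsBridgeIn (inducedOn G X) (P.graph ⊓ inducedOn G X) D

/-- The subgraph `D` has an attachment in the `j`-th path. -/
def Attaches (P : Linkage G A B n) (D : G.Subgraph) (j : Fin n) : Prop :=
  (D.verts ∩ P.verts j).Nonempty

/-- Some bridge of the linkage in `G[X]` has an attachment in both the `i`-th and the `j`-th
path. -/
def BridgeAdjacent (P : Linkage G A B n) (X : Set V) (i j : Fin n) : Prop :=
  ∃ D, P.IsBridge X D ∧ P.Attaches D i ∧ P.Attaches D j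

/-- `D` consists of a single edge with one end in the `j`-th path and the other end in a trivial
path of the linkage. -/
def IsEdgeToTrivial (P : Linkage G A B n) (D : G.Subgraph) (j : Fin n) : Prop :=
  ∃ (x y : V) (h : G.Adj x y) (t : Fin n), P.IsTrivial t ∧ x ∈ P.verts j ∧ y ∈ P.verts t ∧
    D = G.subgraphOfAdj h

end Linkage

/-- `(W 0, …, W L)` is a linear decomposition of `G` of length `L`; the sets `W i` with `L < i`
are irrelevant. -/
structure IsLinearDecomposition (G : SimpleGraph V) (L : ℕ) (W : ℕ → Set V) : Prop where
  vertex_mem : ∀ x, ∃ i ≤ L, x ∈ W i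
  edge_mem : ∀ x y, G.Adj x y → ∃ i ≤ L, x ∈ W i ∧ y ∈ W i
  inter_subset : ∀ i j k, i ≤ j → j ≤ k → k ≤ L → W i ∩ W k ⊆ W j

/-- Consecutive sets meet in exactly `q` vertices. -/
def HasAdhesion (L : ℕ) (W : ℕ → Set V) (q : ℕ) : Prop :=
  ∀ i, 1 ≤ i → i ≤ L → (W (i - 1) ∩ W i).ncard = q

/-- No two consecutive sets are nested. -/
def IsNonredundant (L : ℕ) (W : ℕ → Set V) : Prop :=
  ∀ i, 1 ≤ i → i ≤ L → W (i - 1) ≠ W (i - 1) ∩ W i ∧ W (i - 1) ∩ W i ≠ W i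

/-- A foundational linkage of the decomposition `(W 0, …, W L)` of adhesion `q` (with `1 ≤ L`). -/
abbrev FoundationalLinkage (G : SimpleGraph V) (L : ℕ) (W : ℕ → Set V) (q : ℕ) :=
  Linkage G (W 0 ∩ W 1) (W (L - 1) ∩ W L) q

namespace FoundationalLinkage

variable {L q : ℕ} {W : ℕ → Set V}

/-- Stability: if some bridge in `G[W i]`, other than a single edge joining the `j`-th path to a
trivial path, attaches to the non-trivial `j`-th path and to no other non-trivial path, then the
`j`-th path is bridge adjacent in `W i` to at least `p - 2` trivial paths. -/
def IsStable (p : ℕ) (P : FoundationalLinkage G L W q) : Prop :=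
  ∀ i, 1 ≤ i → i ≤ L - 1 → ∀ j, ¬ P.IsTrivial j →
    (∃ D, P.IsBridge (W i) D ∧ ¬ P.IsEdgeToTrivial D j ∧ P.Attaches D j ∧
      ∀ j', j' ≠ j → ¬ P.IsTrivial j' → ¬ P.Attaches D j') →
    p ≤ {t | P.IsTrivial t ∧ P.BridgeAdjacent (W i) j t}.ncard + 2

/-- A path that is trivial in one `W i` is trivial in all of them. -/
def HasUniformTriviality (P : FoundationalLinkage G L W q) : Prop :=
  ∀ j, (∃ i, 1 ≤ i ∧ i ≤ L - 1 ∧ P.IsTrivialOn (W i) j) →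
    ∀ k, 1 ≤ k → k ≤ L - 1 → P.IsTrivialOn (W k) j

/-- Two distinct paths that are bridge adjacent in one `W k` are so in all of them. -/
def HasUniformAdjacency (P : FoundationalLinkage G L W q) : Prop :=
  ∀ i j, i ≠ j → (∃ k, 1 ≤ k ∧ k ≤ L - 1 ∧ P.BridgeAdjacent (W k) i j) →
    ∀ k', 1 ≤ k' → k' ≤ L - 1 → P.BridgeAdjacent (W k') i j

/-- Rerouting: for all sets `P₁ ⊆ P₂` of paths of the linkage with `|P₁| + |P₂| ≤ p`, where `P₁`
has only non-trivial members, there is a linkage of cardinality `|P₁|` from the first to the last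
ends of `P₁` inside `G[W 0 ∪ W L]` together with the paths that are not in `P₂`. -/
def IsReroutable (p : ℕ) (P : FoundationalLinkage G L W q) : Prop :=
  ∀ P₁ P₂ : Finset (Fin q), P₁ ⊆ P₂ → P₁.card + P₂.card ≤ p → (∀ j ∈ P₁, ¬ P.IsTrivial j) →
    ∃ Q : Linkage G (W 0 ∩ W 1 ∩ ⋃ j ∈ P₁, P.verts j) (W (L - 1) ∩ W L ∩ ⋃ j ∈ P₁, P.verts j)
        P₁.card,
      Q.graph ≤ inducedOn G (W 0 ∪ W L) ⊔ P.graphOf {j | j ∉ P₂}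

end FoundationalLinkage

/-- `G` has a linear decomposition of length at least `l` and adhesion at most `w`, without
redundancies, that has a foundational linkage with the stability, uniformity and rerouting
properties for `p`. -/
def HasGoodLinearDecomposition (p l w : ℕ) (G : SimpleGraph V) : Prop :=
  ∃ (L q : ℕ) (W : ℕ → Set V) (P : FoundationalLinkage G L W q),
    1 ≤ L ∧ l ≤ L ∧ q ≤ w ∧
    IsLinearDecomposition G L W ∧ HasAdhesion L W q ∧ IsNonredundant L W ∧
    P.IsStable p ∧ P.HasUniformTriviality ∧ P.HasUniformAdjacency ∧ P.IsReroutable p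

end GraphNotions

/-! Bounded tree-width is traded for a long nested chain of separations, and the chain is then
thinned out until everything along it is uniform.

A rooted tree-decomposition gives a forest order on the vertices in which each vertex has a bag of
at most `w + 1` predecessors. If all depths are bounded, a large graph has many minimal vertices or
many vertices with a common parent. The sets above these vertices are disjoint and attach only to
one bag; by `p`-connectivity each sees at least `p` vertices of it, and the pigeonhole principle
gives the bipartite minor (`isMinorOf_completeBipartiteGraph`). Otherwise a long chain of the order
gives a long chain of separations of order at most `w` (`exists_minor_or_sepChain`). Menger's
theorem turns it into a chain of constant order `q` whose ends are joined by `q` disjoint paths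
(`exists_linked_chain`).

Uniformity: as an interval of the chain grows, the common part of its two end separators shrinks and
the set of pairs of paths that are adjacent inside it grows. `exists_constant_subsequence` makes
both constant. The first does not depend on the linkage and is treated before the linkage is fixed,
the second afterwards.

Stability: among all linkages between the given end sets, one is taken with the most rich vertices,
that is, vertices off the linkage that reach two non-trivial paths. Suppose that a bridge meeting no
non-trivial path but `P` spans a vertex of `P` with a neighbour leading to another non-trivial path.
Rerouting `P` through the bridge makes that vertex rich and loses no rich vertex
(`exists_rich_ncard_lt`). For an extremal linkage such bridges therefore sit on segments of `P`
whose inner vertices see only trivial paths. A segment of this kind is cut off by its two ends and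
the adjacent trivial paths, so there are at least `p - 2` of the latter
(`le_ncard_trivial_of_poor_bridge`).

Rerouting: by Menger it suffices that no set `Z` of fewer than `|P₁|` vertices separates
(`exists_connIn_of_ncard_lt`). Mark what is reached from the first ends of `P₁`. Each end part of
the chain has a section that `Z` meets only in trivial paths, and every adjacency in the middle
reappears in the left one, so marks spread there between adjacent paths. Giving each path in the
middle its left mark is consistent with the right side except on paths that lie in `P₂` or are hit
by `Z` in the middle. Removing one vertex of each exceptional path and the outer part of `Z` deletes
fewer than `|P₁| + |P₂| ≤ p` vertices and separates marked from unmarked vertices, against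
`p`-connectivity. -/

section Connections

/-! ### Walks inside a set of vertices. -/

variable {V : Type*} {G H : SimpleGraph V} {X Y : Set V} {u v w : V}

/-- The vertices `u` and `v` are joined by a walk of `G` inside the set `X`. -/
def ConnIn (G : SimpleGraph V) (X : Set V) (u v : V) : Prop :=
  ∃ p : G.Walk u v, ∀ x ∈ p.support, x ∈ X

theorem ConnIn.refl (h : u ∈ X) : ConnIn G X u u :=
  ⟨.nil, by simpa using h⟩

theorem ConnIn.symm (h : ConnIn G X u v) : ConnIn G X v u := by
  obtain ⟨p, hp⟩ := h
  exact ⟨p.reverse, by simpa using hp⟩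

theorem ConnIn.trans (h : ConnIn G X u v) (h' : ConnIn G X v w) : ConnIn G X u w := by
  obtain ⟨p, hp⟩ := h
  obtain ⟨q, hq⟩ := h'
  refine ⟨p.append q, fun x hx => ?_⟩
  rcases SimpleGraph.Walk.mem_support_append_iff _ _ |>.1 hx with h | h
  exacts [hp x h, hq x h]

theorem ConnIn.mono (h : ConnIn G X u v) (hG : G ≤ H) (hX : X ⊆ Y) : ConnIn H Y u v := by
  obtain ⟨p, hp⟩ := h
  refine ⟨p.mapLe hG, fun x hx => hX (hp x ?_)⟩
  simpa using hx

theorem ConnIn.mono_set (h : ConnIn G X u v) (hX : X ⊆ Y) : ConnIn G Y u v := h.mono le_rfl hX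

theorem ConnIn.left_mem (h : ConnIn G X u v) : u ∈ X := by
  obtain ⟨p, hp⟩ := h
  exact hp _ p.start_mem_support

theorem ConnIn.right_mem (h : ConnIn G X u v) : v ∈ X := h.symm.left_mem

theorem ConnIn.of_adj (h : G.Adj u v) (hu : u ∈ X) (hv : v ∈ X) : ConnIn G X u v :=
  ⟨h.toWalk, by simp [hu, hv]⟩

theorem ConnIn.tail (h : ConnIn G X u v) (ha : G.Adj v w) (hw : w ∈ X) : ConnIn G X u w :=
  h.trans (.of_adj ha h.right_mem hw)

theorem ConnIn.head (ha : G.Adj u v) (hu : u ∈ X) (h : ConnIn G X v w) : ConnIn G X u w :=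
  (ConnIn.of_adj ha hu h.left_mem).trans h

theorem ConnIn.induction {c : V → Prop} (h : ConnIn G X u v) (hu : c u)
    (step : ∀ x y, x ∈ X → y ∈ X → G.Adj x y → c x → c y) : c v := by
  obtain ⟨p, hp⟩ := h
  induction p with
  | nil => exact hu
  | cons hadj p ih =>
    simp only [SimpleGraph.Walk.support_cons, List.mem_cons, forall_eq_or_imp] at hp
    exact ih (step _ _ hp.1 (hp.2 _ p.start_mem_support) hadj hu) hp.2

/-- A walk in `Y` that starts in `X` and cannot leave `X` is a walk in `X`. -/
theorem ConnIn.restrict (h : ConnIn G Y u v) (hu : u ∈ X)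
    (step : ∀ x y, x ∈ X → x ∈ Y → y ∈ Y → G.Adj x y → y ∈ X) : ConnIn G (X ∩ Y) u v := by
  refine h.induction (c := fun x => ConnIn G (X ∩ Y) u x) (.refl ⟨hu, h.left_mem⟩) ?_
  intro x y hx hy hxy hc
  exact hc.tail hxy ⟨step x y hc.right_mem.1 hx hy hxy, hy⟩

/-- The first vertex of a walk in `Y`. -/
theorem ConnIn.exists_first (h : ConnIn G X u v) (hu : u ∉ Y) (hv : v ∈ Y) :
    ∃ x y, ConnIn G (X \ Y) u x ∧ G.Adj x y ∧ y ∈ Y ∧ y ∈ X := by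
  have := h.induction (c := fun x => (∃ x y, ConnIn G (X \ Y) u x ∧ G.Adj x y ∧ y ∈ Y ∧ y ∈ X) ∨
    ConnIn G (X \ Y) u x) (.inr (.refl ⟨h.left_mem, hu⟩)) (by
      rintro x y hx hy hxy (hc | hc)
      · exact .inl hc
      · by_cases hyY : y ∈ Y
        · exact .inl ⟨x, y, hc, hxy, hyY, hy⟩
        · exact .inr (hc.tail hxy ⟨hy, hyY⟩))
  exact this.resolve_right fun h => h.right_mem.2 hv

theorem ConnIn.exists_path (h : ConnIn G X u v) :
    ∃ p : G.Walk u v, p.IsPath ∧ ∀ x ∈ p.support, x ∈ X := by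
  classical
  obtain ⟨p, hp⟩ := h
  exact ⟨p.bypass, p.bypass_isPath, fun x hx => hp x (p.support_bypass_subset_support hx)⟩

theorem connIn_of_fun (f : ℕ → V) (a b : ℕ) (hab : a ≤ b)
    (h : ∀ i, a ≤ i → i < b → G.Adj (f i) (f (i + 1))) (hX : ∀ i, a ≤ i → i ≤ b → f i ∈ X) :
    ConnIn G X (f a) (f b) := by
  induction b, hab using Nat.le_induction with
  | base => exact .refl (hX _ le_rfl le_rfl)
  | succ b hb ih =>
    exact (ih (fun i h1 h2 => h i h1 (by omega)) (fun i h1 h2 => hX i h1 (by omega))).tail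
      (h b hb (by omega)) (hX _ (by omega) le_rfl)

theorem connIn_of_connected_induce (h : (G.induce X).Connected) (hu : u ∈ X) (hv : v ∈ X) :
    ConnIn G X u v := by
  obtain ⟨p⟩ := h.preconnected ⟨u, hu⟩ ⟨v, hv⟩
  refine ⟨p.map (SimpleGraph.Embedding.induce X).toHom, fun x hx => ?_⟩
  replace hx : x ∈ (p.map (SimpleGraph.Embedding.induce X).toHom).support := hx
  rw [SimpleGraph.Walk.support_map, List.mem_map] at hx
  obtain ⟨y, -, rfl⟩ := hx
  exact y.2

theorem connected_induce_of_connIn (hu : u ∈ X) (h : ∀ v ∈ X, ConnIn G X u v) :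
    (G.induce X).Connected := by
  rw [SimpleGraph.connected_iff_exists_forall_reachable]
  refine ⟨⟨u, hu⟩, fun ⟨v, hv⟩ => ?_⟩
  obtain ⟨p, hp⟩ := h v hv
  exact ⟨p.induce X hp⟩

theorem exists_walk_of_fun (n : ℕ) (f : ℕ → V) (h : ∀ i < n, G.Adj (f i) (f (i + 1))) :
    ∃ p : G.Walk (f 0) (f n), p.length = n ∧ ∀ i ≤ n, p.getVert i = f i := by
  induction n generalizing f with
  | zero => exact ⟨.nil, rfl, by simp⟩
  | succ n ih =>
    obtain ⟨p, hl, hp⟩ := ih (fun i => f (i + 1)) (fun i hi => h (i + 1) (by omega))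
    refine ⟨.cons (h 0 (by omega)) p, by simp [hl], fun i hi => ?_⟩
    cases i with
    | zero => simp
    | succ i => simpa using hp i (by omega)

/-- Injectivity jointly in path index and position gives both that the walks are paths and that they
are disjoint. -/
theorem exists_linkage_of_fun {A B : Set V} {n : ℕ} (len : Fin n → ℕ) (f : Fin n → ℕ → V)
    (hadj : ∀ j, ∀ i < len j, G.Adj (f j i) (f j (i + 1)))
    (hinj : ∀ j j' i i', i ≤ len j → i' ≤ len j' → f j i = f j' i' → j = j' ∧ i = i')
    (hA : ∀ j, f j 0 ∈ A) (hB : ∀ j, f j (len j) ∈ B) :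
    ∃ P : Linkage G A B n, ∀ j, (P.path j).length = len j ∧
      ∀ i ≤ len j, (P.path j).getVert i = f j i := by
  choose p hl hp using fun j => exists_walk_of_fun (G := G) (len j) (f j) (hadj j)
  refine ⟨⟨fun j => f j 0, fun j => f j (len j), p, fun j => ?_, hA, hB, ?_⟩,
    fun j => ⟨hl j, hp j⟩⟩
  · rw [← SimpleGraph.Walk.IsPath.getVert_injOn_iff]
    intro i hi i' hi' h
    simp only [Set.mem_ofPred_eq, hl] at hi hi'
    rw [hp j i hi, hp j i' hi'] at h
    exact (hinj j j i i' hi hi' h).2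
  · intro i j hij x hx hx'
    rw [SimpleGraph.Walk.mem_support_iff_exists_getVert] at hx hx'
    obtain ⟨a, rfl, ha⟩ := hx
    obtain ⟨b, hb', hb⟩ := hx'
    rw [hl] at ha hb
    rw [hp _ _ ha, hp _ _ hb] at hb'
    exact hij (hinj _ _ _ _ hb ha hb').1.symm

end Connections

/-! ### Menger's theorem from Hall's theorem. -/

section Menger

variable {V : Type*} [Finite V]

/-- Menger's theorem. -/
theorem menger (G : SimpleGraph V) (A B : Set V) (n : ℕ) :
    Nonempty (Linkage G A B n) ∨
      ∃ Z : Set V, Z.ncard < n ∧ ∀ a ∈ A, ∀ b ∈ B, ¬ ConnIn G Zᶜ a b := by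
  classical
  have := Fintype.ofFinite V
  by_contra hcon
  push Not at hcon
  obtain ⟨hno, hZ⟩ := hcon
  have hsep : ∀ Z : Finset V, (∀ a ∈ A, ∀ b ∈ B, ¬ ConnIn G (Z : Set V)ᶜ a b) → n ≤ Z.card := by
    intro Z h
    by_contra hlt
    obtain ⟨a, ha, b, hb, hc⟩ := hZ Z (by simpa [Set.ncard_coe_finset] using hlt)
    exact h a ha b hb hc
  set A' : Finset V := A.toFinset with hA'
  have hnA : n ≤ A'.card := hsep A' fun a ha b _ hc => hc.left_mem (by simpa [hA'] using ha)
  -- Hall's theorem will match each vertex outside `B` to itself or a neighbour, not in `A`, or to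
  -- one of `d` dummies. Iterating the matching from the vertices of `A` traces disjoint paths; at
  -- most `d` of them end at a dummy, so at least `n` reach `B`.
  let d := A'.card - n
  let t : {v // v ∉ B} → Finset (V ⊕ Fin d) := fun v =>
    Finset.univ.filter fun x => ∀ u, x = .inl u → u ∉ A ∧ (u = v.1 ∨ G.Adj v.1 u)
  have hhall : ∀ Q : Finset {v // v ∉ B}, Q.card ≤ (Q.biUnion t).card := by
    intro Q
    rcases Q.eq_empty_or_nonempty with rfl | ⟨v0, hv0⟩
    · simp
    let Q' : Finset V := Q.map ⟨Subtype.val, Subtype.val_injective⟩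
    let N : Finset V := Finset.univ.filter fun u => u ∉ A ∧ ∃ v ∈ Q', u = v ∨ G.Adj v u
    have hN : (Q.biUnion t) = N.disjSum Finset.univ := by
      ext x
      rcases x with u | e
      · simp only [Finset.mem_biUnion, Finset.inl_mem_disjSum, N, t, Q', Finset.mem_filter,
          Finset.mem_univ, true_and, Finset.mem_map, Function.Embedding.coeFn_mk]
        constructor
        · rintro ⟨v, hv, h⟩
          exact ⟨(h u rfl).1, v, ⟨v, hv, rfl⟩, (h u rfl).2⟩
        · rintro ⟨hu, _, ⟨v, hv, rfl⟩, h⟩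
          refine ⟨v, hv, fun u' h' => ?_⟩
          cases h'
          exact ⟨hu, h⟩
      · simp only [Finset.mem_biUnion, t, Finset.mem_filter, Finset.mem_univ, true_and,
          Finset.inr_mem_disjSum, iff_true]
        exact ⟨v0, hv0, by simp⟩
    have hdisj : Disjoint N A' := by
      rw [Finset.disjoint_left]
      intro x hx
      simp only [N, Finset.mem_filter] at hx
      simpa [hA'] using hx.2.1
    have hQ' : Q' ⊆ N ∪ A' := by
      intro x hx
      by_cases hxA : x ∈ A
      · simp [hA', hxA]
      · simp only [N, Finset.mem_union, Finset.mem_filter, Finset.mem_univ, true_and]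
        exact .inl ⟨hxA, x, hx, .inl rfl⟩
    -- A walk from `A` that avoids this set stays in `Q'`, which is disjoint from `B`. So the set
    -- separates, and the resulting inequality `n ≤ |N| + |A| - |Q|` is Hall's condition.
    have hsepQ := hsep ((N ∪ A') \ Q') (by
      intro a ha b hb hc
      have hbQ : b ∈ Q' := hc.induction (c := fun x => x ∈ Q')
        (by
          have := hc.left_mem
          by_contra h
          exact this (by simp [hA', ha, h]))
        (by
          intro x y _ hy hxy hxQ
          by_contra h
          refine hy ?_
          simp only [Finset.coe_sdiff, Finset.coe_union, Set.mem_sdiff, Set.mem_union,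
            Finset.mem_coe, h, not_false_eq_true, and_true]
          by_cases hyA : y ∈ A
          · exact .inr (by simpa [hA'] using hyA)
          · left
            simp only [N, Finset.mem_filter, Finset.mem_univ, true_and]
            exact ⟨hyA, x, hxQ, .inr hxy⟩)
      simp only [Q', Finset.mem_map, Function.Embedding.coeFn_mk] at hbQ
      obtain ⟨b', -, rfl⟩ := hbQ
      exact b'.2 hb)
    rw [Finset.card_sdiff_of_subset hQ', Finset.card_union_of_disjoint hdisj] at hsepQ
    have hcard : Q'.card = Q.card := Finset.card_map _
    rw [hN, Finset.card_disjSum, Finset.card_univ, Fintype.card_fin]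
    have := Finset.card_le_card hQ'
    rw [Finset.card_union_of_disjoint hdisj] at this
    omega
  obtain ⟨f, hfinj, hft⟩ := (Finset.all_card_le_biUnion_card_iff_exists_injective t).1 hhall
  have hfl : ∀ v u, f v = .inl u → u ∉ A ∧ (u = v.1 ∨ G.Adj v.1 u) := by
    intro v u h
    have := hft v
    simp only [t, Finset.mem_filter] at this
    exact this.2 u h
  let g : V → V := fun v => if h : v ∉ B then (f ⟨v, h⟩).elim id (fun _ => v) else v
  have hiter : ∀ k a, g (g^[k] a) = g^[k + 1] a := fun k a =>
    (Function.iterate_succ_apply' g k a).symm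
  let term : V → Prop := fun v => v ∈ B ∨ ∃ h : v ∉ B, ∃ e, f ⟨v, h⟩ = .inr e
  have hg : ∀ v, ¬ term v → ∃ h : v ∉ B, f ⟨v, h⟩ = .inl (g v) := by
    intro v hv
    simp only [term, not_or, not_exists] at hv
    refine ⟨hv.1, ?_⟩
    cases hfv : f ⟨v, hv.1⟩ with
    | inl u => simp [g, hv.1, hfv]
    | inr e => exact absurd hfv (hv.2 hv.1 e)
  -- Vertices of `A` are not values of the matching, so coinciding points of two traces can be
  -- pulled back by injectivity until both traces are at their start. This excludes cycles and fixed
  -- points as well.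
  have horb : ∀ a ∈ A, ∀ a' ∈ A, ∀ i j, (∀ k < i, ¬ term (g^[k] a)) →
      (∀ k < j, ¬ term (g^[k] a')) → g^[i] a = g^[j] a' → a = a' ∧ i = j := by
    intro a ha a' ha' i
    induction i with
    | zero =>
      intro j _ hj h
      cases j with
      | zero => exact ⟨h, rfl⟩
      | succ j =>
        obtain ⟨hB, hf⟩ := hg _ (hj j (by omega))
        have := (hfl _ _ hf).1
        rw [hiter, ← h] at this
        exact absurd ha this
    | succ i ih =>
      intro j hi hj h
      cases j with
      | zero =>
        obtain ⟨hB, hf⟩ := hg _ (hi i (by omega))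
        have := (hfl _ _ hf).1
        rw [hiter, h] at this
        exact absurd ha' this
      | succ j =>
        obtain ⟨hB, hf⟩ := hg _ (hi i (by omega))
        obtain ⟨hB', hf'⟩ := hg _ (hj j (by omega))
        rw [hiter] at hf hf'
        rw [h, ← hf'] at hf
        have := hfinj hf
        simp only [Subtype.mk.injEq] at this
        have := ih j (fun k hk => hi k (by omega)) (fun k hk => hj k (by omega)) this
        exact ⟨this.1, by omega⟩
  have hterm : ∀ a ∈ A, ∃ i, term (g^[i] a) := by
    intro a ha
    by_contra h
    push Not at h
    exact not_injective_infinite_finite (fun i : ℕ => g^[i] a)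
      fun i j hij => (horb a ha a ha i j (fun k _ => h k) (fun k _ => h k) hij).2
  have hlen : ∀ a : V, ∃ i, a ∈ A → term (g^[i] a) ∧ ∀ k < i, ¬ term (g^[k] a) := by
    intro a
    by_cases ha : a ∈ A
    · exact ⟨Nat.find (hterm a ha), fun _ =>
        ⟨Nat.find_spec (hterm a ha), fun k hk => Nat.find_min (hterm a ha) hk⟩⟩
    · exact ⟨0, fun h => absurd h ha⟩
  choose len hlen using hlen
  let good : Finset V := A'.filter fun a => g^[len a] a ∈ B
  have hgood : n ≤ good.card := by
    have hbad : (A'.filter fun a => g^[len a] a ∉ B).card ≤ d := by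
      have hex : ∀ a, ∃ e : Fin d ⊕ Unit, a ∈ A → (h : g^[len a] a ∉ B) →
          ∃ e', e = .inl e' ∧ f ⟨_, h⟩ = .inr e' := by
        intro a
        by_cases h : a ∈ A ∧ g^[len a] a ∉ B
        · rcases (hlen a h.1).1 with h' | ⟨h1, e, he⟩
          · exact absurd h' h.2
          · exact ⟨.inl e, fun _ _ => ⟨e, rfl, he⟩⟩
        · exact ⟨.inr (), fun h1 h2 => absurd ⟨h1, h2⟩ h⟩
      choose e he using hex
      have : (A'.filter fun a => g^[len a] a ∉ B).card ≤
          (Finset.univ.map (⟨Sum.inl, Sum.inl_injective⟩ : Fin d ↪ Fin d ⊕ Unit)).card := by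
        apply Finset.card_le_card_of_injOn e
        · intro a ha
          simp only [hA', Finset.coe_filter, Set.mem_toFinset, Set.mem_ofPred_eq] at ha
          obtain ⟨e', he', -⟩ := he a ha.1 ha.2
          simp [he']
        · intro a ha b hb hab
          simp only [hA', Finset.coe_filter, Set.mem_toFinset, Set.mem_ofPred_eq] at ha hb
          obtain ⟨e1, he1, hf1⟩ := he a ha.1 ha.2
          obtain ⟨e2, he2, hf2⟩ := he b hb.1 hb.2
          rw [he1, he2] at hab
          cases hab
          have := hfinj (hf1.trans hf2.symm)
          simp only [Subtype.mk.injEq] at this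
          exact (horb a ha.1 b hb.1 _ _ (hlen a ha.1).2 (hlen b hb.1).2 this).1
      simpa using this
    have := Finset.card_filter_add_card_filter_not (s := A') (fun a => g^[len a] a ∈ B)
    simp only [good]
    omega
  obtain ⟨ι⟩ : Nonempty (Fin n ↪ good) :=
    Function.Embedding.nonempty_of_card_le (by simpa using hgood)
  have hι : ∀ j, (ι j).1 ∈ A ∧ g^[len (ι j).1] (ι j).1 ∈ B := fun j => by
    have := Finset.mem_filter.1 (ι j).2
    exact ⟨by simpa [hA'] using this.1, this.2⟩
  obtain ⟨P, -⟩ := exists_linkage_of_fun (G := G) (A := A) (B := B)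
    (fun j => len (ι j).1) (fun j i => g^[i] (ι j).1)
    (by
      intro j i hi
      have hl := (hlen _ (hι j).1).2
      obtain ⟨hB, hf⟩ := hg _ (hl i hi)
      rw [hiter] at hf
      refine (hfl _ _ hf).2.resolve_left fun h => ?_
      have := (horb _ (hι j).1 _ (hι j).1 (i + 1) i (fun k hk => hl k (by omega))
        (fun k hk => hl k (by omega)) h).2
      omega)
    (by
      intro j j' i i' hi hi' h
      have hl := (hlen _ (hι j).1).2
      have hl' := (hlen _ (hι j').1).2
      have := horb _ (hι j).1 _ (hι j').1 i i' (fun k hk => hl k (by omega))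
        (fun k hk => hl' k (by omega)) h
      exact ⟨ι.injective (Subtype.ext this.1), this.2⟩)
    (fun j => (hι j).1) (fun j => (hι j).2)
  exact hno.elim P

end Menger

/-! ### Chains of separations and their linkages. -/

section Separations

universe u

variable {V : Type u} {G : SimpleGraph V}

/-- The pair `(A, B)` is a separation of `G`. -/
structure IsSep (G : SimpleGraph V) (A B : Set V) : Prop where
  cover : ∀ v, v ∈ A ∨ v ∈ B
  edge : ∀ x y, G.Adj x y → (x ∈ A ∧ y ∈ A) ∨ (x ∈ B ∧ y ∈ B)

/-- A strictly increasing sequence of separations `(A 0, B 0), …, (A M, B M)`. -/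
structure SepChain (G : SimpleGraph V) (M : ℕ) (A B : ℕ → Set V) : Prop where
  sep : ∀ i ≤ M, IsSep G (A i) (B i)
  ssubset : ∀ i j, i < j → j ≤ M → A i ⊂ A j
  anti : ∀ i j, i ≤ j → j ≤ M → B j ⊆ B i

theorem SepChain.mono {M : ℕ} {A B : ℕ → Set V} (h : SepChain G M A B) {i j : ℕ} (hij : i ≤ j)
    (hj : j ≤ M) : A i ⊆ A j := by
  rcases hij.eq_or_lt with rfl | hlt
  exacts [subset_rfl, (h.ssubset i j hlt hj).1]

theorem SepChain.comp {M l : ℕ} {A B : ℕ → Set V} (h : SepChain G M A B) {φ : ℕ → ℕ}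
    (hφ : StrictMono φ) (hl : φ l ≤ M) : SepChain G l (A ∘ φ) (B ∘ φ) where
  sep _ hi := h.sep _ ((hφ.monotone hi).trans hl)
  ssubset _ _ hij hj := h.ssubset _ _ (hφ hij) ((hφ.monotone hj).trans hl)
  anti _ _ hij hj := h.anti _ _ (hφ.monotone hij) ((hφ.monotone hj).trans hl)

theorem IsSep.mem_left_of_adj {A B : Set V} (h : IsSep G A B) {x y : V} (hxy : G.Adj x y)
    (hx : x ∉ B) : y ∈ A :=
  (h.edge x y hxy).elim (·.2) fun h' => absurd h'.1 hx

theorem IsSep.mem_right_of_adj {A B : Set V} (h : IsSep G A B) {x y : V} (hxy : G.Adj x y)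
    (hx : x ∉ A) : y ∈ B :=
  (h.edge x y hxy).elim (fun h' => absurd h'.1 hx) (·.2)

theorem IsSep.mem_right {A B : Set V} (h : IsSep G A B) {x : V} (hx : x ∉ A) : x ∈ B :=
  (h.cover x).resolve_left hx

theorem IsSep.mem_left {A B : Set V} (h : IsSep G A B) {x : V} (hx : x ∉ B) : x ∈ A :=
  (h.cover x).resolve_right hx

theorem IsSep.exists_mem_inter {A B X : Set V} (h : IsSep G A B) {u v : V}
    (hc : ConnIn G X u v) (hu : u ∈ A) (hv : v ∈ B) : ∃ s ∈ A ∩ B, s ∈ X := by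
  by_contra hno
  push Not at hno
  have hvA : v ∈ A := hc.induction (c := fun x => x ∈ A) hu (by
    intro x y hx _ hxy hxA
    exact h.mem_left_of_adj hxy fun hxB => hno x ⟨hxA, hxB⟩ hx)
  exact hno v ⟨hvA, hv⟩ hc.right_mem

/-- A linkage as a linkage in a larger graph. -/
def Linkage.mapLe {H : SimpleGraph V} (hGH : G ≤ H) {X Y : Set V} {n : ℕ}
    (P : Linkage G X Y n) : Linkage H X Y n where
  src := P.src
  tgt := P.tgt
  path j := (P.path j).mapLe hGH
  isPath j := (P.isPath j).mapLe hGH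
  src_mem := P.src_mem
  tgt_mem := P.tgt_mem
  disjoint i j hij x hx := by
    have := P.disjoint i j hij x
    simp only [SimpleGraph.Walk.support_mapLe_eq_support] at hx ⊢
    exact this hx

theorem Linkage.connIn {X Y : Set V} {n : ℕ} (P : Linkage G X Y n) (j : Fin n) :
    ConnIn G (P.verts j) (P.src j) (P.tgt j) :=
  ⟨P.path j, fun _ h => h⟩

theorem Linkage.eq_of_mem {X Y : Set V} {n : ℕ} (P : Linkage G X Y n) {i j : Fin n} {x : V}
    (hi : x ∈ P.verts i) (hj : x ∈ P.verts j) : i = j := by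
  by_contra hij
  exact P.disjoint i j hij x hi hj

theorem Linkage.le_ncard [Finite V] {X Y Z : Set V} {n : ℕ} (P : Linkage G X Y n)
    (h : ∀ j, ∃ z ∈ Z, z ∈ P.verts j) : n ≤ Z.ncard := by
  choose z hz hzP using h
  have hinj : Function.Injective z := fun i j hij => P.eq_of_mem (hzP i) (hij ▸ hzP j)
  calc n = (Set.range z).ncard := by rw [Set.ncard_range_of_injective hinj]; simp
    _ ≤ Z.ncard := Set.ncard_le_ncard (by rintro _ ⟨j, rfl⟩; exact hz j) (Set.toFinite _)

theorem Linkage.le_ncard_of_isSep [Finite V] {X Y A B : Set V} {n : ℕ} (P : Linkage G X Y n)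
    (h : IsSep G A B) (hX : X ⊆ A) (hY : Y ⊆ B) : n ≤ (A ∩ B).ncard :=
  P.le_ncard fun j => h.exists_mem_inter (P.connIn j) (hX (P.src_mem j)) (hY (P.tgt_mem j))

/-- Between two nested separations there are `n` disjoint paths or a separation of order less
than `n`. -/
theorem IsSep.linkage_or_exists_between [Finite V] {A B A' B' : Set V} (h : IsSep G A B)
    (h' : IsSep G A' B') (hA : A ⊆ A') (hB : B' ⊆ B) (n : ℕ) :
    Nonempty (Linkage G (A ∩ B) (A' ∩ B') n) ∨
      ∃ C D, IsSep G C D ∧ A ⊆ C ∧ C ⊆ A' ∧ B' ⊆ D ∧ D ⊆ B ∧ (C ∩ D).ncard < n := by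
  -- Only the edges inside `A' ∩ B` are kept, the region between the two separations. If Menger
  -- gives a cut `Z`, then `C` collects `A` and all that is reached from `A ∩ B` in front of the
  -- cut.
  let G' : SimpleGraph V :=
    { Adj x y := G.Adj x y ∧ x ∈ A' ∩ B ∧ y ∈ A' ∩ B
      symm := ⟨fun _ _ h => ⟨h.1.symm, h.2.2, h.2.1⟩⟩
      loopless := ⟨fun x h => G.loopless.irrefl x h.1⟩ }
  rcases menger G' (A ∩ B) (A' ∩ B') n with ⟨⟨P⟩⟩ | ⟨Z, hZn, hZ⟩
  · exact .inl ⟨P.mapLe fun x y (h : G.Adj x y ∧ _) => h.1⟩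
  right
  have hK : ∀ s ∈ A ∩ B, ∀ s' ∈ A' ∩ B', ¬ ConnIn G ((A' ∩ B) \ Z) s s' := by
    intro s hs s' hs' hc
    refine hZ s hs s' hs' (hc.induction (c := fun x => ConnIn G' Zᶜ s x) (.refl hc.left_mem.2) ?_)
    intro x y hx hy hxy hcx
    exact hcx.tail ⟨hxy, hx.1, hy.1⟩ hy.2
  let C : Set V :=
    {v | v ∉ Z ∩ (A' ∩ B) ∧ (v ∈ A ∨ ∃ s ∈ A ∩ B, ConnIn G ((A' ∩ B) \ Z) s v)}
  have hCA : C ⊆ A' := by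
    rintro v ⟨-, hv | ⟨s, -, hv⟩⟩
    exacts [hA hv, hv.right_mem.1.1]
  have hCB : ∀ v ∈ C, v ∉ B' := by
    rintro v ⟨hvZ, hv | ⟨s, hs, hv⟩⟩ hvB
    · exact hK v ⟨hv, hB hvB⟩ v ⟨hA hv, hvB⟩
        (.refl ⟨⟨hA hv, hB hvB⟩, fun h => hvZ ⟨h, hA hv, hB hvB⟩⟩)
    · exact hK s hs v ⟨hv.right_mem.1.1, hvB⟩ hv
  have hclosed : ∀ x y, G.Adj x y → x ∈ C → y ∉ Z ∩ (A' ∩ B) → y ∈ C := by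
    intro x y hxy hx hy
    have hyA' : y ∈ A' := h'.mem_left_of_adj hxy (hCB x hx)
    refine ⟨hy, ?_⟩
    by_cases hyA : y ∈ A
    · exact .inl hyA
    have hyB : y ∈ B := h.mem_right hyA
    have hxB : x ∈ B := h.mem_right_of_adj hxy.symm hyA
    have hyK : y ∈ (A' ∩ B) \ Z := ⟨⟨hyA', hyB⟩, fun h => hy ⟨h, hyA', hyB⟩⟩
    right
    obtain ⟨hxZ, hxA | ⟨s, hs, hc⟩⟩ := hx
    · exact ⟨x, ⟨hxA, hxB⟩, .of_adj hxy ⟨⟨hA hxA, hxB⟩, fun h => hxZ ⟨h, hA hxA, hxB⟩⟩ hyK⟩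
    · exact ⟨s, hs, hc.tail hxy hyK⟩
  refine ⟨C ∪ Z ∩ (A' ∩ B), Cᶜ, ⟨fun v => ?_, fun x y hxy => ?_⟩, ?_, ?_, ?_, ?_, ?_⟩
  · by_cases hv : v ∈ C
    exacts [.inl (.inl hv), .inr hv]
  · by_cases hx : x ∈ C
    · by_cases hy : y ∈ Z ∩ (A' ∩ B)
      exacts [.inl ⟨.inl hx, .inr hy⟩, .inl ⟨.inl hx, .inl (hclosed x y hxy hx hy)⟩]
    · by_cases hy : y ∈ C
      · left
        refine ⟨?_, .inl hy⟩
        by_contra hx'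
        exact hx (hclosed y x hxy.symm hy fun h => hx' (.inr h))
      · exact .inr ⟨hx, hy⟩
  · intro v hv
    by_cases hvZ : v ∈ Z ∩ (A' ∩ B)
    exacts [.inr hvZ, .inl ⟨hvZ, .inl hv⟩]
  · exact Set.union_subset hCA fun v hv => hv.2.1
  · exact fun v hv hvC => hCB v hvC hv
  · intro v hv
    by_contra hvB
    exact hv ⟨fun h => hvB h.2.2, .inl (h.mem_left hvB)⟩
  · refine lt_of_le_of_lt (Set.ncard_le_ncard ?_ (Set.toFinite _)) hZn
    rintro v ⟨hv | hv, hv'⟩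
    exacts [absurd hv hv', hv.1]

/-- A long chain of separations of bounded order contains, up to shifting the separations, a chain
of separations of constant order whose ends are linked. -/
theorem exists_linked_chain (l r : ℕ) : ∃ M, ∀ (V : Type u) [Finite V] (G : SimpleGraph V)
    (A B : ℕ → Set V), SepChain G M A B → (∀ i ≤ M, (A i ∩ B i).ncard ≤ r) →
    ∃ (A' B' : ℕ → Set V) (q : ℕ), q ≤ r ∧ SepChain G l A' B' ∧
      (∀ i ≤ l, (A' i ∩ B' i).ncard = q) ∧
      Nonempty (Linkage G (A' 0 ∩ B' 0) (A' l ∩ B' l) q) := by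
  induction r with
  | zero =>
    refine ⟨l, fun V _ G A B h hr => ⟨A, B, 0, le_rfl, h, fun i hi => by simpa using hr i hi, ?_⟩⟩
    rcases menger G (A 0 ∩ B 0) (A l ∩ B l) 0 with h | ⟨Z, hZ, -⟩
    exacts [h, absurd hZ (by omega)]
  | succ r ih =>
    obtain ⟨M, hM⟩ := ih
    refine ⟨(M + 1) * (l + 1), fun V _ G A B h hr => ?_⟩
    have hidx : ∀ s ≤ M, s * (l + 1) + l ≤ (M + 1) * (l + 1) := by
      intro s hs
      have := Nat.mul_le_mul_right (l + 1) (Nat.succ_le_succ hs)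
      simp only [Nat.succ_eq_add_one, add_mul] at this ⊢
      omega
    -- The chain is split into `M + 1` blocks of `l + 1` separations. If the ends of a block are
    -- joined by `r + 1` paths, all orders in it equal `r + 1`. Otherwise every block admits a
    -- separation of order at most `r` between its ends, and these form a chain for the induction.
    by_cases hex : ∃ s ≤ M, Nonempty (Linkage G (A (s * (l + 1)) ∩ B (s * (l + 1)))
        (A (s * (l + 1) + l) ∩ B (s * (l + 1) + l)) (r + 1))
    · obtain ⟨s, hs, ⟨P⟩⟩ := hex
      have hl := hidx s hs
      refine ⟨fun i => A (s * (l + 1) + i), fun i => B (s * (l + 1) + i), r + 1, le_rfl,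
        h.comp (φ := fun i => s * (l + 1) + i) (fun i j hij => by simpa using hij) hl,
        fun i hi => (hr _ (by omega)).antisymm ?_, ⟨P⟩⟩
      refine P.le_ncard_of_isSep (h.sep _ (by omega)) (fun v hv => ?_) fun v hv => ?_
      · exact h.mono (by omega) (by omega) hv.1
      · exact h.anti _ _ (by omega) (by omega) hv.2
    · have hbetween : ∀ s, ∃ CD : Set V × Set V, s ≤ M → IsSep G CD.1 CD.2 ∧
          A (s * (l + 1)) ⊆ CD.1 ∧ CD.1 ⊆ A (s * (l + 1) + l) ∧
          B (s * (l + 1) + l) ⊆ CD.2 ∧ CD.2 ⊆ B (s * (l + 1)) ∧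
          (CD.1 ∩ CD.2).ncard < r + 1 := by
        intro s
        by_cases hs : s ≤ M
        · have hl := hidx s hs
          rcases (h.sep (s * (l + 1)) (by omega)).linkage_or_exists_between
            (h.sep (s * (l + 1) + l) hl) (h.mono (by omega) hl) (h.anti _ _ (by omega) hl) (r + 1)
            with hP | ⟨C, D, hCD⟩
          · exact absurd ⟨s, hs, hP⟩ hex
          · exact ⟨(C, D), fun _ => hCD⟩
        · exact ⟨(∅, ∅), fun h => absurd h hs⟩
      choose CD hCD using hbetween
      have hlt : ∀ i j, i < j → i * (l + 1) + l < j * (l + 1) := by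
        intro i j hij
        have := Nat.mul_le_mul_right (l + 1) (Nat.succ_le_of_lt hij)
        simp only [Nat.succ_eq_add_one, add_mul] at this ⊢
        omega
      have hchain : SepChain G M (fun s => (CD s).1) (fun s => (CD s).2) := by
        refine ⟨fun i hi => (hCD i hi).1, fun i j hij hj => ?_, fun i j hij hj => ?_⟩
        · have hj' := hidx j hj
          exact ((hCD i (by omega)).2.2.1.trans_ssubset
            (h.ssubset _ _ (hlt i j hij) (by omega))).trans_subset (hCD j hj).2.1
        · rcases hij.eq_or_lt with rfl | hij
          · exact subset_rfl
          have hj' := hidx j hj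
          exact ((hCD j hj).2.2.2.2.1.trans (h.anti _ _ (hlt i j hij).le (by omega))).trans
            (hCD i (by omega)).2.2.2.1
      obtain ⟨A', B', q, hq, h1, h2, h3⟩ := hM V G _ _ hchain
        (fun i hi => Nat.lt_succ_iff.1 (hCD i hi).2.2.2.2.2)
      exact ⟨A', B', q, by omega, h1, h2, h3⟩

end Separations

/-! ### A Ramsey-type lemma for monotone functions of intervals. -/

/-- A bounded function of intervals that is monotone under inclusion is constant on a long
subsequence. -/
theorem exists_constant_subsequence (l n : ℕ) : ∃ M, 0 < M ∧ ∀ (f : ℕ → ℕ → ℕ) (s : ℕ),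
    (∀ a' a b b', s ≤ a' → a' ≤ a → a < b → b ≤ b' → b' ≤ s + M → f a b ≤ f a' b') →
    f s (s + M) ≤ n → ∃ (φ : ℕ → ℕ) (c : ℕ), StrictMono φ ∧ s ≤ φ 0 ∧ φ l ≤ s + M ∧
      ∀ a b, a < b → b ≤ l → f (φ a) (φ b) = c := by
  induction n with
  | zero =>
    refine ⟨l + 1, by omega, fun f s hf hn => ⟨fun k => s + k, 0, fun i j hij => by simpa using hij,
      by simp, by simp, fun a b hab hb => ?_⟩⟩
    have := hf s (s + a) (s + b) (s + (l + 1)) le_rfl (by omega) (by omega) (by omega) le_rfl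
    dsimp only
    omega
  | succ n ih =>
    obtain ⟨M, hM0, hM⟩ := ih
    -- The interval is cut into `l + 1` pieces of length `M`. If each piece has the value of the
    -- whole, monotonicity forces this value on all unions of consecutive pieces; otherwise some
    -- piece has value at most `n`.
    refine ⟨(l + 1) * M, by positivity, fun f s hf hn => ?_⟩
    have hidx : ∀ k k' : ℕ, k < k' → k * M + M ≤ k' * M := by
      intro k k' hk
      have := Nat.mul_le_mul_right M (Nat.succ_le_of_lt hk)
      rwa [Nat.succ_mul] at this
    by_cases hall : ∀ k < l + 1, f (s + k * M) (s + k * M + M) = f s (s + (l + 1) * M)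
    · refine ⟨fun k => s + k * M, f s (s + (l + 1) * M), fun i j hij => ?_, by simp, ?_,
        fun a b hab hb => ?_⟩
      · have := hidx i j hij
        dsimp only
        omega
      · have := hidx l (l + 1) (by omega)
        dsimp only
        omega
      · have h1 := hidx a b hab
        have h2 := hidx b (l + 1) (by omega)
        dsimp only
        refine le_antisymm (hf _ _ _ _ le_rfl (by omega) (by omega) (by omega) le_rfl) ?_
        rw [← hall a (by omega)]
        exact hf _ _ _ _ (by omega) le_rfl (by omega) (by omega) (by omega)
    · push Not at hall
      obtain ⟨k, hk, hne⟩ := hall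
      have hkl := hidx k (l + 1) hk
      have hle := hf s (s + k * M) (s + k * M + M) (s + (l + 1) * M) le_rfl (by omega) (by omega)
        (by omega) le_rfl
      obtain ⟨φ, c, h1, h2, h3, h4⟩ := hM f (s + k * M)
        (fun a' a b b' _ _ _ _ _ => hf a' a b b' (by omega) (by omega) (by omega) (by omega)
          (by omega)) (by omega)
      exact ⟨φ, c, h1, by omega, by omega, h4⟩

/-! ### From tree-width to a bipartite minor or a long chain of separations. -/

section EliminationOrder

universe u

section Tree

variable {U : Type*} {T : SimpleGraph U}

/-- The unique path between two vertices of a tree. -/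
noncomputable def treePath (hT : T.IsTree) (r s : U) : T.Walk r s :=
  (hT.existsUnique_path r s).choose

theorem treePath_isPath (hT : T.IsTree) (r s : U) : (treePath hT r s).IsPath :=
  (hT.existsUnique_path r s).choose_spec.1

theorem eq_treePath (hT : T.IsTree) {r s : U} {p : T.Walk r s} (hp : p.IsPath) :
    p = treePath hT r s :=
  (hT.existsUnique_path r s).choose_spec.2 p hp

/-- The order of a tree with root `r`. -/
def TreeLE (hT : T.IsTree) (r s t : U) : Prop := s ∈ (treePath hT r t).support

variable {hT : T.IsTree} {r s t x : U}

theorem treePath_getVert (i : ℕ) :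
    treePath hT r ((treePath hT r t).getVert i) = (treePath hT r t).take i :=
  (eq_treePath hT ((treePath_isPath hT r t).take i)).symm

theorem TreeLE.exists_getVert (h : TreeLE hT r s t) :
    ∃ i ≤ (treePath hT r t).length, (treePath hT r t).getVert i = s := by
  obtain ⟨i, h1, h2⟩ := SimpleGraph.Walk.mem_support_iff_exists_getVert.1 h
  exact ⟨i, h2, h1⟩

theorem treeLE_getVert {i j : ℕ} (h : i ≤ j) :
    TreeLE hT r ((treePath hT r t).getVert i) ((treePath hT r t).getVert j) := by
  rw [TreeLE, treePath_getVert]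
  have := ((treePath hT r t).take j).getVert_mem_support i
  rwa [SimpleGraph.Walk.take_getVert, min_eq_right h] at this

theorem TreeLE.refl (hT : T.IsTree) (r s : U) : TreeLE hT r s s :=
  SimpleGraph.Walk.end_mem_support _

theorem TreeLE.exists_getVert_le (h : TreeLE hT r s t) (h' : TreeLE hT r t x) :
    ∃ i j, i ≤ j ∧ j ≤ (treePath hT r x).length ∧ (treePath hT r x).getVert i = s ∧
      (treePath hT r x).getVert j = t := by
  obtain ⟨j, hj, rfl⟩ := h'.exists_getVert
  obtain ⟨i, -, hi⟩ := h.exists_getVert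
  rw [treePath_getVert, SimpleGraph.Walk.take_getVert] at hi
  exact ⟨j ⊓ i, j, inf_le_left, hj, hi, rfl⟩

theorem TreeLE.trans (h : TreeLE hT r s t) (h' : TreeLE hT r t x) : TreeLE hT r s x := by
  obtain ⟨i, j, -, -, rfl, -⟩ := h.exists_getVert_le h'
  exact SimpleGraph.Walk.getVert_mem_support _ _

theorem TreeLE.antisymm (h : TreeLE hT r s t) (h' : TreeLE hT r t s) : s = t := by
  obtain ⟨i, j, hij, hj, hi, rfl⟩ := h.exists_getVert_le h'
  have hi' : i = (treePath hT r s).length :=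
    (treePath_isPath hT r s).getVert_injOn (show i ≤ _ by omega)
      (show _ ≤ (treePath hT r s).length from le_rfl)
      (by rw [hi, SimpleGraph.Walk.getVert_length])
  have : j = (treePath hT r s).length := by omega
  rw [this, SimpleGraph.Walk.getVert_length]

theorem TreeLE.total (h : TreeLE hT r s x) (h' : TreeLE hT r t x) :
    TreeLE hT r s t ∨ TreeLE hT r t s := by
  obtain ⟨i, -, rfl⟩ := h.exists_getVert
  obtain ⟨j, -, rfl⟩ := h'.exists_getVert
  rcases le_total i j with hij | hij
  exacts [.inl (treeLE_getVert hij), .inr (treeLE_getVert hij)]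

variable {V : Type*} {G : SimpleGraph V} {Y : U → Set V}

theorem IsTreeDecomposition.mem_of_between (hY : IsTreeDecomposition G T Y)
    (h : TreeLE hT r s t) (h' : TreeLE hT r t x) {v : V} (hs : v ∈ Y s) (hx : v ∈ Y x) :
    v ∈ Y t := by
  obtain ⟨i, j, hij, hj, rfl, rfl⟩ := h.exists_getVert_le h'
  refine hY.inter_subset _ _ _ ((treePath hT r x).drop i) ((treePath_isPath hT r x).drop i) ?_
    ⟨hs, hx⟩
  have := ((treePath hT r x).drop i).getVert_mem_support (j - i)
  rwa [SimpleGraph.Walk.drop_getVert, Nat.add_sub_cancel' hij] at this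

/-- Take a node nearest to the root whose bag contains `v`. The path from the root to it has no
earlier node of this kind, so it concatenates with the path to any other such node to form a path.
-/
theorem IsTreeDecomposition.exists_top (hY : IsTreeDecomposition G T Y) (hT : T.IsTree) (r : U)
    (v : V) : ∃ t, v ∈ Y t ∧ ∀ s, v ∈ Y s → TreeLE hT r t s := by
  obtain ⟨t, ht, hmin⟩ : ∃ t, v ∈ Y t ∧ ∀ s, v ∈ Y s →
      (treePath hT r t).length ≤ (treePath hT r s).length := by
    obtain ⟨t, ht, hmin⟩ := (measure fun t => (treePath hT r t).length).wf.has_min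
      {t | v ∈ Y t} (hY.vertex_mem v)
    exact ⟨t, ht, fun s hs => not_lt.1 (hmin s hs)⟩
  refine ⟨t, ht, fun s hs => ?_⟩
  have hpath : ((treePath hT r t).append (treePath hT t s)).IsPath := by
    rw [SimpleGraph.Walk.isPath_def, SimpleGraph.Walk.support_append]
    have hnodup := (treePath_isPath hT t s).support_nodup
    rw [← SimpleGraph.Walk.cons_tail_support, List.nodup_cons] at hnodup
    refine List.Nodup.append (treePath_isPath hT r t).support_nodup hnodup.2 fun m hm hm' => ?_
    have hvm : v ∈ Y m := hY.inter_subset _ _ _ _ (treePath_isPath hT t s)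
      (List.mem_of_mem_tail hm') ⟨ht, hs⟩
    obtain ⟨i, hi, rfl⟩ := TreeLE.exists_getVert hm
    have := hmin _ hvm
    rw [treePath_getVert, SimpleGraph.Walk.take_length] at this
    have : i = (treePath hT r t).length := by omega
    rw [this, SimpleGraph.Walk.getVert_length] at hm'
    exact hnodup.1 hm'
  rw [TreeLE, ← eq_treePath hT hpath]
  exact SimpleGraph.Walk.mem_support_append_iff _ _ |>.2 (.inl (SimpleGraph.Walk.end_mem_support _))

end Tree

/-- A forest order on the vertices of `G` together with bags `K` of size at most `w + 1` of
predecessors, such that adjacent vertices are comparable and the smaller one is in the bag of the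
larger one. -/
structure IsElimOrder {V : Type u} (G : SimpleGraph V) (w : ℕ) (le : V → V → Prop)
    (K : V → Set V) : Prop where
  refl : ∀ u, le u u
  trans : ∀ u v x, le u v → le v x → le u x
  antisymm : ∀ u v, le u v → le v u → u = v
  total_below : ∀ u v x, le u x → le v x → le u v ∨ le v u
  le_of_mem : ∀ u v, v ∈ K u → le v u
  mem_of_between : ∀ u v x, le u v → le v x → u ∈ K x → u ∈ K v
  adj : ∀ u v, G.Adj u v → (le u v ∧ u ∈ K v) ∨ (le v u ∧ v ∈ K u)
  self_mem : ∀ u, u ∈ K u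
  ncard_le : ∀ u, (K u).ncard ≤ w + 1

/-- Vertices are compared by the tree order of their highest nodes, ties being broken by an
enumeration. Two vertices in a common bag are comparable, because both highest nodes lie on the path
from the root to that bag. -/
theorem exists_isElimOrder {V : Type u} [Finite V] {G : SimpleGraph V} {w : ℕ}
    (h : TreewidthAtMost w G) : ∃ le K, IsElimOrder G w le K := by
  obtain ⟨n, T, Y, hY, hw⟩ := h
  have hT := hY.isTree
  obtain ⟨r⟩ := hT.connected.nonempty
  choose top htop htop_le using hY.exists_top hT r
  let e := Finite.equivFin V
  let le : V → V → Prop := fun u v =>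
    (TreeLE hT r (top u) (top v) ∧ top u ≠ top v) ∨ (top u = top v ∧ e u ≤ e v)
  have hle : ∀ {u v}, le u v → TreeLE hT r (top u) (top v) := by
    rintro u v (h | h)
    · exact h.1
    · rw [h.1]; exact .refl _ _ _
  have hcomp : ∀ u v, TreeLE hT r (top u) (top v) → le u v ∨ le v u := by
    intro u v h
    by_cases heq : top u = top v
    · rcases le_total (e u) (e v) with h' | h'
      exacts [.inl (.inr ⟨heq, h'⟩), .inr (.inr ⟨heq.symm, h'⟩)]
    · exact .inl (.inl ⟨h, heq⟩)
  have htotal : ∀ u v t, TreeLE hT r (top u) t → TreeLE hT r (top v) t → le u v ∨ le v u := by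
    intro u v t hu hv
    rcases hu.total hv with h | h
    exacts [hcomp u v h, (hcomp v u h).symm]
  refine ⟨le, fun u => {v | v ∈ Y (top u) ∧ le v u}, ?_, ?_, ?_, ?_, ?_, ?_, ?_, ?_, ?_⟩
  · exact fun u => .inr ⟨rfl, le_rfl⟩
  · rintro u v x (h | h) (h' | h')
    · refine .inl ⟨h.1.trans h'.1, fun heq => ?_⟩
      rw [heq] at h
      exact h.2 (h.1.antisymm h'.1)
    · exact .inl (h'.1 ▸ h)
    · exact .inl (h.1 ▸ h')
    · exact .inr ⟨h.1.trans h'.1, h.2.trans h'.2⟩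
  · rintro u v (h | h) (h' | h')
    · exact absurd (h.1.antisymm h'.1) h.2
    · exact absurd h'.1.symm h.2
    · exact absurd h.1.symm h'.2
    · exact e.injective (le_antisymm h.2 h'.2)
  · exact fun u v x h h' => htotal u v _ (hle h) (hle h')
  · exact fun u v h => h.2
  · exact fun u v x h h' hu =>
      ⟨hY.mem_of_between (hle h) (hle h') (htop u) hu.1, h⟩
  · intro u v huv
    obtain ⟨s, hus, hvs⟩ := hY.edge_mem u v huv
    rcases htotal u v s (htop_le u s hus) (htop_le v s hvs) with h | h
    · exact .inl ⟨h, hY.mem_of_between (hle h) (htop_le v s hvs) (htop u) hus, h⟩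
    · exact .inr ⟨h, hY.mem_of_between (hle h) (htop_le u s hus) (htop v) hvs, h⟩
  · exact fun u => ⟨htop u, .inr ⟨rfl, le_rfl⟩⟩
  · intro u
    have h1 : {v | v ∈ Y (top u) ∧ le v u}.encard ≤ w + 1 :=
      (Set.encard_le_encard fun v hv => hv.1).trans (hw (top u))
    rw [← Set.Finite.cast_ncard_eq (Set.toFinite _)] at h1
    exact_mod_cast h1

/-- Many disjoint connected parts attaching to a common small set give a complete bipartite
minor. -/
theorem isMinorOf_completeBipartiteGraph {V : Type u} [Finite V] {G : SimpleGraph V} {p k w : ℕ}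
    (hp : IsVertexConnected p G) {Z : Set V} (hZ : Z.ncard ≤ w + 1) (S : Finset V)
    (hS : 2 ^ (w + 1) * k + 2 ≤ S.card) (D : V → Set V) (hD : ∀ v ∈ S, v ∈ D v)
    (hdisj : ∀ u ∈ S, ∀ v ∈ S, ∀ x, x ∈ D u → x ∈ D v → u = v)
    (hnbr : ∀ v ∈ S, ∀ x y, G.Adj x y → x ∈ D v → y ∉ D v → y ∈ Z)
    (hDZ : ∀ v ∈ S, ∀ x ∈ D v, x ∉ Z) :
    IsMinorOf (completeBipartiteGraph (Fin p) (Fin k)) G := by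
  classical
  have := Fintype.ofFinite V
  -- `D v` need not be connected, so the branch set is the component of `v` in it. Its neighbours in
  -- `Z` number at least `p`, since otherwise they would separate `v` from another member of `S`.
  -- The summand 2 in `hS` provides such a member even if `k = 0`.
  let C : V → Set V := fun v => {x | ConnIn G (D v) v x}
  let N : V → Finset V := fun v => Finset.univ.filter fun z => z ∈ Z ∧ ∃ x ∈ C v, G.Adj x z
  have hN : ∀ v ∈ S, p ≤ (N v).card := by
    intro v hv
    by_contra! hlt
    obtain ⟨v', hv', hne⟩ := Finset.exists_mem_ne (by omega : 1 < S.card) v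
    have hc := connIn_of_connected_induce (hp.2 (N v) hlt) (u := v) (v := v')
      (by simpa [N] using fun h => absurd h (hDZ v hv v (hD v hv)))
      (by simpa [N] using fun h => absurd h (hDZ v' hv' v' (hD v' hv')))
    have hcv : v' ∈ C v := hc.induction (c := fun x => x ∈ C v) (.refl (hD v hv)) (by
      intro x y hx hy hxy hcx
      refine ConnIn.tail hcx hxy ?_
      by_contra hyD
      refine hy ?_
      simp only [N, Finset.mem_filter, Finset.mem_univ, true_and]
      exact ⟨hnbr v hv x y hxy hcx.right_mem hyD, x, hcx, hxy⟩)
    exact hne (hdisj v' hv' v hv v' (hD v' hv') hcv.right_mem)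
  -- There are at most `2 ^ (w + 1)` candidates for the neighbourhood, so more than `k` members of
  -- `S` share one.
  obtain ⟨N0, -, hN0⟩ := Finset.exists_lt_card_fiber_of_mul_lt_card_of_maps_to (s := S)
    (t := Z.toFinset.powerset) (f := N) (n := k) (by
      intro v _
      rw [Finset.mem_powerset]
      intro z hz
      simp only [N, Finset.mem_filter] at hz
      simpa using hz.2.1) (by
      rw [Finset.card_powerset, ← Set.ncard_eq_toFinset_card']
      have := Nat.pow_le_pow_right (n := 2) (by omega) hZ
      have := Nat.mul_le_mul_right k this
      omega)
  obtain ⟨ι⟩ : Nonempty (Fin k ↪ (S.filter fun x => N x = N0)) :=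
    Function.Embedding.nonempty_of_card_le (by rw [Fintype.card_fin, Fintype.card_coe]; exact hN0.le)
  have hι : ∀ b, (ι b).1 ∈ S ∧ N (ι b).1 = N0 := fun b => Finset.mem_filter.1 (ι b).2
  obtain ⟨v0, hv0⟩ := Finset.card_pos.1 (by omega : 0 < (S.filter fun x => N x = N0).card)
  have hv0 := Finset.mem_filter.1 hv0
  obtain ⟨κ⟩ : Nonempty (Fin p ↪ N0) :=
    Function.Embedding.nonempty_of_card_le (by simpa [hv0.2] using hN v0 hv0.1)
  have hκ : ∀ a, (κ a).1 ∈ Z ∧ ∀ b, ∃ x ∈ C (ι b).1, G.Adj x (κ a).1 := by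
    intro a
    have h0 : ∀ v, N v = N0 → (κ a).1 ∈ N v := fun v hv => hv ▸ (κ a).2
    exact ⟨(Finset.mem_filter.1 (h0 v0 hv0.2)).2.1,
      fun b => (Finset.mem_filter.1 (h0 _ (hι b).2)).2.2⟩
  have hCZ : ∀ b, ∀ x ∈ C (ι b).1, x ∉ Z := fun b x hx => hDZ _ (hι b).1 x hx.right_mem
  refine ⟨Sum.elim (fun a => {(κ a).1}) (fun b => C (ι b).1), ?_, ?_, ?_⟩
  · rintro (a | b)
    · exact connected_induce_of_connIn (u := (κ a).1) rfl (by rintro v rfl; exact .refl rfl)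
    · refine connected_induce_of_connIn (u := (ι b).1) (.refl (hD _ (hι b).1)) fun v hv => ?_
      have := ConnIn.restrict (X := C (ι b).1) hv (.refl (hD _ (hι b).1))
        fun x y hx _ hy hxy => ConnIn.tail hx hxy hy
      exact this.mono_set Set.inter_subset_left
  · rintro (a | b) (a' | b') hne
    · simp only [Sum.elim_inl, Set.disjoint_singleton, ne_eq]
      exact fun h => hne (congrArg _ (κ.injective (Subtype.ext h)))
    · simp only [Sum.elim_inl, Sum.elim_inr, Set.disjoint_singleton_left]
      exact fun h => hCZ b' _ h (hκ a).1
    · simp only [Sum.elim_inl, Sum.elim_inr, Set.disjoint_singleton_right]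
      exact fun h => hCZ b _ h (hκ a').1
    · simp only [Sum.elim_inr]
      rw [Set.disjoint_left]
      intro x hx hx'
      refine hne (congrArg _ (ι.injective (Subtype.ext ?_)))
      exact hdisj _ (hι b).1 _ (hι b').1 x (ConnIn.right_mem hx) (ConnIn.right_mem hx')
  · rintro (a | b) (a' | b') hadj
    · simp at hadj
    · obtain ⟨x, hx, hxa⟩ := (hκ a).2 b'
      exact ⟨_, rfl, x, hx, hxa.symm⟩
    · obtain ⟨x, hx, hxa⟩ := (hκ a').2 b
      exact ⟨x, hx, _, rfl, hxa⟩
    · simp at hadj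

namespace IsElimOrder

variable {V : Type u} {G : SimpleGraph V} {w : ℕ} {le : V → V → Prop} {K : V → Set V}

/-- The outer end of such an edge must be the smaller one and so lies in the bag of the inner end;
bags pass this down to `v`. Hence the proper predecessors in the bag of `v` cut off all that lies
above `v`. -/
theorem bag_of_adj (h : IsElimOrder G w le K) {v x y : V} (hxy : G.Adj x y) (hx : le v x)
    (hy : ¬ le v y) : y ∈ K v ∧ y ≠ v := by
  refine ⟨?_, fun h' => hy (h' ▸ h.refl v)⟩
  rcases h.adj x y hxy with h' | h'
  · exact absurd (h.trans _ _ _ hx h'.1) hy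
  · exact h.mem_of_between y v x ((h.total_below _ _ _ h'.1 hx).resolve_right hy) hx h'.2

theorem isSep (h : IsElimOrder G w le K) (v : V) :
    IsSep G {x | ¬ le v x} ({x | le v x} ∪ K v \ {v}) where
  cover x := by
    by_cases hx : le v x
    exacts [.inr (.inl hx), .inl hx]
  edge x y hxy := by
    by_cases hx : le v x <;> by_cases hy : le v y
    · exact .inr ⟨.inl hx, .inl hy⟩
    · exact .inr ⟨.inl hx, .inr (h.bag_of_adj hxy hx hy)⟩
    · exact .inr ⟨.inr (h.bag_of_adj hxy.symm hy hx), .inl hy⟩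
    · exact .inl ⟨hx, hy⟩

theorem ncard_sep_le [Finite V] (h : IsElimOrder G w le K) (v : V) :
    ({x | ¬ le v x} ∩ ({x | le v x} ∪ K v \ {v})).ncard ≤ w := by
  have h1 : ({x | ¬ le v x} ∩ ({x | le v x} ∪ K v \ {v})) ⊆ K v \ {v} := by
    rintro x ⟨hx, hx' | hx'⟩
    exacts [absurd hx' hx, hx']
  have h2 := Set.ncard_le_ncard h1 (Set.toFinite _)
  have h3 := Set.ncard_sdiff_singleton_add_one (h.self_mem v) (Set.toFinite _)
  have h4 := h.ncard_le v
  omega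

/-- The number of proper predecessors. -/
noncomputable def depth (le : V → V → Prop) (v : V) : ℕ := {x | le x v ∧ x ≠ v}.ncard

theorem depth_lt [Finite V] (h : IsElimOrder G w le K) {u v : V} (huv : le u v) (hne : u ≠ v) :
    depth le u < depth le v := by
  refine Set.ncard_lt_ncard ⟨?_, fun hsub => ?_⟩ (Set.toFinite _)
  · rintro x ⟨hx, hxu⟩
    refine ⟨h.trans _ _ _ hx huv, ?_⟩
    rintro rfl
    exact hxu (h.antisymm _ _ hx huv)
  · exact (hsub ⟨huv, hne⟩).2 rfl

theorem exists_parent [Finite V] (h : IsElimOrder G w le K) {v : V} (hv : depth le v ≠ 0) :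
    ∃ u, le u v ∧ u ≠ v ∧ depth le u + 1 = depth le v ∧ ∀ x, le x v → x ≠ v → le x u := by
  have hne : {x | le x v ∧ x ≠ v}.Nonempty := Set.nonempty_of_ncard_ne_zero hv
  obtain ⟨u, hu, hmax⟩ := Set.exists_max_image _ (depth le) (Set.toFinite _) hne
  have hall : ∀ x, le x v → x ≠ v → le x u := by
    intro x hx hxv
    rcases h.total_below _ _ _ hx hu.1 with h' | h'
    · exact h'
    · by_cases hux : u = x
      · exact hux ▸ h.refl u
      · exact absurd (h.depth_lt h' hux) (not_lt.2 (hmax x ⟨hx, hxv⟩))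
  refine ⟨u, hu.1, hu.2, ?_, hall⟩
  have heq : {x | le x v ∧ x ≠ v} = insert u {x | le x u ∧ x ≠ u} := by
    ext x
    simp only [Set.mem_ofPred_eq, Set.mem_insert_iff]
    constructor
    · intro hx
      by_cases hxu : x = u
      exacts [.inl hxu, .inr ⟨hall x hx.1 hx.2, hxu⟩]
    · rintro (rfl | hx)
      · exact hu
      · refine ⟨h.trans _ _ _ hx.1 hu.1, ?_⟩
        rintro rfl
        exact hx.2 (h.antisymm _ _ hx.1 hu.1)
  rw [depth, depth, heq, Set.ncard_insert_of_notMem (by simp) (Set.toFinite _)]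

theorem exists_chain [Finite V] (h : IsElimOrder G w le K) (m : ℕ) (v : V) (hv : depth le v = m) :
    ∃ a : ℕ → V, a m = v ∧ ∀ i < m, le (a i) (a (i + 1)) ∧ a i ≠ a (i + 1) := by
  induction m generalizing v with
  | zero => exact ⟨fun _ => v, rfl, by omega⟩
  | succ m ih =>
    obtain ⟨u, h1, h2, h3, -⟩ := h.exists_parent (v := v) (by omega)
    obtain ⟨a, ha, hle⟩ := ih u (by omega)
    refine ⟨fun i => if i = m + 1 then v else a i, by simp, fun i hi => ?_⟩
    by_cases him : i = m
    · subst him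
      simpa [ha] using ⟨h1, h2⟩
    · have h1 : i ≠ m + 1 := by omega
      simpa [h1, him] using hle i (by omega)

/-- The separations cut off the up-sets along a chain of predecessors of `v`. Inclusions are strict
because `a i` belongs to the up-set of `a i` but to no later one. -/
theorem exists_sepChain [Finite V] (h : IsElimOrder G w le K) (m : ℕ) (v : V) (hv : depth le v = m) :
    ∃ A B : ℕ → Set V, SepChain G m A B ∧ ∀ i ≤ m, (A i ∩ B i).ncard ≤ w := by
  obtain ⟨a, -, ha⟩ := h.exists_chain m v hv
  have hle : ∀ i j, i ≤ j → j ≤ m → le (a i) (a j) := by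
    intro i j hij
    induction j, hij using Nat.le_induction with
    | base => exact fun _ => h.refl _
    | succ j hj ih => exact fun hjm => h.trans _ _ _ (ih (by omega)) (ha j (by omega)).1
  have hlt : ∀ i j, i < j → j ≤ m → ¬ le (a j) (a i) := by
    intro i j hij hj hji
    have h1 := hle (i + 1) j (by omega) hj
    exact (ha i (by omega)).2 (h.antisymm _ _ (ha i (by omega)).1 (h.trans _ _ _ h1 hji))
  refine ⟨fun i => {x | ¬ le (a i) x}, fun i => {x | le (a i) x} ∪ K (a i) \ {a i},
    ⟨fun i _ => h.isSep _, fun i j hij hj => ⟨fun x hx hx' => ?_, fun hsub => ?_⟩,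
      fun i j hij hj => ?_⟩, fun i _ => h.ncard_sep_le _⟩
  · exact hx (h.trans _ _ _ (hle i j hij.le hj) hx')
  · exact hsub (hlt i j hij hj) (h.refl _)
  · rintro y (hy | ⟨hy, hne⟩)
    · exact .inl (h.trans _ _ _ (hle i j hij hj) hy)
    · by_cases hay : le (a i) y
      · exact .inl hay
      · have := (h.total_below _ _ _ (h.le_of_mem _ _ hy) (hle i j hij hj)).resolve_right hay
        exact .inr ⟨h.mem_of_between _ _ _ this (hle i j hij hj) hy,
          fun h' => hay (h' ▸ h.refl _)⟩

/-- If no vertex has large depth, then many vertices have a common parent or no parent. -/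
theorem isMinorOf_of_depth_le [Finite V] (h : IsElimOrder G w le K) {p k m : ℕ} (hp : IsVertexConnected p G)
    (hm : ∀ v, depth le v ≤ m)
    (hV : ∑ i ∈ Finset.range (m + 1), (2 ^ (w + 1) * k + 2) ^ (i + 1) < Nat.card V) :
    IsMinorOf (completeBipartiteGraph (Fin p) (Fin k)) G := by
  classical
  have := Fintype.ofFinite V
  set d := 2 ^ (w + 1) * k + 2 with hd
  by_contra hno
  have hroots : (Finset.univ.filter fun v => depth le v = 0).card ≤ d := by
    by_contra! hlt
    refine hno (isMinorOf_completeBipartiteGraph hp (Z := ∅) (w := w) (by simp) _ hlt.le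
      (fun v => {x | le v x}) (fun v _ => h.refl v) ?_ ?_ (by simp))
    · intro u hu v hv x hux hvx
      simp only [Finset.mem_filter, Finset.mem_univ, true_and] at hu hv
      by_contra hne
      rcases h.total_below _ _ _ hux hvx with h' | h'
      · have := h.depth_lt h' hne; omega
      · have := h.depth_lt h' (Ne.symm hne); omega
    · intro v hv x y hxy hx hy
      simp only [Finset.mem_filter, Finset.mem_univ, true_and] at hv
      have hb := h.bag_of_adj hxy hx hy
      have := h.depth_lt (h.le_of_mem _ _ hb.1) hb.2
      omega
  have hpar : ∀ v, ∃ u, depth le v ≠ 0 → le u v ∧ u ≠ v ∧ depth le u + 1 = depth le v ∧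
      ∀ x, le x v → x ≠ v → le x u := by
    intro v
    by_cases hv : depth le v = 0
    · exact ⟨v, fun h => absurd hv h⟩
    · obtain ⟨u, hu⟩ := h.exists_parent hv
      exact ⟨u, fun _ => hu⟩
  choose par hpar using hpar
  -- Edges leaving the up-set of a child of `u` lead to its proper predecessors. These are at most
  -- `u`, so they lie in the bag of `u`, which serves as the common attachment set.
  have hchildren : ∀ u i, (Finset.univ.filter fun v => depth le v = i + 1 ∧ par v = u).card ≤ d := by
    intro u i
    by_contra! hlt
    refine hno (isMinorOf_completeBipartiteGraph hp (h.ncard_le u) _ hlt.le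
      (fun v => {x | le v x}) (fun v _ => h.refl v) ?_ ?_ ?_)
    · intro a ha b hb x hax hbx
      simp only [Finset.mem_filter, Finset.mem_univ, true_and] at ha hb
      by_contra hne
      rcases h.total_below _ _ _ hax hbx with h' | h'
      · have := h.depth_lt h' hne; omega
      · have := h.depth_lt h' (Ne.symm hne); omega
    · intro v hv x y hxy hx hy
      simp only [Finset.mem_filter, Finset.mem_univ, true_and] at hv
      have hb := h.bag_of_adj hxy hx hy
      obtain ⟨h1, h2, h3, h4⟩ := hpar v (by omega)
      rw [hv.2] at h1 h4
      exact h.mem_of_between _ _ _ (h4 y (h.le_of_mem _ _ hb.1) hb.2) h1 hb.1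
    · intro v hv x hx hxu
      simp only [Finset.mem_filter, Finset.mem_univ, true_and] at hv
      obtain ⟨h1, h2, h3, h4⟩ := hpar v (by omega)
      rw [hv.2] at h1 h2
      exact h2 (h.antisymm _ _ h1 (h.trans _ _ _ hx (h.le_of_mem _ _ hxu)))
  have hlevel : ∀ i, (Finset.univ.filter fun v => depth le v = i).card ≤ d ^ (i + 1) := by
    intro i
    induction i with
    | zero => simpa using hroots
    | succ i ih =>
      calc _ ≤ d * (Finset.univ.filter fun v => depth le v = i).card := by
            refine Finset.card_le_mul_card_image_of_maps_to (f := par) ?_ d fun u _ => ?_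
            · intro v hv
              simp only [Finset.mem_filter, Finset.mem_univ, true_and] at hv ⊢
              have := (hpar v (by omega)).2.2.1
              omega
            · rw [Finset.filter_filter]
              exact hchildren u i
        _ ≤ d * d ^ (i + 1) := Nat.mul_le_mul_left _ ih
        _ = d ^ (i + 1 + 1) := by rw [pow_succ' d (i + 1)]
  have hcard : Nat.card V = ∑ i ∈ Finset.range (m + 1),
      (Finset.univ.filter fun v => depth le v = i).card := by
    rw [Nat.card_eq_fintype_card, ← Finset.card_univ]
    exact Finset.card_eq_sum_card_fiberwise fun v _ => by
      simpa using Nat.lt_succ_of_le (hm v)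
  exact absurd hV (not_lt.2 (hcard ▸ Finset.sum_le_sum fun i _ => hlevel i))

end IsElimOrder

/-- A large `p`-connected graph of bounded tree-width has a complete bipartite minor or a long
chain of separations of bounded order. -/
theorem exists_minor_or_sepChain (p k w m : ℕ) : ∃ N, ∀ (V : Type u) [Finite V]
    (G : SimpleGraph V), IsVertexConnected p G → TreewidthAtMost w G → N ≤ Nat.card V →
    IsMinorOf (completeBipartiteGraph (Fin p) (Fin k)) G ∨
      ∃ A B : ℕ → Set V, SepChain G m A B ∧ ∀ i ≤ m, (A i ∩ B i).ncard ≤ w := by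
  refine ⟨∑ i ∈ Finset.range (m + 1), (2 ^ (w + 1) * k + 2) ^ (i + 1) + 1,
    fun V _ G hp hw hN => ?_⟩
  obtain ⟨le, K, h⟩ := exists_isElimOrder hw
  by_cases hdepth : ∀ v, IsElimOrder.depth le v ≤ m
  · exact .inl (h.isMinorOf_of_depth_le hp hdepth (by omega))
  · right
    push Not at hdepth
    obtain ⟨v, hv⟩ := hdepth
    obtain ⟨A, B, hAB, hcard⟩ := h.exists_sepChain _ v rfl
    exact ⟨A, B, hAB.comp (φ := id) strictMono_id hv.le, fun i hi => hcard i (by omega)⟩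

end EliminationOrder

/-! ### Positions on the paths of a linkage and crossings with separations. -/

namespace Linkage

variable {V : Type*} {G : SimpleGraph V} {X Y : Set V} {n : ℕ}

/-- The `i`-th vertex of the `j`-th path. -/
def vert (P : Linkage G X Y n) (j : Fin n) (i : ℕ) : V := (P.path j).getVert i

/-- The length of the `j`-th path. -/
def len (P : Linkage G X Y n) (j : Fin n) : ℕ := (P.path j).length

/-- The vertex set of the linkage. -/
def support (P : Linkage G X Y n) : Set V := ⋃ j, P.verts j

variable (P : Linkage G X Y n)

theorem mem_support_iff {x : V} : x ∈ P.support ↔ ∃ j, x ∈ P.verts j := Set.mem_iUnion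

theorem vert_mem (j : Fin n) (i : ℕ) : P.vert j i ∈ P.verts j :=
  (P.path j).getVert_mem_support i

theorem vert_mem_support (j : Fin n) (i : ℕ) : P.vert j i ∈ P.support :=
  P.mem_support_iff.2 ⟨j, P.vert_mem j i⟩

theorem vert_zero (j : Fin n) : P.vert j 0 = P.src j := (P.path j).getVert_zero

theorem vert_len (j : Fin n) : P.vert j (P.len j) = P.tgt j := (P.path j).getVert_length

variable {P}

theorem exists_vert {j : Fin n} {x : V} (h : x ∈ P.verts j) : ∃ i ≤ P.len j, P.vert j i = x := by
  obtain ⟨i, h1, h2⟩ := SimpleGraph.Walk.mem_support_iff_exists_getVert.1 h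
  exact ⟨i, h2, h1⟩

theorem vert_inj {j : Fin n} {i i' : ℕ} (hi : i ≤ P.len j) (hi' : i' ≤ P.len j)
    (h : P.vert j i = P.vert j i') : i = i' :=
  (P.isPath j).getVert_injOn hi hi' h

theorem adj_vert {j : Fin n} {i : ℕ} (hi : i < P.len j) :
    G.Adj (P.vert j i) (P.vert j (i + 1)) :=
  (P.path j).adj_getVert_succ hi

theorem connIn_vert {Z : Set V} {j : Fin n} {a b : ℕ} (hab : a ≤ b) (hb : b ≤ P.len j)
    (hZ : ∀ i, a ≤ i → i ≤ b → P.vert j i ∈ Z) : ConnIn G Z (P.vert j a) (P.vert j b) :=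
  connIn_of_fun _ a b hab (fun _ _ hi => adj_vert (by omega)) hZ

theorem exists_restrict (P : Linkage G X Y n) {X' Y' : Set V} (a b : Fin n → ℕ)
    (hab : ∀ j, a j ≤ b j) (hb : ∀ j, b j ≤ P.len j) (hX : ∀ j, P.vert j (a j) ∈ X')
    (hY : ∀ j, P.vert j (b j) ∈ Y') :
    ∃ P' : Linkage G X' Y' n, ∀ j, P'.len j = b j - a j ∧
      ∀ i ≤ b j - a j, P'.vert j i = P.vert j (a j + i) := by
  refine exists_linkage_of_fun (fun j => b j - a j) (fun j i => P.vert j (a j + i)) ?_ ?_ ?_ ?_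
  · intro j i hi
    have := hb j
    exact adj_vert (by omega)
  · intro j j' i i' hi hi' h
    have hjj' : j = j' := P.eq_of_mem (P.vert_mem j _) (h ▸ P.vert_mem j' _)
    subst hjj'
    have h1 := hb j
    have h2 := hab j
    have := vert_inj (by omega) (by omega) h
    exact ⟨rfl, by omega⟩
  · exact hX
  · intro j
    simpa [Nat.add_sub_cancel' (hab j)] using hY j

theorem isTrivial_iff {j : Fin n} : P.IsTrivial j ↔ P.src j = P.tgt j := by
  constructor
  · rintro ⟨x, hx⟩
    have h1 : P.src j ∈ P.verts j := (P.path j).start_mem_support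
    have h2 : P.tgt j ∈ P.verts j := (P.path j).end_mem_support
    rw [hx] at h1 h2
    rw [h1, h2]
  · intro h
    rw [← P.vert_zero, ← P.vert_len] at h
    have hlen := vert_inj (by omega) le_rfl h
    refine ⟨P.src j, Set.eq_singleton_iff_unique_mem.2 ⟨(P.path j).start_mem_support, ?_⟩⟩
    intro x hx
    obtain ⟨i, hi, rfl⟩ := exists_vert hx
    rw [show i = 0 by omega, P.vert_zero]

theorem isTrivial_iff_len {j : Fin n} : P.IsTrivial j ↔ P.len j = 0 := by
  rw [isTrivial_iff, ← P.vert_zero, ← P.vert_len]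
  exact ⟨fun h => (vert_inj (by omega) le_rfl h).symm, fun h => by rw [h]⟩

theorem graph_verts : P.graph.verts = P.support := by
  simp only [graph, graphOf, SimpleGraph.Subgraph.verts_iSup, Set.mem_univ, Set.iUnion_true,
    support, verts, SimpleGraph.Walk.verts_toSubgraph]

theorem graph_adj {x y : V} : P.graph.Adj x y ↔ ∃ j, (P.path j).toSubgraph.Adj x y := by
  simp [graph, graphOf]

theorem mem_verts_of_toSubgraph_adj {j : Fin n} {x y : V} (h : (P.path j).toSubgraph.Adj x y) :
    x ∈ P.verts j ∧ y ∈ P.verts j := by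
  have h1 := (P.path j).toSubgraph.edge_vert h
  have h2 := (P.path j).toSubgraph.edge_vert h.symm
  rw [SimpleGraph.Walk.mem_verts_toSubgraph] at h1 h2
  exact ⟨h1, h2⟩

theorem toSubgraph_adj_iff {j : Fin n} {x y : V} : (P.path j).toSubgraph.Adj x y ↔
    ∃ i < P.len j, (x = P.vert j i ∧ y = P.vert j (i + 1)) ∨
      (y = P.vert j i ∧ x = P.vert j (i + 1)) := by
  rw [SimpleGraph.Walk.toSubgraph_adj_iff]
  constructor
  · rintro ⟨i, h, hi⟩
    rw [Sym2.eq_iff] at h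
    refine ⟨i, hi, ?_⟩
    rcases h with h | h
    exacts [.inl ⟨h.1.symm, h.2.symm⟩, .inr ⟨h.1.symm, h.2.symm⟩]
  · rintro ⟨i, hi, h⟩
    refine ⟨i, ?_, hi⟩
    rw [Sym2.eq_iff]
    rcases h with h | h
    exacts [.inl ⟨h.1.symm, h.2.symm⟩, .inr ⟨h.1.symm, h.2.symm⟩]

/-- The positions at which the paths of a linkage cross a separation whose order is the
cardinality of the linkage. -/
theorem exists_pos [Finite V] (P : Linkage G X Y n) {A B : Set V} (h : IsSep G A B) (hX : X ⊆ A)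
    (hY : Y ⊆ B) (hn : (A ∩ B).ncard = n) :
    ∃ a : Fin n → ℕ, (∀ j, a j ≤ P.len j) ∧
      (∀ j, ∀ k ≤ P.len j, (P.vert j k ∈ A ↔ k ≤ a j) ∧ (P.vert j k ∈ B ↔ a j ≤ k)) ∧
      ∀ s ∈ A ∩ B, ∃ j, s = P.vert j (a j) := by
  have hex : ∀ j, ∃ i ≤ P.len j, P.vert j i ∈ A ∩ B := by
    intro j
    obtain ⟨s, hs, hsP⟩ := h.exists_mem_inter (P.connIn j) (hX (P.src_mem j)) (hY (P.tgt_mem j))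
    obtain ⟨i, hi, rfl⟩ := exists_vert hsP
    exact ⟨i, hi, hs⟩
  choose a ha hmem using hex
  have hinj : Function.Injective fun j => P.vert j (a j) := fun i j hij =>
    P.eq_of_mem (P.vert_mem i _) (by rw [show P.vert i (a i) = _ from hij]; exact P.vert_mem j _)
  -- Each of the `n` paths uses a vertex of `A ∩ B`, and there are only `n` of them. So every path
  -- crosses exactly once and changes sides there.
  have hrange : Set.range (fun j => P.vert j (a j)) = A ∩ B := by
    refine Set.eq_of_subset_of_ncard_le (by rintro _ ⟨j, rfl⟩; exact hmem j) ?_ (Set.toFinite _)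
    rw [Set.ncard_range_of_injective hinj, hn]
    simp
  have hsurj : ∀ s ∈ A ∩ B, ∃ j, s = P.vert j (a j) := by
    intro s hs
    rw [← hrange] at hs
    obtain ⟨j, hj⟩ := hs
    exact ⟨j, hj.symm⟩
  have huniq : ∀ j, ∀ k ≤ P.len j, P.vert j k ∈ A ∩ B → k = a j := by
    intro j k hk hs
    obtain ⟨j', hj'⟩ := hsurj _ hs
    have : j = j' := P.eq_of_mem (P.vert_mem j k) (hj' ▸ P.vert_mem j' _)
    subst this
    exact vert_inj hk (ha j) hj'
  have hleft : ∀ j, ∀ k ≤ a j, P.vert j k ∈ A := by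
    intro j k
    induction k with
    | zero => exact fun _ => P.vert_zero j ▸ hX (P.src_mem j)
    | succ k ih =>
      intro hk
      have hkA := ih (by omega)
      have hl := ha j
      refine h.mem_left_of_adj (adj_vert (by omega)) fun hkB => ?_
      have := huniq j k (by omega) ⟨hkA, hkB⟩
      omega
  have hright : ∀ j k, a j ≤ k → k ≤ P.len j → P.vert j k ∈ B := by
    intro j k hak hk
    induction hk using Nat.decreasingInduction with
    | self => exact P.vert_len j ▸ hY (P.tgt_mem j)
    | of_succ k hk ih =>
      have hkB := ih (by omega)
      refine h.mem_right_of_adj (adj_vert hk).symm fun hkA => ?_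
      have := huniq j (k + 1) (by omega) ⟨hkA, hkB⟩
      omega
  refine ⟨a, ha, fun j k hk => ⟨⟨fun hA => ?_, hleft j k⟩, ⟨fun hB => ?_, fun h => hright j k h hk⟩⟩,
    hsurj⟩
  · by_contra! hlt
    have := huniq j k hk ⟨hA, hright j k hlt.le hk⟩
    omega
  · by_contra! hlt
    have := huniq j k hk ⟨hleft j k hlt.le, hB⟩
    omega

end Linkage

/-! ### Bridges expressed by walks. -/

section PathAdjacency

variable {V : Type*} {G : SimpleGraph V} {n : ℕ}

/-- The sets `vp i` and `vp j` are joined inside `X` by an edge or by a path with inner vertices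
outside all sets `vp m`. -/
def PathAdj (G : SimpleGraph V) (vp : Fin n → Set V) (X : Set V) (i j : Fin n) : Prop :=
  ∃ x ∈ vp i ∩ X, ∃ y ∈ vp j ∩ X, G.Adj x y ∨
    ∃ u u', G.Adj x u ∧ ConnIn G (X \ ⋃ m, vp m) u u' ∧ G.Adj u' y

theorem PathAdj.mono {vp : Fin n → Set V} {X X' : Set V} {i j : Fin n} (h : PathAdj G vp X i j)
    (hX : X ⊆ X') : PathAdj G vp X' i j := by
  obtain ⟨x, hx, y, hy, h⟩ := h
  refine ⟨x, ⟨hx.1, hX hx.2⟩, y, ⟨hy.1, hX hy.2⟩, h.imp_right ?_⟩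
  rintro ⟨u, u', h1, h2, h3⟩
  exact ⟨u, u', h1, h2.mono_set (Set.sdiff_subset_sdiff_left hX), h3⟩

theorem PathAdj.congr {vp vp' : Fin n → Set V} {X : Set V} {i j : Fin n} (h : PathAdj G vp X i j)
    (hvp : ∀ m, vp m ∩ X = vp' m ∩ X) : PathAdj G vp' X i j := by
  obtain ⟨x, hx, y, hy, h⟩ := h
  rw [hvp] at hx hy
  refine ⟨x, hx, y, hy, h.imp_right ?_⟩
  rintro ⟨u, u', h1, h2, h3⟩
  refine ⟨u, u', h1, h2.mono_set ?_, h3⟩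
  rintro z ⟨hz, hz'⟩
  refine ⟨hz, fun hmem => hz' ?_⟩
  obtain ⟨m, hm⟩ := Set.mem_iUnion.1 hmem
  have : z ∈ vp m ∩ X := by rw [hvp]; exact ⟨hm, hz⟩
  exact Set.mem_iUnion.2 ⟨m, this.1⟩

theorem connIn_of_reachable_coe {H : G.Subgraph} {a b : H.verts} (h : H.coe.Reachable a b) :
    ConnIn G H.verts a b := by
  obtain ⟨p⟩ := h
  induction p with
  | nil => exact .refl (Subtype.prop _)
  | cons hadj p ih => exact ih.head (H.adj_sub hadj) (Subtype.prop _)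

variable {A B X : Set V} (P : Linkage G A B n)

theorem bridgeVerts_eq : ((inducedOn G X).deleteVerts (P.graph ⊓ inducedOn G X).verts).verts =
    X \ P.support := by
  ext x
  simp only [inducedOn, SimpleGraph.Subgraph.induce_verts,
    SimpleGraph.Subgraph.verts_inf, Linkage.graph_verts, Set.mem_sdiff, Set.mem_inter_iff]
  tauto

theorem reachable_bridge_iff {a b : ((inducedOn G X).deleteVerts
    (P.graph ⊓ inducedOn G X).verts).verts} :
    ((inducedOn G X).deleteVerts (P.graph ⊓ inducedOn G X).verts).coe.Reachable a b ↔
      ConnIn G (X \ P.support) a.1 b.1 := by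
  constructor
  · intro h
    exact (connIn_of_reachable_coe h).mono_set (bridgeVerts_eq P).subset
  · intro h
    have := h.induction (c := fun x => ∃ hx, ((inducedOn G X).deleteVerts
      (P.graph ⊓ inducedOn G X).verts).coe.Reachable a ⟨x, hx⟩) ⟨a.2, .refl _⟩ (by
        rintro x y hx hy hxy ⟨hx', hr⟩
        have hy' : y ∈ ((inducedOn G X).deleteVerts (P.graph ⊓ inducedOn G X).verts).verts := by
          rwa [bridgeVerts_eq]
        refine ⟨hy', hr.trans (SimpleGraph.Adj.reachable ?_)⟩
        rw [SimpleGraph.Subgraph.coe_adj, SimpleGraph.Subgraph.deleteVerts_adj]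
        rw [SimpleGraph.Subgraph.deleteVerts_verts] at hx' hy'
        exact ⟨hx'.1, hx'.2, hy'.1, hy'.2, hx.1, hy.1, hxy⟩)
    exact this.2

theorem Linkage.isComponentBridge_iff {D : G.Subgraph} :
    IsComponentBridge (inducedOn G X) (P.graph ⊓ inducedOn G X) D ↔
      ∃ v ∈ X \ P.support,
        D.verts = {x | ConnIn G (X \ P.support) v x ∨
          ∃ y, ConnIn G (X \ P.support) v y ∧ (inducedOn G X).Adj x y} ∧
        ∀ x y, D.Adj x y ↔ (inducedOn G X).Adj x y ∧
          (ConnIn G (X \ P.support) v x ∨ ConnIn G (X \ P.support) v y) := by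
  have hC : ∀ (v : ((inducedOn G X).deleteVerts (P.graph ⊓ inducedOn G X).verts).verts) (x : V),
      x ∈ Subtype.val '' (((inducedOn G X).deleteVerts
        (P.graph ⊓ inducedOn G X).verts).coe.connectedComponentMk v).supp ↔
        ConnIn G (X \ P.support) v.1 x := by
    intro v x
    constructor
    · rintro ⟨y, hy, rfl⟩
      rw [SimpleGraph.ConnectedComponent.mem_supp_iff, SimpleGraph.ConnectedComponent.eq] at hy
      exact ((reachable_bridge_iff P).1 hy).symm
    · intro h
      refine ⟨⟨x, by rw [bridgeVerts_eq]; exact h.right_mem⟩, ?_, rfl⟩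
      rw [SimpleGraph.ConnectedComponent.mem_supp_iff, SimpleGraph.ConnectedComponent.eq]
      exact (reachable_bridge_iff P).2 h.symm
  constructor
  · rintro ⟨c, C, rfl, h1, h2⟩
    induction c using SimpleGraph.ConnectedComponent.ind with | _ v => ?_
    have hv := (bridgeVerts_eq P).subset v.2
    simp only [hC] at h1 h2
    exact ⟨v.1, hv, h1, h2⟩
  · rintro ⟨v, hv, h1, h2⟩
    refine ⟨SimpleGraph.connectedComponentMk _ ⟨v, by rwa [bridgeVerts_eq]⟩, _, rfl, ?_, ?_⟩
    · simpa only [hC] using h1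
    · simpa only [hC] using h2

theorem inducedOn_adj {x y : V} : (inducedOn G X).Adj x y ↔ x ∈ X ∧ y ∈ X ∧ G.Adj x y := by
  simp [inducedOn]

variable {P}

/-- The walk form is monotone in `X`, which is what the passage to a uniform subsequence needs. -/
theorem Linkage.bridgeAdjacent_iff {i j : Fin n} (hij : i ≠ j) :
    P.BridgeAdjacent X i j ↔ PathAdj G P.verts X i j := by
  constructor
  · rintro ⟨D, hD | hD, ⟨a, haD, hai⟩, ⟨b, hbD, hbj⟩⟩
    · obtain ⟨x, y, hxy, hK, -, -, -, rfl⟩ := hD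
      rw [inducedOn_adj] at hK
      simp only [SimpleGraph.subgraphOfAdj_verts, Set.mem_insert_iff,
        Set.mem_singleton_iff] at haD hbD
      have hab : a ≠ b := by
        rintro rfl
        exact hij (P.eq_of_mem hai hbj)
      rcases haD with rfl | rfl <;> rcases hbD with rfl | rfl
      · exact absurd rfl hab
      · exact ⟨_, ⟨hai, hK.1⟩, _, ⟨hbj, hK.2.1⟩, .inl hxy⟩
      · exact ⟨_, ⟨hai, hK.2.1⟩, _, ⟨hbj, hK.1⟩, .inl hxy.symm⟩
      · exact absurd rfl hab
    · obtain ⟨v, hv, hverts, -⟩ := P.isComponentBridge_iff.1 hD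
      have hatt : ∀ z ∈ D.verts, ∀ m, z ∈ P.verts m →
          ∃ y, ConnIn G (X \ P.support) v y ∧ (inducedOn G X).Adj z y := by
        intro z hz m hm
        rw [hverts] at hz
        rcases hz with hz | hz
        · exact absurd (P.mem_support_iff.2 ⟨m, hm⟩) hz.right_mem.2
        · exact hz
      obtain ⟨u, hu, hau⟩ := hatt a haD i hai
      obtain ⟨u', hu', hbu'⟩ := hatt b hbD j hbj
      rw [inducedOn_adj] at hau hbu'
      exact ⟨a, ⟨hai, hau.1⟩, b, ⟨hbj, hbu'.1⟩, .inr ⟨u, u', hau.2.2, hu.symm.trans hu',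
        hbu'.2.2.symm⟩⟩
  · rintro ⟨x, hx, y, hy, hxy | ⟨u, u', hxu, huu', hu'y⟩⟩
    · refine ⟨G.subgraphOfAdj hxy, .inl ⟨x, y, hxy, inducedOn_adj.2 ⟨hx.2, hy.2, hxy⟩, ?_, ?_, ?_,
        rfl⟩, ⟨x, by simp, hx.1⟩, ⟨y, by simp, hy.1⟩⟩
      · rintro ⟨h, -⟩
        obtain ⟨m, hm⟩ := Linkage.graph_adj.1 h
        have hm' := Linkage.mem_verts_of_toSubgraph_adj hm
        exact hij ((P.eq_of_mem hx.1 hm'.1).trans (P.eq_of_mem hm'.2 hy.1))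
      · rw [SimpleGraph.Subgraph.verts_inf, Linkage.graph_verts]
        exact ⟨P.mem_support_iff.2 ⟨i, hx.1⟩, hx.2⟩
      · rw [SimpleGraph.Subgraph.verts_inf, Linkage.graph_verts]
        exact ⟨P.mem_support_iff.2 ⟨j, hy.1⟩, hy.2⟩
    · let D : G.Subgraph :=
        { verts := {x | ConnIn G (X \ P.support) u x ∨
            ∃ y, ConnIn G (X \ P.support) u y ∧ (inducedOn G X).Adj x y}
          Adj x y := (inducedOn G X).Adj x y ∧
            (ConnIn G (X \ P.support) u x ∨ ConnIn G (X \ P.support) u y)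
          adj_sub h := (inducedOn G X).adj_sub h.1
          edge_vert := by
            rintro a b ⟨hab, h | h⟩
            exacts [.inl h, .inr ⟨b, h, hab⟩]
          symm := ⟨fun _ _ h => ⟨h.1.symm, h.2.symm⟩⟩ }
      refine ⟨D, .inr (P.isComponentBridge_iff.2 ⟨u, huu'.left_mem, rfl, fun _ _ => Iff.rfl⟩),
        ⟨x, .inr ⟨u, .refl huu'.left_mem, ?_⟩, hx.1⟩, ⟨y, .inr ⟨u', huu', ?_⟩, hy.1⟩⟩
      · exact inducedOn_adj.2 ⟨hx.2, huu'.left_mem.1, hxu⟩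
      · exact inducedOn_adj.2 ⟨hy.2, huu'.right_mem.1, hu'y.symm⟩

end PathAdjacency

/-- Used to see that every vertex of a walk witnessing `Touches` touches the same path. -/
theorem ConnIn.through {V : Type*} {G : SimpleGraph V} {X : Set V} {u v : V}
    (h : ConnIn G X u v) : ConnIn G {x | ConnIn G X x v} u v := by
  refine (h.symm.induction (c := fun y => ConnIn G {x | ConnIn G X x v} v y)
    (.refl (.refl h.right_mem)) ?_).symm
  intro x y _ hy hxy hc
  exact hc.tail hxy (ConnIn.head hxy.symm hy hc.right_mem)

theorem IsVertexConnected.connIn {V : Type*} [Finite V] {G : SimpleGraph V} {p : ℕ}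
    (hp : IsVertexConnected p G) {Z : Set V} (hZ : Z.ncard < p) {u v : V} (hu : u ∉ Z)
    (hv : v ∉ Z) : ConnIn G Zᶜ u v := by
  have hfin := Set.toFinite Z
  have h := hp.2 hfin.toFinset (by rwa [← Set.ncard_eq_toFinset_card Z hfin])
  refine (connIn_of_connected_induce h (u := u) (v := v) (by simpa using hu)
    (by simpa using hv)).mono_set fun x hx => ?_
  simpa using hx

/-! ### Rich and poor vertices, and the extremal linkage. -/

namespace Linkage

variable {V : Type*} {G : SimpleGraph V} {X Y : Set V} {n : ℕ}

/-- The vertex `v` can be joined to the `m`-th path without meeting the other paths. -/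
def Touches (P : Linkage G X Y n) (v : V) (m : Fin n) : Prop :=
  ∃ u ∈ P.verts m, ConnIn G {x | ∀ m', m' ≠ m → x ∉ P.verts m'} v u

/-- The vertices outside the linkage that touch no non-trivial path except possibly the `j`-th. -/
def poor (P : Linkage G X Y n) (j : Fin n) : Set V :=
  {u | u ∉ P.support ∧ ∀ m, m ≠ j → P.src m ≠ P.tgt m → ¬ P.Touches u m}

/-- The vertices outside the linkage that touch at least two non-trivial paths. -/
def rich (P : Linkage G X Y n) : Set V :=
  {v | v ∉ P.support ∧ ∃ m m', m ≠ m' ∧ P.src m ≠ P.tgt m ∧ P.src m' ≠ P.tgt m' ∧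
    P.Touches v m ∧ P.Touches v m'}

/-- The `k`-th vertex of the `j`-th path has a neighbour that touches another non-trivial path. -/
def IsGoodPos (P : Linkage G X Y n) (j : Fin n) (k : ℕ) : Prop :=
  ∃ v m, G.Adj (P.vert j k) v ∧ m ≠ j ∧ P.src m ≠ P.tgt m ∧ P.Touches v m

variable {P : Linkage G X Y n}

theorem Touches.head {v w : V} {m : Fin n} (h : P.Touches w m) (hvw : G.Adj v w)
    (hv : v ∉ P.support) : P.Touches v m := by
  obtain ⟨u, hu, hc⟩ := h
  exact ⟨u, hu, hc.head hvw fun m' _ hm' => hv (P.mem_support_iff.2 ⟨m', hm'⟩)⟩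

theorem touches_of_mem {v : V} {m : Fin n} (h : v ∈ P.verts m) : P.Touches v m :=
  ⟨v, h, .refl fun _ hne hm' => hne (P.eq_of_mem hm' h)⟩

/-- Rerouting a path through poor vertices past a good position increases the number of rich
vertices. -/
theorem exists_rich_ncard_lt [Finite V] (P : Linkage G X Y n) {j : Fin n} {α γ β : ℕ}
    (hαγ : α < γ) (hγβ : γ < β) (hβ : β ≤ P.len j) (hgood : P.IsGoodPos j γ)
    (hD : ConnIn G ({P.vert j α, P.vert j β} ∪ P.poor j) (P.vert j α) (P.vert j β)) :
    ∃ P' : Linkage G X Y n, P.rich.ncard < P'.rich.ncard := by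
  classical
  -- The new `j`-th path runs inside `R`: it omits the old positions strictly between `α` and `β`,
  -- so the good vertex at `γ` leaves the linkage.
  let R : Set V := {x | (∃ k ≤ P.len j, (k ≤ α ∨ β ≤ k) ∧ x = P.vert j k) ∨ x ∈ P.poor j}
  have hR : ConnIn G R (P.src j) (P.tgt j) := by
    rw [← P.vert_zero, ← P.vert_len]
    have h1 : ConnIn G R (P.vert j 0) (P.vert j α) :=
      connIn_vert (by omega) (by omega) fun i _ hi => .inl ⟨i, by omega, .inl hi, rfl⟩
    have h2 : ConnIn G R (P.vert j β) (P.vert j (P.len j)) :=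
      connIn_vert hβ le_rfl fun i hi hi' => .inl ⟨i, hi', .inr hi, rfl⟩
    refine (h1.trans (hD.mono_set ?_)).trans h2
    rintro x ((rfl | rfl) | hx)
    exacts [.inl ⟨α, by omega, .inl le_rfl, rfl⟩, .inl ⟨β, hβ, .inr le_rfl, rfl⟩, .inr hx]
  obtain ⟨p, hp, hpR⟩ := hR.exists_path
  have hRother : ∀ x ∈ R, ∀ m, m ≠ j → x ∉ P.verts m := by
    rintro x (⟨k, -, -, rfl⟩ | hx) m hm hxm
    · exact hm (P.eq_of_mem hxm (P.vert_mem j k))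
    · exact hx.1 (P.mem_support_iff.2 ⟨m, hxm⟩)
  let P' : Linkage G X Y n :=
    { src := P.src
      tgt := P.tgt
      path := Function.update P.path j p
      isPath i := by
        by_cases hi : i = j
        · subst hi; simpa using hp
        · simpa [hi] using P.isPath i
      src_mem := P.src_mem
      tgt_mem := P.tgt_mem
      disjoint := by
        intro i i' hii' x hx hx'
        by_cases hi : i = j
        · subst hi
          have hi' : i' ≠ i := fun h => hii' h.symm
          simp only [Function.update_self] at hx
          simp only [ne_eq, hi', not_false_eq_true, Function.update_of_ne] at hx'
          exact hRother x (hpR x hx) i' hi' hx'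
        · by_cases hi' : i' = j
          · subst hi'
            simp only [Function.update_self] at hx'
            simp only [ne_eq, hi, not_false_eq_true, Function.update_of_ne] at hx
            exact hRother x (hpR x hx') i hi hx
          · simp only [ne_eq, hi, hi', not_false_eq_true, Function.update_of_ne] at hx hx'
            exact P.disjoint i i' hii' x hx hx' }
  have hvj : ∀ x ∈ P'.verts j, x ∈ R := by
    intro x hx
    simp only [verts, P', Function.update_self, Set.mem_ofPred_eq] at hx
    exact hpR x hx
  have hsrc : P.src j ∈ P'.verts j := (P'.path j).start_mem_support
  have hvm : ∀ m, m ≠ j → P'.verts m = P.verts m := by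
    intro m hm
    simp only [verts, P', ne_eq, hm, not_false_eq_true, Function.update_of_ne]
  have hjtriv : P.src j ≠ P.tgt j := by
    rw [ne_eq, ← isTrivial_iff, isTrivial_iff_len]
    omega
  have hsupp : ∀ x ∈ P'.support, x ∈ P.support ∨ x ∈ P.poor j := by
    intro x hx
    obtain ⟨m, hm⟩ := P'.mem_support_iff.1 hx
    by_cases hmj : m = j
    · subst hmj
      rcases hvj x hm with ⟨k, -, -, rfl⟩ | hx
      exacts [.inl (P.vert_mem_support _ _), .inr hx]
    · rw [hvm m hmj] at hm
      exact .inl (P.mem_support_iff.2 ⟨m, hm⟩)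
  -- For `m = j`, the walk is continued along the old path to its first vertex, which the new path
  -- keeps. For `m ≠ j`, every vertex of the walk touches `m`; hence none is poor, and the walk
  -- misses the new path.
  have htouch : ∀ v m, P.src m ≠ P.tgt m → P.Touches v m → P'.Touches v m := by
    rintro v m hm ⟨u, hu, hc⟩
    by_cases hmj : m = j
    · subst hmj
      obtain ⟨k, hk, rfl⟩ := exists_vert hu
      refine ⟨P.src m, hsrc, ?_⟩
      have hset : {x | ∀ m', m' ≠ m → x ∉ P.verts m'} ⊆ {x | ∀ m', m' ≠ m → x ∉ P'.verts m'} := by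
        intro x hx m' hm'
        rw [hvm m' hm']
        exact hx m' hm'
      refine (hc.mono_set hset).trans ?_
      rw [← P.vert_zero]
      refine (connIn_vert (by omega) hk fun i _ _ => hset fun m' hm' hmem => ?_).symm
      exact hm' (P.eq_of_mem hmem (P.vert_mem m i))
    · refine ⟨u, by rwa [hvm m hmj], hc.through.mono_set fun x hx m' hm' hxm' => ?_⟩
      by_cases hm'j : m' = j
      · subst hm'j
        rcases hvj x hxm' with ⟨k, -, -, rfl⟩ | hxp
        · exact hx.left_mem m' hm' (P.vert_mem m' k)
        · exact hxp.2 m hmj hm ⟨u, hu, hx⟩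
      · rw [hvm m' hm'j] at hxm'
        exact hx.left_mem m' hm' hxm'
  have hg : P.vert j γ ∉ P'.support := by
    intro hmem
    obtain ⟨m, hm⟩ := P'.mem_support_iff.1 hmem
    by_cases hmj : m = j
    · subst hmj
      rcases hvj _ hm with ⟨k, hk, hk', heq⟩ | hx
      · have := vert_inj (by omega) hk heq
        omega
      · exact hx.1 (P.vert_mem_support _ _)
    · rw [hvm m hmj] at hm
      exact hmj (P.eq_of_mem hm (P.vert_mem _ _))
  refine ⟨P', Set.ncard_lt_ncard ⟨?_, fun hsub => ?_⟩ (Set.toFinite _)⟩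
  · rintro v ⟨hv, m, m', hne, hm, hm', ht, ht'⟩
    refine ⟨fun hmem => ?_, m, m', hne, hm, hm', htouch v m hm ht, htouch v m' hm' ht'⟩
    have hpoor := (hsupp v hmem).resolve_left hv
    by_cases hmj : m = j
    · exact hpoor.2 m' (fun h => hne (hmj.trans h.symm)) hm' ht'
    · exact hpoor.2 m hmj hm ht
  · obtain ⟨v, m, hadj, hmj, hm, ht⟩ := hgood
    have : P.vert j γ ∈ P'.rich := ⟨hg, m, j, hmj, hm, hjtriv, (htouch v m hm ht).head hadj hg,
      htouch _ j hjtriv (touches_of_mem (P.vert_mem j γ))⟩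
    exact (hsub this).1 (P.vert_mem_support _ _)

theorem eq_src_of_mem {t : Fin n} {x : V} (ht : P.src t = P.tgt t) (hx : x ∈ P.verts t) :
    x = P.src t := by
  obtain ⟨y, hy⟩ := isTrivial_iff.2 ht
  have h1 : P.src t ∈ P.verts t := (P.path t).start_mem_support
  rw [hy] at hx h1
  exact hx.trans h1.symm

/-- Touching a path is inherited along walks off the linkage, so each component off the linkage is
poor as a whole or not at all. -/
theorem poor_of_connIn {j : Fin n} {u v : V} (hu : u ∈ P.poor j)
    (h : ConnIn G P.supportᶜ u v) : ConnIn G (P.poor j) u v := by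
  refine (h.restrict hu ?_).mono_set Set.inter_subset_left
  intro x y hx _ hy hxy
  exact ⟨hy, fun m hm hmt ht => hx.2 m hm hmt (ht.head hxy hx.1)⟩

/-- If a path of a linkage with the largest possible number of rich vertices has a bridge in `W`
that attaches to no other non-trivial path, then it is adjacent in `W` to many trivial paths. -/
theorem le_ncard_trivial_of_poor_bridge [Finite V] {p : ℕ} (hp : IsVertexConnected p G)
    (hmax : ∀ P' : Linkage G X Y n, P'.rich.ncard ≤ P.rich.ncard) {W : Set V} {j : Fin n}
    (hj : P.src j ≠ P.tgt j) {x y : ℕ} (hy : y ≤ P.len j)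
    (hW : ∀ k ≤ P.len j, P.vert j k ∈ W ↔ x ≤ k ∧ k ≤ y)
    (hbd : ∀ v ∈ W, (∀ u, G.Adj v u → u ∈ W) ∨
      (v ∈ P.support ∧ ∀ k ≤ P.len j, v = P.vert j k → k = x ∨ k = y))
    (hout : ∃ o, o ∉ W)
    (hbridge : (∃ α β, x ≤ α ∧ α + 1 < β ∧ β ≤ y ∧ G.Adj (P.vert j α) (P.vert j β)) ∨
      ∃ v ∈ W, v ∈ P.poor j ∧ ∃ u, ConnIn G P.supportᶜ v u ∧ ∃ k ≤ P.len j,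
        G.Adj u (P.vert j k)) :
    p ≤ {t | P.src t = P.tgt t ∧ PathAdj G P.verts W j t}.ncard + 2 := by
  classical
  set T := {t | P.src t = P.tgt t ∧ PathAdj G P.verts W j t} with hT
  by_contra! hlt
  let Att : V → ℕ → Prop := fun v k =>
    k ≤ P.len j ∧ ∃ u, ConnIn G P.supportᶜ v u ∧ G.Adj u (P.vert j k)
  let Link : ℕ → ℕ → Prop := fun k k' =>
    ConnIn G ({P.vert j k, P.vert j k'} ∪ P.poor j) (P.vert j k) (P.vert j k')
  have hout_nbr : ∀ v ∈ W, v ∉ P.support → ∀ u, G.Adj v u → u ∈ W := fun v hv hvs =>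
    (hbd v hv).resolve_right fun h => hvs h.1
  have hlocal : ∀ v ∈ W, ∀ u, ConnIn G P.supportᶜ v u → ConnIn G (W \ P.support) v u := by
    intro v hv u hc
    exact hc.restrict hv fun a b ha ha' _ hab => hout_nbr a ha ha' b hab
  have hAttW : ∀ v ∈ W, ∀ k, Att v k → x ≤ k ∧ k ≤ y := by
    rintro v hv k ⟨hk, u, hc, huk⟩
    have := (hlocal v hv u hc).right_mem
    exact (hW k hk).1 (hout_nbr u this.1 this.2 _ huk)
  have hAttLink : ∀ v ∈ P.poor j, ∀ k k', Att v k → Att v k' → Link k k' := by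
    rintro v hv k k' ⟨-, u, hu, huk⟩ ⟨-, u', hu', huk'⟩
    have h1 := (poor_of_connIn hv hu).symm.trans (poor_of_connIn hv hu')
    exact ((h1.mono_set Set.subset_union_right).head huk.symm (.inl (.inl rfl))).tail huk'
      (.inl (.inr rfl))
  have hLinkAdj : ∀ k k', G.Adj (P.vert j k) (P.vert j k') → Link k k' := fun k k' h =>
    .of_adj h (.inl (.inl rfl)) (.inl (.inr rfl))
  -- Here the extremal choice enters: a link through poor vertices cannot span a good position.
  have hnogood : ∀ k γ k', k < γ → γ < k' → k' ≤ y → Link k k' → ¬ P.IsGoodPos j γ := by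
    intro k γ k' h1 h2 h3 hl hg
    obtain ⟨P', hP'⟩ := P.exists_rich_ncard_lt h1 h2 (h3.trans hy) hg hl
    exact absurd (hmax P') (not_le.2 hP')
  have hLinkSymm : ∀ k k', Link k k' → Link k' k := by
    intro k k' h
    have := h.symm
    rwa [Set.pair_comm] at this
  obtain ⟨α, β, hα, hαβ, hβ, hlink, hseed⟩ : ∃ α β, x ≤ α ∧ α ≤ β ∧ β ≤ y ∧ Link α β ∧
      (α + 1 < β ∨ ∃ v ∈ W, v ∈ P.poor j ∧ Att v α ∧ ∀ k, Att v k → α ≤ k ∧ k ≤ β) := by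
    rcases hbridge with ⟨α, β, h1, h2, h3, h4⟩ | ⟨v, hvW, hv, u, hu, k, hk, huk⟩
    · exact ⟨α, β, h1, by omega, h3, hLinkAdj _ _ h4, .inl h2⟩
    · have hAk : Att v k := ⟨hk, u, hu, huk⟩
      have hex : ∃ k, Att v k := ⟨k, hAk⟩
      have hα := Nat.find_spec hex
      have hβ := Nat.findGreatest_spec (P := Att v) hk hAk
      have hβ' := Nat.findGreatest_le (P := Att v) (P.len j)
      refine ⟨Nat.find hex, Nat.findGreatest (Att v) (P.len j), (hAttW v hvW _ hα).1,
        Nat.find_min' hex hβ, (hAttW v hvW _ hβ).2, hAttLink v hv _ _ hα hβ,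
        .inr ⟨v, hvW, hv, hα, fun k hk => ⟨Nat.find_min' hex hk, ?_⟩⟩⟩
      exact Nat.le_findGreatest hk.1 hk
  let goal : ℕ → Prop := fun k => k = x ∨ k = y ∨ P.IsGoodPos j k
  -- The span from `α` to `β` is enlarged on both sides to the nearest good position or end of the
  -- part of the path in `W`. No position strictly between `a` and `b` is then good.
  obtain ⟨a, hxa, haα, hagoal, hamax⟩ : ∃ a, x ≤ a ∧ a ≤ α ∧ goal a ∧
      ∀ k, a < k → k ≤ α → ¬ goal k :=
    ⟨Nat.findGreatest goal α, Nat.le_findGreatest hα (.inl rfl), Nat.findGreatest_le _,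
      Nat.findGreatest_spec hα (.inl rfl), fun k h1 h2 => Nat.findGreatest_is_greatest h1 h2⟩
  obtain ⟨b, hby, hβb, hbgoal, hbmin⟩ : ∃ b, b ≤ y ∧ β ≤ b ∧ goal b ∧
      ∀ k, k < b → β ≤ k → ¬ goal k := by
    have hex : ∃ b, β ≤ b ∧ goal b := ⟨y, hβ, .inr (.inl rfl)⟩
    exact ⟨Nat.find hex, Nat.find_min' hex ⟨hβ, .inr (.inl rfl)⟩, (Nat.find_spec hex).1,
      (Nat.find_spec hex).2, fun k h1 h2 h3 => Nat.find_min hex h1 ⟨h2, h3⟩⟩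
  have hinner : ∀ k, a < k → k < b → ¬ P.IsGoodPos j k := by
    intro k hak hkb hg
    rcases le_or_gt k α with h | h
    · exact hamax k hak h (.inr (.inr hg))
    rcases le_or_gt β k with h' | h'
    · exact hbmin k hkb h' (.inr (.inr hg))
    · exact hnogood α k β h h' hβ hlink hg
  -- A link leaving the segment would span `a` or `b`, and each of these is good unless it is
  -- already the end of the path's part in `W`.
  have hspan : ∀ k k', a < k → k < b → x ≤ k' → k' ≤ y → Link k k' → a ≤ k' ∧ k' ≤ b := by
    intro k k' hak hkb hxk' hk'y hl
    constructor
    · by_contra! h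
      have hg : P.IsGoodPos j a := by
        rcases hagoal with h' | h' | h'
        exacts [absurd h' (by omega), absurd h' (by omega), h']
      exact hnogood k' a k h hak (by omega) (hLinkSymm _ _ hl) hg
    · by_contra! h
      have hg : P.IsGoodPos j b := by
        rcases hbgoal with h' | h' | h'
        exacts [absurd h' (by omega), absurd h' (by omega), h']
      exact hnogood k b k' hkb h hk'y hl hg
  -- `U` is what the segment cuts off: its inner vertices and the poor vertices attached only within
  -- it. All its outer neighbours lie in `Z`, which has fewer than `p` vertices by the assumption to
  -- be refuted; a vertex outside `W` then contradicts `p`-connectivity.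
  let U : Set V := {v | (∃ k, a < k ∧ k < b ∧ v = P.vert j k) ∨
    (v ∈ W ∧ v ∈ P.poor j ∧ (∃ k, Att v k) ∧ ∀ k, Att v k → a ≤ k ∧ k ≤ b)}
  let Z : Set V := {P.vert j a, P.vert j b} ∪ P.src '' T
  have hZcard : Z.ncard < p := by
    have h1 := Set.ncard_union_le {P.vert j a, P.vert j b} (P.src '' T)
    have h2 := Set.ncard_insert_le (P.vert j a) {P.vert j b}
    rw [Set.ncard_singleton] at h2
    have h3 := Set.ncard_image_le (f := P.src) (Set.toFinite T)
    have h4 : Z.ncard = ({P.vert j a, P.vert j b} ∪ P.src '' T).ncard := rfl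
    omega
  have hZW : Z ⊆ W := by
    rintro z ((rfl | rfl) | ⟨t, ⟨ht, -, -, z, hz, -⟩, rfl⟩)
    · exact (hW a (by omega)).2 ⟨hxa, by omega⟩
    · exact (hW b (by omega)).2 ⟨by omega, hby⟩
    · exact eq_src_of_mem ht hz.1 ▸ hz.2
  have hUW : U ⊆ W := by
    rintro v (⟨k, h1, h2, rfl⟩ | h)
    · exact (hW k (by omega)).2 ⟨by omega, by omega⟩
    · exact h.1
  have hUZ : ∀ v ∈ U, v ∉ Z := by
    rintro v (⟨k, h1, h2, rfl⟩ | h) hz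
    · rcases hz with (hz | hz) | ⟨t, ht, hz⟩
      · have := vert_inj (by omega) (by omega) hz
        omega
      · have := vert_inj (by omega) (by omega) hz
        omega
      · have htj : t = j := P.eq_of_mem (P.path t).start_mem_support (hz ▸ P.vert_mem j k)
        exact hj (htj ▸ ht.1)
    · refine h.2.1.1 ?_
      rcases hz with (rfl | rfl) | ⟨t, ht, rfl⟩
      exacts [P.vert_mem_support _ _, P.vert_mem_support _ _,
        P.mem_support_iff.2 ⟨t, (P.path t).start_mem_support⟩]
  have hpos : ∀ k, a ≤ k → k ≤ b → P.vert j k ∉ Z → P.vert j k ∈ U := by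
    intro k h1 h2 hz
    have ha : k ≠ a := fun h => hz (h ▸ .inl (.inl rfl))
    have hb : k ≠ b := fun h => hz (h ▸ .inl (.inr rfl))
    exact .inl ⟨k, by omega, by omega, rfl⟩
  have hclosed : ∀ v w, v ∈ U → G.Adj v w → w ∉ Z → w ∈ U := by
    intro v w hv hvw hw
    have hwW : w ∈ W := by
      refine (hbd v (hUW hv)).elim (fun h => h w hvw) fun h => ?_
      rcases hv with ⟨k, h1, h2, rfl⟩ | hv
      · have := h.2 k (by omega) rfl
        omega
      · exact absurd h.1 hv.2.1.1
    by_cases hws : w ∈ P.support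
    · obtain ⟨m, hm⟩ := P.mem_support_iff.1 hws
      by_cases hmj : m = j
      · subst hmj
        obtain ⟨k', hk', rfl⟩ := exists_vert hm
        have hk'W := (hW k' hk').1 hwW
        rcases hv with ⟨k, h1, h2, rfl⟩ | hv
        · have := hspan k k' h1 h2 hk'W.1 hk'W.2 (hLinkAdj _ _ hvw)
          exact hpos k' this.1 this.2 hw
        · have := hv.2.2.2 k' ⟨hk', v, .refl hv.2.1.1, hvw⟩
          exact hpos k' this.1 this.2 hw
      by_cases hmt : P.src m = P.tgt m
      · refine absurd (.inr ⟨m, ⟨hmt, ?_⟩, (eq_src_of_mem hmt hm).symm⟩) hw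
        rcases hv with ⟨k, h1, h2, rfl⟩ | hv
        · exact ⟨_, ⟨P.vert_mem j k, (hW k (by omega)).2 ⟨by omega, by omega⟩⟩, w, ⟨hm, hwW⟩,
            .inl hvw⟩
        · obtain ⟨k, hk⟩ := hv.2.2.1
          have hkW := hAttW v hv.1 k hk
          obtain ⟨hkl, u, hvu, huk⟩ := hk
          exact ⟨_, ⟨P.vert_mem j k, (hW k hkl).2 hkW⟩, w, ⟨hm, hwW⟩,
            .inr ⟨u, v, huk.symm, (hlocal v hv.1 u hvu).symm, hvw⟩⟩
      · have htw := touches_of_mem hm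
        rcases hv with ⟨k, h1, h2, rfl⟩ | hv
        · exact absurd ⟨w, m, hvw, hmj, hmt, htw⟩ (hinner k h1 h2)
        · exact absurd (htw.head hvw hv.2.1.1) (hv.2.1.2 m hmj hmt)
    · right
      rcases hv with ⟨k, h1, h2, rfl⟩ | hv
      · have hwp : w ∈ P.poor j :=
          ⟨hws, fun m hmj hmt ht => hinner k h1 h2 ⟨w, m, hvw, hmj, hmt, ht⟩⟩
        have hwk : Att w k := ⟨by omega, w, .refl hws, hvw.symm⟩
        refine ⟨hwW, hwp, ⟨k, hwk⟩, fun k' hk' => ?_⟩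
        have hk'W := hAttW w hwW k' hk'
        exact hspan k k' h1 h2 hk'W.1 hk'W.2 (hAttLink w hwp k k' hwk hk')
      · have hvc : ConnIn G P.supportᶜ v w := .of_adj hvw hv.2.1.1 hws
        obtain ⟨k, hk, u, hu, huk⟩ := hv.2.2.1
        refine ⟨hwW, (poor_of_connIn hv.2.1 hvc).right_mem, ⟨k, hk, u, hvc.symm.trans hu, huk⟩, ?_⟩
        rintro k' ⟨hk', u', hu', huk'⟩
        exact hv.2.2.2 k' ⟨hk', u', hvc.trans hu', huk'⟩
  obtain ⟨u, hu⟩ : U.Nonempty := by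
    rcases hseed with h | ⟨v, h1, h2, h3, h4⟩
    · exact ⟨P.vert j (α + 1), .inl ⟨α + 1, by omega, by omega, rfl⟩⟩
    · refine ⟨v, .inr ⟨h1, h2, ⟨α, h3⟩, fun k hk => ?_⟩⟩
      have := h4 k hk
      exact ⟨by omega, by omega⟩
  obtain ⟨o, ho⟩ := hout
  have hc := hp.connIn hZcard (hUZ u hu) fun h => ho (hZW h)
  exact ho (hUW (hc.induction (c := fun v => v ∈ U) hu fun v w _ hw hvw hv =>
    hclosed v w hv hvw hw))

end Linkage

/-! ### Linkages crossing a chain of separations. -/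

/-- A linkage that runs through a chain of separations whose orders equal the cardinality of the
linkage; `pos i j` is the position at which the `j`-th path crosses the `i`-th separation. A path
that crosses two of the separations at the same vertex is trivial. -/
structure LinkedChain {V : Type*} {G : SimpleGraph V} {X Y : Set V} {q : ℕ} (M : ℕ)
    (A B : ℕ → Set V) (P : Linkage G X Y q) (pos : ℕ → Fin q → ℕ) : Prop where
  chain : SepChain G M A B
  pos_le : ∀ i ≤ M, ∀ j, pos i j ≤ P.len j
  mem_left : ∀ i ≤ M, ∀ j, ∀ k ≤ P.len j, P.vert j k ∈ A i ↔ k ≤ pos i j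
  mem_right : ∀ i ≤ M, ∀ j, ∀ k ≤ P.len j, P.vert j k ∈ B i ↔ pos i j ≤ k
  mem_inter : ∀ i ≤ M, ∀ s ∈ A i ∩ B i, ∃ j, s = P.vert j (pos i j)
  trivial : ∀ a b, a < b → b ≤ M → ∀ j, pos a j = pos b j → P.src j = P.tgt j

namespace LinkedChain

variable {V : Type*} {G : SimpleGraph V} {X Y : Set V} {q M : ℕ} {A B : ℕ → Set V}
  {P : Linkage G X Y q} {pos : ℕ → Fin q → ℕ}

theorem comp (h : LinkedChain M A B P pos) {l : ℕ} {φ : ℕ → ℕ} (hφ : StrictMono φ)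
    (hl : φ l ≤ M) : LinkedChain l (A ∘ φ) (B ∘ φ) P (pos ∘ φ) where
  chain := h.chain.comp hφ hl
  pos_le _ hi := h.pos_le _ ((hφ.monotone hi).trans hl)
  mem_left _ hi := h.mem_left _ ((hφ.monotone hi).trans hl)
  mem_right _ hi := h.mem_right _ ((hφ.monotone hi).trans hl)
  mem_inter _ hi := h.mem_inter _ ((hφ.monotone hi).trans hl)
  trivial _ _ hab hb := h.trivial _ _ (hφ hab) ((hφ.monotone hb).trans hl)

theorem pos_mono (h : LinkedChain M A B P pos) {a b : ℕ} (hab : a ≤ b) (hb : b ≤ M) (j : Fin q) :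
    pos a j ≤ pos b j := by
  have hle := h.pos_le a (hab.trans hb) j
  exact (h.mem_left b hb j _ hle).1
    (h.chain.mono hab hb ((h.mem_left a (hab.trans hb) j _ hle).2 le_rfl))

theorem pos_lt (h : LinkedChain M A B P pos) {a b : ℕ} (hab : a < b) (hb : b ≤ M) {j : Fin q}
    (hj : P.src j ≠ P.tgt j) : pos a j < pos b j :=
  lt_of_le_of_ne (h.pos_mono hab.le hb j) fun heq => hj (h.trivial a b hab hb j heq)

theorem mem_support (h : LinkedChain M A B P pos) {i : ℕ} (hi : i ≤ M) {s : V} (hA : s ∈ A i)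
    (hB : s ∈ B i) : s ∈ P.support := by
  obtain ⟨j, rfl⟩ := h.mem_inter i hi s ⟨hA, hB⟩
  exact P.vert_mem_support _ _

theorem mem_between (h : LinkedChain M A B P pos) {a b : ℕ} (ha : a ≤ M) (hb : b ≤ M) {j : Fin q}
    {k : ℕ} (hk : k ≤ P.len j) : P.vert j k ∈ B a ∩ A b ↔ pos a j ≤ k ∧ k ≤ pos b j := by
  rw [Set.mem_inter_iff, h.mem_right a ha j k hk, h.mem_left b hb j k hk]

/-- The neighbours of a vertex between two separations that is not on the linkage. -/
theorem between_of_adj (h : LinkedChain M A B P pos) {a b : ℕ} (ha : a ≤ M) (hb : b ≤ M) {v u : V}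
    (hv : v ∈ B a ∩ A b) (hvs : v ∉ P.support) (hvu : G.Adj v u) : u ∈ B a ∩ A b :=
  ⟨(h.chain.sep a ha).mem_right_of_adj hvu fun hA => hvs (h.mem_support ha hA hv.1),
    (h.chain.sep b hb).mem_left_of_adj hvu fun hB => hvs (h.mem_support hb hv.2 hB)⟩

/-- The separators consist of vertices of the linkage, so a walk off the linkage cannot leave the
section in which it starts. -/
theorem connIn_between (h : LinkedChain M A B P pos) {a b : ℕ} (ha : a ≤ M) (hb : b ≤ M) {v u : V}
    (hv : v ∈ B a ∩ A b) (hc : ConnIn G P.supportᶜ v u) :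
    ConnIn G ((B a ∩ A b) \ P.support) v u :=
  hc.restrict hv fun _ _ hx hx' _ hxy => h.between_of_adj ha hb hx hx' hxy

/-- The stability property for a linkage with the largest number of rich vertices. -/
theorem le_ncard_trivial [Finite V] (h : LinkedChain M A B P pos) {p : ℕ}
    (hp : IsVertexConnected p G)
    (hmax : ∀ P' : Linkage G X Y q, P'.rich.ncard ≤ P.rich.ncard) {a b : ℕ} (hab : a < b)
    (hb : b < M) {j : Fin q} (hj : P.src j ≠ P.tgt j)
    (hbridge : (∃ α β, pos a j ≤ α ∧ α + 1 < β ∧ β ≤ pos b j ∧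
        G.Adj (P.vert j α) (P.vert j β)) ∨
      ∃ v ∈ B a ∩ A b, v ∈ P.poor j ∧ ∃ u, ConnIn G P.supportᶜ v u ∧ ∃ k ≤ P.len j,
        G.Adj u (P.vert j k)) :
    p ≤ {t | P.src t = P.tgt t ∧ PathAdj G P.verts (B a ∩ A b) j t}.ncard + 2 := by
  refine P.le_ncard_trivial_of_poor_bridge hp hmax hj (x := pos a j) (y := pos b j)
    (h.pos_le b hb.le j) (fun k hk => h.mem_between (by omega) hb.le hk) (fun v hv => ?_) ?_ hbridge
  · by_cases hvs : v ∈ A a ∨ v ∈ B b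
    · right
      rcases hvs with hvs | hvs
      · refine ⟨h.mem_support (by omega) hvs hv.1, fun k hk hvk => .inl ?_⟩
        subst hvk
        exact le_antisymm ((h.mem_left a (by omega) j k hk).1 hvs)
          ((h.mem_right a (by omega) j k hk).1 hv.1)
      · refine ⟨h.mem_support hb.le hv.2 hvs, fun k hk hvk => .inr ?_⟩
        subst hvk
        exact le_antisymm ((h.mem_left b hb.le j k hk).1 hv.2)
          ((h.mem_right b hb.le j k hk).1 hvs)
    · push Not at hvs
      exact .inl fun u hvu => ⟨(h.chain.sep a (by omega)).mem_right_of_adj hvu hvs.1,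
        (h.chain.sep b hb.le).mem_left_of_adj hvu hvs.2⟩
  · obtain ⟨o, -, ho⟩ := Set.exists_of_ssubset (h.chain.ssubset b (b + 1) (by omega) hb)
    exact ⟨o, fun h' => ho h'.2⟩

end LinkedChain

theorem Linkage.exists_rich_max {V : Type*} [Finite V] {G : SimpleGraph V} {X Y : Set V} {q : ℕ}
    (P₀ : Linkage G X Y q) :
    ∃ P : Linkage G X Y q, ∀ P' : Linkage G X Y q, P'.rich.ncard ≤ P.rich.ncard := by
  have hbdd : BddAbove (Set.range fun P : Linkage G X Y q => P.rich.ncard) :=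
    ⟨Nat.card V, by rintro _ ⟨P, rfl⟩; exact Set.ncard_le_card _⟩
  obtain ⟨P, hP⟩ := Nat.sSup_mem ⟨_, Set.mem_range_self P₀⟩ hbdd
  exact ⟨P, fun P' => by
    have := le_csSup hbdd ⟨P', rfl⟩
    rw [← hP] at this
    exact this⟩

-- Thinning out the chain for uniform triviality and adjacency.

universe u

/-- A long linked chain of separations has a long subsequence in which all linkages have the same
trivial paths. -/
theorem exists_uniformly_trivial_chain (l q : ℕ) : ∃ N, ∀ M ≥ N, ∀ (V : Type u) [Finite V]
    (G : SimpleGraph V) (A B : ℕ → Set V), SepChain G M A B →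
    (∀ i ≤ M, (A i ∩ B i).ncard = q) → Nonempty (Linkage G (A 0 ∩ B 0) (A M ∩ B M) q) →
    ∃ A' B' : ℕ → Set V, (∀ i ≤ l, (A' i ∩ B' i).ncard = q) ∧
      ∃ X Y : Set V, Nonempty (Linkage G X Y q) ∧
      ∀ P : Linkage G X Y q, ∃ pos, LinkedChain l A' B' P pos := by
  obtain ⟨N, -, hN⟩ := exists_constant_subsequence l q
  refine ⟨N, fun M hM V _ G A B hch hq ⟨P₀⟩ => ?_⟩
  have hmono : ∀ a' a b b', a' ≤ a → a < b → b ≤ b' → b' ≤ M →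
      (A a' ∩ B a') ∩ (A b' ∩ B b') ⊆ (A a ∩ B a) ∩ (A b ∩ B b) := by
    intro a' a b b' h1 h2 h3 h4 v hv
    have hva := hch.mono h1 (by omega) hv.1.1
    have hvb := hch.anti b b' h3 h4 hv.2.2
    exact ⟨⟨hva, hch.anti a b h2.le (by omega) hvb⟩, hch.mono h2.le (by omega) hva, hvb⟩
  -- `q` minus the size of the common part of two separators grows with the interval. Once it is
  -- constant, a vertex in two separators lies in the first and the last one, and so a path crossing
  -- two separations at that vertex both starts and ends there. This argument uses no particular
  -- linkage, so it is available for the extremal one.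
  obtain ⟨φ, c, hφ, -, hφl, hc⟩ := hN
    (fun a b => q - ((A a ∩ B a) ∩ (A b ∩ B b)).ncard) 0
    (fun a' a b b' _ h1 h2 h3 h4 => Nat.sub_le_sub_left (Set.ncard_le_ncard
      (hmono a' a b b' h1 h2 h3 (by omega)) (Set.toFinite _)) q) (Nat.sub_le _ _)
  rw [zero_add] at hφl
  replace hφl := hφl.trans hM
  have hch' := hch.comp hφ hφl
  have hq' : ∀ i ≤ l, ((A ∘ φ) i ∩ (B ∘ φ) i).ncard = q := fun i hi =>
    hq _ ((hφ.monotone hi).trans hφl)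
  have hT : ∀ a b, a < b → b ≤ l → (A (φ a) ∩ B (φ a)) ∩ (A (φ b) ∩ B (φ b)) ⊆
      (A (φ 0) ∩ B (φ 0)) ∩ (A (φ l) ∩ B (φ l)) := by
    intro a b hab hb
    have h0 : ∀ a b, a < b → b ≤ l →
        ((A (φ a) ∩ B (φ a)) ∩ (A (φ b) ∩ B (φ b))).ncard ≤ q := fun a b hab hb =>
      (Set.ncard_le_ncard Set.inter_subset_left (Set.toFinite _)).trans
        (hq' a (hab.le.trans hb)).le
    have h1 := hc a b hab hb
    have h2 := hc 0 l (by omega) le_rfl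
    have h3 := h0 a b hab hb
    have h4 := h0 0 l (by omega) le_rfl
    refine (Set.eq_of_subset_of_ncard_le (hmono _ _ _ _ (hφ.monotone (Nat.zero_le a)) (hφ hab)
      (hφ.monotone hb) hφl) ?_ (Set.toFinite _)).symm.subset
    omega
  refine ⟨A ∘ φ, B ∘ φ, hq', A (φ 0) ∩ B (φ 0), A (φ l) ∩ B (φ l), ?_, ?_⟩
  · have hX : ∀ i ≤ M, A 0 ∩ B 0 ⊆ A i := fun i hi v hv => hch.mono (Nat.zero_le i) hi hv.1
    have hY : ∀ i ≤ M, A M ∩ B M ⊆ B i := fun i hi v hv => hch.anti i M hi le_rfl hv.2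
    have h0l : φ 0 ≤ φ l := hφ.monotone (Nat.zero_le l)
    obtain ⟨a, ha, hav, -⟩ := P₀.exists_pos (hch.sep (φ 0) (by omega)) (hX _ (by omega))
      (hY _ (by omega)) (hq _ (by omega))
    obtain ⟨b, hb, hbv, -⟩ := P₀.exists_pos (hch.sep (φ l) hφl) (hX _ hφl) (hY _ hφl) (hq _ hφl)
    obtain ⟨P, -⟩ := P₀.exists_restrict (X' := A (φ 0) ∩ B (φ 0)) (Y' := A (φ l) ∩ B (φ l)) a b
      (fun j => (hbv j _ (ha j)).1.1 (hch.mono h0l hφl ((hav j _ (ha j)).1.2 le_rfl))) hb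
      (fun j => ⟨(hav j _ (ha j)).1.2 le_rfl, (hav j _ (ha j)).2.2 le_rfl⟩)
      (fun j => ⟨(hbv j _ (hb j)).1.2 le_rfl, (hbv j _ (hb j)).2.2 le_rfl⟩)
    exact ⟨P⟩
  · intro P
    have hex : ∀ i, ∃ a : Fin q → ℕ, i ≤ l → (∀ j, a j ≤ P.len j) ∧
        (∀ j, ∀ k ≤ P.len j, (P.vert j k ∈ A (φ i) ↔ k ≤ a j) ∧ (P.vert j k ∈ B (φ i) ↔ a j ≤ k)) ∧
        ∀ s ∈ A (φ i) ∩ B (φ i), ∃ j, s = P.vert j (a j) := by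
      intro i
      by_cases hi : i ≤ l
      · obtain ⟨a, ha⟩ := P.exists_pos (hch'.sep i hi)
          (fun v hv => hch'.mono (Nat.zero_le i) hi hv.1)
          (fun v hv => hch'.anti i l hi le_rfl hv.2) (hq' i hi)
        exact ⟨a, fun _ => ha⟩
      · exact ⟨fun _ => 0, fun h => absurd h hi⟩
    choose pos hpos using hex
    refine ⟨pos, hch', fun i hi => (hpos i hi).1, fun i hi j k hk => ((hpos i hi).2.1 j k hk).1,
      fun i hi j k hk => ((hpos i hi).2.1 j k hk).2, fun i hi => (hpos i hi).2.2, ?_⟩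
    intro a b hab hb j heq
    have hal := (hpos a (by omega)).1 j
    have hbl := (hpos b hb).1 j
    have hva := (hpos a (by omega)).2.1 j _ hal
    have hvb := (hpos b hb).2.1 j _ hbl
    rw [← heq] at hvb
    have hmem := hT a b hab hb ⟨⟨hva.1.2 le_rfl, hva.2.2 le_rfl⟩, hvb.1.2 le_rfl, hvb.2.2 le_rfl⟩
    have h1 := ((hpos 0 (by omega)).2.1 j _ hal).1.1 hmem.1.1
    have h2 := ((hpos l le_rfl).2.1 j _ hal).2.1 hmem.2.2
    have h3 := ((hpos 0 (by omega)).2.1 j 0 (Nat.zero_le _)).2.1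
      (P.vert_zero j ▸ (P.src_mem j).2)
    have h4 := ((hpos l le_rfl).2.1 j _ le_rfl).1.1 (P.vert_len j ▸ (P.tgt_mem j).1)
    rw [← Linkage.isTrivial_iff, Linkage.isTrivial_iff_len]
    omega

/-- A long linked chain of separations has a long subsequence in which the same pairs of paths are
adjacent between any two of the separations. -/
theorem exists_uniformly_adjacent_chain (l q : ℕ) : ∃ M, ∀ (V : Type u) (G : SimpleGraph V)
    (A B : ℕ → Set V) (X Y : Set V) (P : Linkage G X Y q) (pos : ℕ → Fin q → ℕ),
    LinkedChain M A B P pos → ∃ φ : ℕ → ℕ, StrictMono φ ∧ φ l ≤ M ∧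
      ∀ a b a' b', a < b → b ≤ l → a' < b' → b' ≤ l → ∀ i j,
        PathAdj G P.verts (B (φ a) ∩ A (φ b)) i j →
          PathAdj G P.verts (B (φ a') ∩ A (φ b')) i j := by
  obtain ⟨M, -, hM⟩ := exists_constant_subsequence l (q * q)
  refine ⟨M, fun V G A B X Y P pos h => ?_⟩
  let F : ℕ → ℕ → Set (Fin q × Fin q) := fun a b =>
    {ij | PathAdj G P.verts (B a ∩ A b) ij.1 ij.2}
  have hmono : ∀ a' a b b', a' ≤ a → a < b → b ≤ b' → b' ≤ M → F a b ⊆ F a' b' := by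
    intro a' a b b' h1 h2 h3 h4 ij hij
    exact hij.mono (Set.inter_subset_inter (h.chain.anti _ _ h1 (by omega)) (h.chain.mono h3 h4))
  obtain ⟨φ, c, hφ, -, hφl, hc⟩ := hM (fun a b => (F a b).ncard) 0
    (fun a' a b b' _ h1 h2 h3 h4 => Set.ncard_le_ncard (hmono a' a b b' h1 h2 h3 (by omega))
      (Set.toFinite _)) ((Set.ncard_le_card _).trans (by simp))
  rw [zero_add] at hφl
  have hsub : ∀ a b, a < b → b ≤ l → F (φ a) (φ b) ⊆ F (φ 0) (φ l) := fun a b hab hb =>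
    hmono _ _ _ _ (hφ.monotone (Nat.zero_le a)) (hφ hab) (hφ.monotone hb) hφl
  refine ⟨φ, hφ, hφl, fun a b a' b' hab hb hab' hb' i j hij => ?_⟩
  have heq : F (φ a') (φ b') = F (φ 0) (φ l) :=
    Set.eq_of_subset_of_ncard_le (hsub a' b' hab' hb')
      ((hc 0 l (by omega) le_rfl).trans (hc a' b' hab' hb').symm).le (Set.toFinite _)
  have : (i, j) ∈ F (φ a') (φ b') := heq ▸ hsub a b hab hb hij
  exact this

theorem ConnIn.map {V : Type*} {G H : SimpleGraph V} {X Y : Set V} {u v : V}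
    (h : ConnIn G X u v) (hXY : X ⊆ Y) (hGH : ∀ x ∈ X, ∀ y ∈ X, G.Adj x y → H.Adj x y) :
    ConnIn H Y u v :=
  h.induction (c := fun x => ConnIn H Y u x) (.refl (hXY h.left_mem))
    fun x y hx hy hxy hc => hc.tail (hGH x hx y hy hxy) (hXY hy)

/-! ### Rerouting through the two ends of the chain. -/

namespace LinkedChain

variable {V : Type*} [Finite V] {G : SimpleGraph V} {X Y : Set V} {q M : ℕ} {A B : ℕ → Set V}
  {P : Linkage G X Y q} {pos : ℕ → Fin q → ℕ}

/-- A small set of vertices meets some section between two consecutive separations only in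
trivial paths. -/
theorem exists_section (h : LinkedChain M A B P pos) {p : ℕ} {Z : Set V} (hZ : Z.ncard < p) (c : ℕ)
    (hc : c + 2 * p ≤ M) : ∃ i, c ≤ i ∧ i + 1 ≤ c + 2 * p ∧
      ∀ v ∈ Z, v ∈ B i ∩ A (i + 1) → ∃ j, P.src j = P.tgt j ∧ v ∈ P.verts j := by
  by_contra! hno
  -- Only every second section is used, so two of them are divided by two separations. A vertex in
  -- both sections is crossed at both separations, which makes its path trivial; hence the chosen
  -- vertices of `Z` are distinct.
  have hex : ∀ s : Fin p, ∃ v ∈ Z, v ∈ B (c + 2 * s) ∩ A (c + 2 * s + 1) ∧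
      ∀ j, P.src j = P.tgt j → v ∉ P.verts j := fun s => hno _ (by omega) (by omega)
  choose z hzZ hz hztriv using hex
  have hlt : ∀ s s' : Fin p, s < s' → z s ≠ z s' := by
    intro s s' hss' heq
    have hs' := s'.2
    have hss : (s : ℕ) < s' := hss'
    have h1 := hz s
    have h2 := hz s'
    rw [← heq] at h2
    have hA1 := h1.2
    have hB2 := h.chain.anti (c + 2 * s + 2) _ (by omega) (by omega) h2.1
    have hB1 := h.chain.anti (c + 2 * s + 1) (c + 2 * s + 2) (by omega) (by omega) hB2
    have hA2 := h.chain.mono (i := c + 2 * s + 1) (j := c + 2 * s + 2) (by omega) (by omega) hA1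
    obtain ⟨j, hj⟩ := h.mem_inter _ (by omega) _ ⟨hA1, hB1⟩
    have hle := h.pos_le (c + 2 * s + 1) (by omega) j
    have hposle : pos (c + 2 * s + 2) j ≤ pos (c + 2 * s + 1) j :=
      (h.mem_right _ (by omega) j _ hle).1 (hj ▸ hB2)
    have := h.pos_mono (a := c + 2 * s + 1) (b := c + 2 * s + 2) (by omega) (by omega) j
    exact hztriv s j (h.trivial (c + 2 * s + 1) (c + 2 * s + 2) (by omega) (by omega) j (by omega))
      (hj ▸ P.vert_mem j _)
  have hinj : Function.Injective z := by
    intro s s' heq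
    rcases lt_trichotomy s s' with h' | h' | h'
    exacts [absurd heq (hlt _ _ h'), h', absurd heq.symm (hlt _ _ h')]
  have : (Set.range z).ncard ≤ Z.ncard :=
    Set.ncard_le_ncard (by rintro _ ⟨s, rfl⟩; exact hzZ s) (Set.toFinite _)
  rw [Set.ncard_range_of_injective hinj, Nat.card_eq_fintype_card, Fintype.card_fin] at this
  omega

/-- Fewer than `|P₁|` vertices do not separate the first from the last ends of `P₁` in the graph
that consists of the two ends of the chain and the paths not in `P₂`. -/
theorem exists_connIn_of_ncard_lt (h : LinkedChain M A B P pos) {p : ℕ}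
    (hp : IsVertexConnected p G)
    (hadj : ∀ a b a' b', a < b → b ≤ M → a' < b' → b' ≤ M → ∀ i j,
      PathAdj G P.verts (B a ∩ A b) i j → PathAdj G P.verts (B a' ∩ A b') i j)
    {m m' : ℕ} (hm : 2 * p ≤ m) (hmm' : m < m') (hm' : m' + 2 * p ≤ M)
    {P₁ P₂ : Finset (Fin q)} (hcard : P₁.card + P₂.card ≤ p)
    (htriv : ∀ j ∈ P₁, P.src j ≠ P.tgt j) {H : SimpleGraph V}
    (hHl : ∀ x y, G.Adj x y → x ∈ A m → y ∈ A m → H.Adj x y)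
    (hHr : ∀ x y, G.Adj x y → x ∈ B m' → y ∈ B m' → H.Adj x y)
    (hHp : ∀ j ∉ P₂, ∀ k, pos m j ≤ k → k < pos m' j → H.Adj (P.vert j k) (P.vert j (k + 1)))
    {Z : Set V} (hZ : Z.ncard < P₁.card) :
    ∃ j ∈ P₁, ∃ j' ∈ P₁, ConnIn H Zᶜ (P.vert j (pos m j)) (P.vert j' (pos m' j')) := by
  classical
  by_contra! hsep
  have hZp : Z.ncard < p := by omega
  obtain ⟨i, -, hi, hiZ⟩ := h.exists_section hZp 0 (by omega)
  obtain ⟨i', hi', hi'M, hi'Z⟩ := h.exists_section hZp m' hm'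
  -- `c₀` marks what is reached in `H - Z`, `lf` the paths marked at the left section, and `Mis` the
  -- paths whose marks on the two sides disagree. `Z'` trades the part of `Z` in the middle for the
  -- right crossings of the mismatched paths.
  let c₀ : V → Prop := fun v => ∃ j ∈ P₁, ConnIn H Zᶜ (P.vert j (pos m j)) v
  let lf : Fin q → Prop := fun j => c₀ (P.vert j (pos (i + 1) j))
  let Mis : Set (Fin q) := {j | ¬ (c₀ (P.vert j (pos i' j)) ↔ lf j)}
  let Z' : Set V := Z ∩ (A (i + 1) ∪ B i') ∪ (fun j => P.vert j (pos i' j)) '' Mis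
  have hAm : A (i + 1) ⊆ A m := h.chain.mono (by omega) (by omega)
  have hBm : B i' ⊆ B m' := h.chain.anti _ _ (by omega) (by omega)
  have hHA : ∀ x y, G.Adj x y → x ∈ A (i + 1) → y ∈ A (i + 1) → H.Adj x y := fun x y hxy hx hy =>
    hHl x y hxy (hAm hx) (hAm hy)
  have hHB : ∀ x y, G.Adj x y → x ∈ B i' → y ∈ B i' → H.Adj x y := fun x y hxy hx hy =>
    hHr x y hxy (hBm hx) (hBm hy)
  have hc₀Z : ∀ v, c₀ v → v ∉ Z := by
    rintro v ⟨j, -, hc⟩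
    exact hc.right_mem
  have hc₀conn : ∀ u v, c₀ u → ConnIn H Zᶜ u v → c₀ v := by
    rintro u v ⟨j, hj, hc⟩ huv
    exact ⟨j, hj, hc.trans huv⟩
  have htrivpos : ∀ j, P.src j = P.tgt j → ∀ k, P.vert j k = P.src j := fun j hj k =>
    Linkage.eq_src_of_mem hj (P.vert_mem j k)
  have hposle : ∀ a ≤ M, ∀ j, pos a j ≤ P.len j := h.pos_le
  have hpnotZ : ∀ j, P.src j ≠ P.tgt j → ∀ k ≤ P.len j, P.vert j k ∈ B i ∩ A (i + 1) →
      P.vert j k ∉ Z := by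
    intro j hj k hk hmem hkZ
    obtain ⟨t, ht, hmt⟩ := hiZ _ hkZ hmem
    exact hj (P.eq_of_mem hmt (P.vert_mem j k) ▸ ht)
  have hpnotZ' : ∀ j, P.src j ≠ P.tgt j → ∀ k ≤ P.len j, P.vert j k ∈ B i' ∩ A (i' + 1) →
      P.vert j k ∉ Z := by
    intro j hj k hk hmem hkZ
    obtain ⟨t, ht, hmt⟩ := hi'Z _ hkZ hmem
    exact hj (P.eq_of_mem hmt (P.vert_mem j k) ▸ ht)
  have hleftZ : ∀ j, P.src j ≠ P.tgt j → P.vert j (pos (i + 1) j) ∉ Z := fun j hj =>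
    hpnotZ j hj _ (hposle _ (by omega) j) ((h.mem_between (by omega) (by omega)
      (hposle _ (by omega) j)).2 ⟨h.pos_mono (by omega) (by omega) j, le_rfl⟩)
  have hrightZ : ∀ j, P.src j ≠ P.tgt j → P.vert j (pos i' j) ∉ Z := fun j hj =>
    hpnotZ' j hj _ (hposle _ (by omega) j) ((h.mem_between (by omega) (by omega)
      (hposle _ (by omega) j)).2 ⟨le_rfl, h.pos_mono (by omega) (by omega) j⟩)
  have hMis : ∀ j ∈ Mis, P.src j ≠ P.tgt j := by
    intro j hj hjt
    refine hj ?_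
    simp only [lf, htrivpos j hjt]
  -- a mismatched path outside `P₂` meets `Z` in the middle
  have hMisZ : ∀ j ∈ Mis, j ∉ P₂ → ∃ z ∈ Z \ (A (i + 1) ∪ B i'), z ∈ P.verts j := by
    intro j hj hjP
    by_contra! hno
    have hconn : ConnIn H Zᶜ (P.vert j (pos (i + 1) j)) (P.vert j (pos i' j)) := by
      refine connIn_of_fun _ _ _ (h.pos_mono (by omega) (by omega) j) (fun k hk1 hk2 => ?_)
        fun k hk1 hk2 hkZ => ?_
      · have hlen := hposle i' (by omega) j
        have hG := P.adj_vert (j := j) (i := k) (by omega)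
        by_cases hkm : k + 1 ≤ pos m j
        · exact hHl _ _ hG ((h.mem_left m (by omega) j k (by omega)).2 (by omega))
            ((h.mem_left m (by omega) j _ (by omega)).2 hkm)
        · by_cases hkm' : pos m' j ≤ k
          · exact hHr _ _ hG ((h.mem_right m' (by omega) j k (by omega)).2 hkm')
              ((h.mem_right m' (by omega) j _ (by omega)).2 (by omega))
          · exact hHp j hjP k (by omega) (by omega)
      · have hlen := hposle i' (by omega) j
        refine hno _ ⟨hkZ, ?_⟩ (P.vert_mem j k)
        rintro (hkA | hkB)
        · have := (h.mem_left _ (by omega) j k (by omega)).1 hkA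
          exact hleftZ j (hMis j hj) ((le_antisymm this hk1) ▸ hkZ)
        · have := (h.mem_right _ (by omega) j k (by omega)).1 hkB
          exact hrightZ j (hMis j hj) ((le_antisymm hk2 this) ▸ hkZ)
    exact hj ⟨fun hc => hc₀conn _ _ hc hconn.symm, fun hc => hc₀conn _ _ hc hconn⟩
  -- The mismatched paths outside `P₂` inject into the middle part of `Z`. Hence `|Z'| ≤ |Z| + |P₂|
  -- < |P₁| + |P₂| ≤ p`.
  have hZ' : Z'.ncard < p := by
    have h1 : (Mis \ P₂).ncard ≤ (Z \ (A (i + 1) ∪ B i')).ncard := by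
      have hex : ∀ j, ∃ z, j ∈ Mis \ P₂ → z ∈ Z \ (A (i + 1) ∪ B i') ∧ z ∈ P.verts j := by
        intro j
        by_cases hj : j ∈ Mis \ P₂
        · obtain ⟨z, hz⟩ := hMisZ j hj.1 hj.2
          exact ⟨z, fun _ => hz⟩
        · exact ⟨P.src j, fun h => absurd h hj⟩
      choose z hz using hex
      exact Set.ncard_le_ncard_of_injOn z (fun j hj => (hz j hj).1)
        (fun j hj j' hj' heq => P.eq_of_mem (hz j hj).2 (heq ▸ (hz j' hj').2)) (Set.toFinite _)
    have h2 : Mis.ncard ≤ P₂.card + (Mis \ P₂).ncard := by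
      rw [← Set.ncard_coe_finset]
      refine (Set.ncard_le_ncard (t := ↑P₂ ∪ Mis \ P₂) ?_ (Set.toFinite _)).trans
        (Set.ncard_union_le _ _)
      intro j hj
      by_cases hjP : j ∈ (P₂ : Set (Fin q))
      exacts [.inl hjP, .inr ⟨hj, hjP⟩]
    have h3 := Set.ncard_inter_add_ncard_sdiff_eq_ncard Z (A (i + 1) ∪ B i') (Set.toFinite _)
    have h4 : Z'.ncard ≤ _ := Set.ncard_union_le _ _
    have h5 := Set.ncard_image_le (f := fun j => P.vert j (pos i' j)) (Set.toFinite Mis)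
    omega
  have hZZ' : ∀ v, v ∉ Z' → v ∈ A (i + 1) ∪ B i' → v ∉ Z := fun v hv hmem hvZ =>
    hv (.inl ⟨hvZ, hmem⟩)
  have hleft_of_mem : ∀ j, ∀ v ∈ P.verts j, v ∉ Z' → P.vert j (pos (i + 1) j) ∉ Z := by
    intro j v hv hvZ'
    by_cases hjt : P.src j = P.tgt j
    · have hveq : v = P.vert j (pos (i + 1) j) :=
        (Linkage.eq_src_of_mem hjt hv).trans (htrivpos j hjt _).symm
      rw [← hveq]
      refine hZZ' v hvZ' (.inl ?_)
      rw [hveq]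
      exact (h.mem_left _ (by omega) j _ (hposle _ (by omega) j)).2 le_rfl
    · exact hleftZ j hjt
  -- the vertices of a path in the left section are connected in `H - Z`
  have halong : ∀ j, ∀ v ∈ P.verts j ∩ (B i ∩ A (i + 1)), P.vert j (pos (i + 1) j) ∉ Z →
      ConnIn H Zᶜ v (P.vert j (pos (i + 1) j)) := by
    rintro j v ⟨hv, hvW⟩ hjZ
    obtain ⟨k, hk, rfl⟩ := Linkage.exists_vert hv
    have hkb := (h.mem_between (by omega) (by omega) hk).1 hvW
    have hlen := hposle (i + 1) (by omega) j
    by_cases hjt : P.src j = P.tgt j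
    · rw [htrivpos j hjt] at hjZ ⊢
      rw [htrivpos j hjt]
      exact .refl hjZ
    · refine connIn_of_fun _ _ _ hkb.2 (fun s hs1 hs2 => ?_) fun s hs1 hs2 => ?_
      · exact hHA _ _ (P.adj_vert (by omega)) ((h.mem_left _ (by omega) j s (by omega)).2 (by omega))
          ((h.mem_left _ (by omega) j _ (by omega)).2 hs2)
      · exact hpnotZ j hjt s (by omega) ((h.mem_between (by omega) (by omega) (by omega)).2
          ⟨by omega, hs2⟩)
  -- The adjacency recurs in the left section, which `Z` meets only in trivial paths. The inner
  -- vertices of the connecting walk thus avoid `Z`, and the walk carries the mark within `H - Z`.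
  have hkey : ∀ j j', PathAdj G P.verts (B (i + 1) ∩ A i') j j' → lf j →
      P.vert j' (pos (i + 1) j') ∉ Z → lf j' := by
    intro j j' hjj' hlf hj'Z
    obtain ⟨x, hx, y, hy, hxy⟩ := hadj _ _ i (i + 1) (by omega) (by omega) (by omega) (by omega)
      j j' hjj'
    have hcx := halong j x hx (hc₀Z _ hlf)
    have hcy := halong j' y hy hj'Z
    refine hc₀conn _ _ hlf (hcx.symm.trans (ConnIn.trans ?_ hcy))
    rcases hxy with hxy | ⟨u, u', hxu, huu', hu'y⟩
    · exact .of_adj (hHA _ _ hxy hx.2.2 hy.2.2) hcx.left_mem hcy.left_mem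
    · have hmid : ConnIn H Zᶜ u u' := by
        refine huu'.map (fun v hv hvZ => ?_) fun a ha b hb hab => hHA _ _ hab ha.1.2 hb.1.2
        obtain ⟨t, -, ht⟩ := hiZ v hvZ hv.1
        exact hv.2 (Set.mem_iUnion.2 ⟨t, ht⟩)
      exact (hmid.head (hHA _ _ hxu hx.2.2 huu'.left_mem.1.2) hcx.left_mem).tail
        (hHA _ _ hu'y huu'.right_mem.1.2 hy.2.2) hcy.left_mem
  -- `H` may lack the bridges in the middle, so the marks there are prescribed: a path takes its
  -- left mark, and a vertex off the linkage is marked if its component attaches to a marked path.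
  let c₁ : V → Prop := fun v => (∃ j, lf j ∧ v ∈ P.verts j) ∨
    (v ∉ P.support ∧ ∃ j, lf j ∧ ∃ u, ConnIn G P.supportᶜ v u ∧ ∃ y ∈ P.verts j, G.Adj u y)
  have hc₁path : ∀ j, ∀ v ∈ P.verts j, c₁ v ↔ lf j := by
    intro j v hv
    constructor
    · rintro (⟨j', hj', hv'⟩ | ⟨hv', -⟩)
      · exact P.eq_of_mem hv hv' ▸ hj'
      · exact absurd (P.mem_support_iff.2 ⟨j, hv⟩) hv'
    · exact fun hj => .inl ⟨j, hj, hv⟩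
  have hconsist : ∀ v, v ∈ B (i + 1) → v ∈ A i' → v ∉ Z' → v ∈ A (i + 1) ∪ B i' →
      (c₀ v ↔ c₁ v) := by
    rintro v hvB hvA hvZ' (hv | hv)
    · obtain ⟨j, rfl⟩ := h.mem_inter (i + 1) (by omega) v ⟨hv, hvB⟩
      exact (hc₁path j _ (P.vert_mem j _)).symm
    · obtain ⟨j, rfl⟩ := h.mem_inter i' (by omega) v ⟨hvA, hv⟩
      rw [hc₁path j _ (P.vert_mem j _)]
      by_contra hmis
      exact hvZ' (.inr ⟨j, hmis, rfl⟩)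
  have hmidadj : ∀ x y, x ∈ B (i + 1) ∩ A i' → y ∈ B (i + 1) ∩ A i' → y ∉ Z' → G.Adj x y →
      c₁ x → c₁ y := by
    intro x y hx hy hyZ' hxy hcx
    by_cases hys : y ∈ P.support
    · obtain ⟨j', hj'⟩ := P.mem_support_iff.1 hys
      rw [hc₁path j' y hj']
      rcases hcx with ⟨j, hlf, hxj⟩ | ⟨hxs, j, hlf, u, hxu, z, hz, huz⟩
      · by_cases hjj' : j = j'
        · exact hjj' ▸ hlf
        · exact hkey j j' ⟨x, ⟨hxj, hx⟩, y, ⟨hj', hy⟩, .inl hxy⟩ hlf (hleft_of_mem j' y hj' hyZ')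
      · by_cases hjj' : j = j'
        · exact hjj' ▸ hlf
        · have hcu := h.connIn_between (a := i + 1) (b := i') (by omega) (by omega) hx hxu
          have hzW := h.between_of_adj (by omega) (by omega) hcu.right_mem.1 hcu.right_mem.2 huz
          exact hkey j j' ⟨z, ⟨hz, hzW⟩, y, ⟨hj', hy⟩, .inr ⟨u, x, huz.symm, hcu.symm, hxy⟩⟩ hlf
            (hleft_of_mem j' y hj' hyZ')
    · right
      refine ⟨hys, ?_⟩
      rcases hcx with ⟨j, hlf, hxj⟩ | ⟨hxs, j, hlf, u, hxu, z, hz, huz⟩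
      · exact ⟨j, hlf, y, .refl hys, x, hxj, hxy.symm⟩
      · exact ⟨j, hlf, u, hxu.head hxy.symm hys, z, hz, huz⟩
  let c : V → Prop := fun v => if v ∈ A (i + 1) ∪ B i' then c₀ v else c₁ v
  have hc_out : ∀ v, v ∈ A (i + 1) ∪ B i' → (c v ↔ c₀ v) := fun v hv => by simp only [c, if_pos hv]
  have hc_mid : ∀ v, v ∈ B (i + 1) → v ∈ A i' → v ∉ Z' → (c v ↔ c₁ v) := by
    intro v h1 h2 h3
    by_cases hv : v ∈ A (i + 1) ∪ B i'
    · rw [hc_out v hv, hconsist v h1 h2 h3 hv]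
    · simp only [c, if_neg hv]
  have hstep : ∀ x y, x ∈ Z'ᶜ → y ∈ Z'ᶜ → G.Adj x y → c x → c y := by
    intro x y hx hy hxy hcx
    rcases (h.chain.sep (i + 1) (by omega)).edge x y hxy with hA | hB
    · rw [hc_out _ (.inl hA.1)] at hcx
      rw [hc_out _ (.inl hA.2)]
      exact hc₀conn x y hcx (.of_adj (hHA x y hxy hA.1 hA.2) (hZZ' x hx (.inl hA.1))
        (hZZ' y hy (.inl hA.2)))
    rcases (h.chain.sep i' (by omega)).edge x y hxy with hA | hB'
    · rw [hc_mid x hB.1 hA.1 hx] at hcx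
      rw [hc_mid y hB.2 hA.2 hy]
      exact hmidadj x y ⟨hB.1, hA.1⟩ ⟨hB.2, hA.2⟩ hy hxy hcx
    · rw [hc_out _ (.inr hB'.1)] at hcx
      rw [hc_out _ (.inr hB'.2)]
      exact hc₀conn x y hcx (.of_adj (hHB x y hxy hB'.1 hB'.2) (hZZ' x hx (.inr hB'.1))
        (hZZ' y hy (.inr hB'.2)))
  -- `P₁` has more members than `Z`, so one of them avoids `Z`. Its mark travels through `G - Z'` to
  -- the right side and then along `R` to the last end. The target is the crossing with `i' + 1`,
  -- because the one with `i'` may belong to `Z'`.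
  obtain ⟨R, hRP, hRZ⟩ : ∃ R ∈ P₁, ∀ z ∈ P.verts R, z ∉ Z := by
    by_contra! hno
    obtain ⟨R, -⟩ := Finset.card_pos.1 (by omega : 0 < P₁.card)
    have : Nonempty V := ⟨P.src R⟩
    choose! z hz hzZ using hno
    have : P₁.card ≤ Z.ncard := by
      rw [← Set.ncard_coe_finset]
      exact Set.ncard_le_ncard_of_injOn z hzZ
        (fun j hj j' hj' heq => P.eq_of_mem (hz j hj) (heq ▸ hz j' hj')) (Set.toFinite _)
    omega
  have hRt := htriv R hRP
  have hnotZ' : ∀ k ≤ P.len R, k ≠ pos i' R → P.vert R k ∉ Z' := by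
    rintro k hk hne (hkZ | ⟨j, -, hj⟩)
    · exact hRZ _ (P.vert_mem R k) hkZ.1
    · have hjR : j = R := P.eq_of_mem (P.vert_mem j _)
        (by rw [show P.vert j _ = _ from hj]; exact P.vert_mem R k)
      subst hjR
      exact hne (Linkage.vert_inj hk (hposle _ (by omega) j) hj.symm)
  have hRi := h.pos_lt (a := i) (b := i') (by omega) (by omega) hRt
  have hRi' := h.pos_lt (a := i') (b := i' + 1) (by omega) (by omega) hRt
  have hconn := hp.connIn hZ' (hnotZ' (pos i R) (hposle _ (by omega) R) (by omega))
    (hnotZ' (pos (i' + 1) R) (hposle _ (by omega) R) (by omega))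
  have hRi_mem : P.vert R (pos i R) ∈ A (i + 1) := (h.mem_left _ (by omega) R _
    (hposle _ (by omega) R)).2 (h.pos_mono (by omega) (by omega) R)
  have hRi'_mem : P.vert R (pos (i' + 1) R) ∈ B i' := (h.mem_right _ (by omega) R _
    (hposle _ (by omega) R)).2 (h.pos_mono (by omega) (by omega) R)
  have hstart : c (P.vert R (pos i R)) := by
    rw [hc_out _ (.inl hRi_mem)]
    have hlen := hposle m (by omega) R
    refine ⟨R, hRP, (connIn_of_fun _ _ _ (h.pos_mono (by omega) (by omega) R) (fun k hk1 hk2 => ?_)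
      fun k _ _ => hRZ _ (P.vert_mem R k)).symm⟩
    exact hHl _ _ (P.adj_vert (by omega)) ((h.mem_left m (by omega) R k (by omega)).2 hk2.le)
      ((h.mem_left m (by omega) R _ (by omega)).2 hk2)
  have hend : c (P.vert R (pos (i' + 1) R)) := hconn.induction (c := c) hstart hstep
  rw [hc_out _ (.inr hRi'_mem)] at hend
  obtain ⟨j, hj, hjc⟩ := hend
  have hlen := hposle (i' + 1) (by omega) R
  refine hsep j hj R hRP (hjc.trans (connIn_of_fun _ _ _ (h.pos_mono (by omega) (by omega) R)
    (fun k hk1 hk2 => ?_) fun k _ _ => hRZ _ (P.vert_mem R k)).symm)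
  exact hHr _ _ (P.adj_vert (by omega)) ((h.mem_right m' (by omega) R k (by omega)).2 hk1)
    ((h.mem_right m' (by omega) R _ (by omega)).2 (by omega))

end LinkedChain

/-! ### The linear decomposition given by a chain of separations. -/

section Decomposition

variable {V : Type*} {G : SimpleGraph V} {A B : ℕ → Set V}

/-- The linear decomposition of length `L` given by the separations with indices
`m, …, m + L - 1`. -/
def chainBag (A B : ℕ → Set V) (m L i : ℕ) : Set V :=
  (if i = 0 then Set.univ else B (m + i - 1)) ∩ (if L ≤ i then Set.univ else A (m + i))

variable {m L M : ℕ}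

theorem chainBag_zero (hL : 1 ≤ L) : chainBag A B m L 0 = A m := by
  simp [chainBag, show ¬ L ≤ 0 by omega]

theorem chainBag_last (hL : 1 ≤ L) : chainBag A B m L L = B (m + L - 1) := by
  simp [chainBag, show L ≠ 0 by omega]

theorem chainBag_of_lt {i : ℕ} (hi : 1 ≤ i) (hiL : i < L) :
    chainBag A B m L i = B (m + i - 1) ∩ A (m + i) := by
  simp [chainBag, show i ≠ 0 by omega, show ¬ L ≤ i by omega]

theorem chainBag_inter (h : SepChain G M A B) (hM : m + L ≤ M) {i : ℕ} (hi : i < L) :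
    chainBag A B m L i ∩ chainBag A B m L (i + 1) = A (m + i) ∩ B (m + i) := by
  ext v
  simp only [chainBag, Nat.add_eq_zero_iff, one_ne_zero, and_false, if_false,
    show ¬ L ≤ i by omega, show m + (i + 1) - 1 = m + i by omega]
  constructor
  · rintro ⟨⟨-, h1⟩, h2, -⟩
    exact ⟨h1, h2⟩
  · rintro ⟨h1, h2⟩
    refine ⟨⟨?_, h1⟩, h2, ?_⟩
    · split_ifs with h0
      exacts [trivial, h.anti _ _ (by omega) (by omega) h2]
    · split_ifs with h0
      exacts [trivial, h.mono (by omega) (by omega) h1]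

/-- A vertex or edge lies on one side of every separation. The last bag whose preceding separation
has it on the right contains it, since it must be on the left of the following separation. -/
theorem isLinearDecomposition_chainBag (h : SepChain G M A B) (hM : m + L ≤ M) :
    IsLinearDecomposition G L (chainBag A B m L) := by
  have key : ∀ S : Set V, (∀ i ≤ M, S ⊆ A i ∨ S ⊆ B i) → ∃ i ≤ L, S ⊆ chainBag A B m L i := by
    classical
    intro S hS
    let Q : ℕ → Prop := fun i => i = 0 ∨ S ⊆ B (m + i - 1)
    have hQ := Nat.findGreatest_spec (P := Q) (Nat.zero_le L) (.inl rfl)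
    have hle := Nat.findGreatest_le (P := Q) L
    refine ⟨Nat.findGreatest Q L, hle, Set.subset_inter ?_ ?_⟩
    · split_ifs with h0
      exacts [Set.subset_univ _, hQ.resolve_left h0]
    · split_ifs with h0
      · exact Set.subset_univ _
      · have hlt : Nat.findGreatest Q L < L := not_le.1 h0
        have hnot := Nat.findGreatest_is_greatest (P := Q) (Nat.lt_succ_self _) hlt
        refine (hS _ (by omega)).resolve_right fun hB => hnot (.inr ?_)
        rwa [show m + (Nat.findGreatest Q L).succ - 1 = m + Nat.findGreatest Q L by omega]
  refine ⟨fun x => ?_, fun x y hxy => ?_, ?_⟩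
  · obtain ⟨i, hi, hx⟩ := key {x} fun i hi => by simpa using (h.sep i hi).cover x
    exact ⟨i, hi, hx rfl⟩
  · obtain ⟨i, hi, hx⟩ := key {x, y} fun i hi => by
      simpa [Set.insert_subset_iff] using (h.sep i hi).edge x y hxy
    exact ⟨i, hi, hx (.inl rfl), hx (.inr rfl)⟩
  · rintro i j k hij hjk hk v ⟨hvi, hvk⟩
    simp only [chainBag, Set.mem_inter_iff] at hvi hvk ⊢
    constructor
    · split_ifs with h0
      · trivial
      · have := hvk.1
        rw [if_neg (by omega)] at this
        exact h.anti _ _ (by omega) (by omega) this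
    · split_ifs with h0
      · trivial
      · have := hvi.2
        rw [if_neg (by omega)] at this
        exact h.mono (by omega) (by omega) this

/-- Every bag has more than `q` vertices: it contains a separator and a vertex that joins the left
side at the next separation. For the two end bags this takes the separations `m - 1` and `m + L`,
whence the bounds on `m`. -/
theorem isNonredundant_chainBag [Finite V] (h : SepChain G M A B) (hm : 1 ≤ m) (hM : m + L ≤ M)
    {q : ℕ} (hq : ∀ i ≤ M, (A i ∩ B i).ncard = q) : IsNonredundant L (chainBag A B m L) := by
  have hcard : ∀ i ≤ L, (chainBag A B m L i).ncard ≠ q := by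
    intro i hi
    have hss := h.ssubset (m + i - 1) (m + i) (by omega) (by omega)
    have hsub : B (m + i - 1) ∩ A (m + i) ⊆ chainBag A B m L i := by
      rintro v ⟨h1, h2⟩
      refine ⟨?_, ?_⟩ <;> split_ifs
      exacts [trivial, h1, trivial, h2]
    have hlt : (A (m + i - 1) ∩ B (m + i - 1)).ncard < (chainBag A B m L i).ncard := by
      refine Set.ncard_lt_ncard ⟨fun v hv => hsub ⟨hv.2, hss.1 hv.1⟩, fun hsup => ?_⟩
        (Set.toFinite _)
      obtain ⟨v, hv, hv'⟩ := Set.exists_of_ssubset hss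
      exact hv' (hsup (hsub ⟨(h.sep _ (by omega)).mem_right hv', hv⟩)).1
    rw [hq _ (by omega)] at hlt
    exact hlt.ne'
  intro i hi hiL
  obtain ⟨i, rfl⟩ := Nat.exists_eq_add_of_le' hi
  rw [Nat.add_sub_cancel, chainBag_inter h hM (by omega)]
  refine ⟨fun heq => hcard i (by omega) ?_, fun heq => hcard (i + 1) hiL ?_⟩
  · rw [heq]; exact hq _ (by omega)
  · rw [← heq]; exact hq _ (by omega)

theorem hasAdhesion_chainBag (h : SepChain G M A B) (hM : m + L ≤ M)
    {q : ℕ} (hq : ∀ i ≤ M, (A i ∩ B i).ncard = q) : HasAdhesion L (chainBag A B m L) q := by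
  intro i hi hiL
  obtain ⟨i, rfl⟩ := Nat.exists_eq_add_of_le' hi
  rw [Nat.add_sub_cancel, chainBag_inter h hM (by omega)]
  exact hq _ (by omega)

end Decomposition

/-! ### Restricting the linkage to an interval of the chain. -/

/-- The restriction of a linkage to an interval of a chain of separations. -/
structure IsRestriction {V : Type*} {G : SimpleGraph V} {X Y X' Y' : Set V} {q : ℕ}
    (P : Linkage G X Y q) (P' : Linkage G X' Y' q) (a b : Fin q → ℕ) : Prop where
  le : ∀ j, a j ≤ b j
  le_len : ∀ j, b j ≤ P.len j
  len_eq : ∀ j, P'.len j = b j - a j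
  vert_eq : ∀ j, ∀ i ≤ b j - a j, P'.vert j i = P.vert j (a j + i)

namespace IsRestriction

variable {V : Type*} {G : SimpleGraph V} {X Y X' Y' : Set V} {q : ℕ}
  {P : Linkage G X Y q} {P' : Linkage G X' Y' q} {a b : Fin q → ℕ}

theorem mem_verts_iff (h : IsRestriction P P' a b) {j : Fin q} {x : V} :
    x ∈ P'.verts j ↔ ∃ k, a j ≤ k ∧ k ≤ b j ∧ x = P.vert j k := by
  have hab := h.le j
  constructor
  · intro hx
    obtain ⟨i, hi, rfl⟩ := Linkage.exists_vert hx
    rw [h.len_eq] at hi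
    exact ⟨a j + i, by omega, by omega, h.vert_eq j i hi⟩
  · rintro ⟨k, hk1, hk2, rfl⟩
    have := h.vert_eq j (k - a j) (by omega)
    rw [Nat.add_sub_cancel' hk1] at this
    exact this ▸ P'.vert_mem j _

theorem toSubgraph_adj (h : IsRestriction P P' a b) {j : Fin q} {k : ℕ} (hk : a j ≤ k)
    (hk' : k < b j) : (P'.path j).toSubgraph.Adj (P.vert j k) (P.vert j (k + 1)) := by
  rw [Linkage.toSubgraph_adj_iff]
  refine ⟨k - a j, by rw [h.len_eq]; omega, .inl ⟨?_, ?_⟩⟩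
  · rw [h.vert_eq j _ (by omega), Nat.add_sub_cancel' hk]
  · rw [h.vert_eq j _ (by omega)]
    congr 1
    omega

theorem verts_subset (h : IsRestriction P P' a b) (j : Fin q) : P'.verts j ⊆ P.verts j := by
  intro x hx
  obtain ⟨k, -, -, rfl⟩ := h.mem_verts_iff.1 hx
  exact P.vert_mem j k

theorem support_subset (h : IsRestriction P P' a b) : P'.support ⊆ P.support :=
  Set.iUnion_mono h.verts_subset

end IsRestriction

/-- The spanning graph contains all vertices, so a one-vertex path could lie outside `K`; `hX`
excludes this. -/
theorem Linkage.graph_le_of_spanningCoe {V : Type*} {G : SimpleGraph V} {K : G.Subgraph}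
    {X Y : Set V} {n : ℕ} (Q : Linkage K.spanningCoe X Y n) (hX : X ⊆ K.verts) :
    (Q.mapLe K.spanningCoe_le).graph ≤ K := by
  have hadj : ∀ x y, (Q.mapLe K.spanningCoe_le).graph.Adj x y → K.Adj x y := by
    intro x y h
    obtain ⟨j, hj⟩ := Linkage.graph_adj.1 h
    rw [SimpleGraph.Walk.adj_toSubgraph_iff_mem_edges] at hj
    have hj' : s(x, y) ∈ (Q.path j).edges := by
      simpa only [Linkage.mapLe, SimpleGraph.Walk.edges_mapLe_eq_edges] using hj
    exact (Q.path j).adj_of_mem_edges hj'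
  refine ⟨fun x hx => ?_, hadj⟩
  rw [Linkage.graph_verts] at hx
  obtain ⟨j, hj⟩ := (Linkage.mem_support_iff _).1 hx
  obtain ⟨i, hi, rfl⟩ := Linkage.exists_vert hj
  have hc : ConnIn K.spanningCoe Set.univ ((Q.mapLe K.spanningCoe_le).vert j 0)
      ((Q.mapLe K.spanningCoe_le).vert j i) := by
    refine connIn_of_fun _ 0 i (Nat.zero_le i) (fun k _ hk => ?_) fun _ _ _ => trivial
    refine hadj _ _ (Linkage.graph_adj.2 ⟨j, Linkage.toSubgraph_adj_iff.2 ⟨k, ?_, .inl ⟨rfl, rfl⟩⟩⟩)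
    omega
  refine hc.induction (c := fun x => x ∈ K.verts) ?_ fun x y _ _ hxy _ => K.edge_vert hxy.symm
  rw [Linkage.vert_zero]
  exact hX (Q.src_mem j)

namespace LinkedChain

variable {V : Type*} {G : SimpleGraph V} {X Y : Set V} {q M : ℕ} {A B : ℕ → Set V}
  {P : Linkage G X Y q} {pos : ℕ → Fin q → ℕ}

theorem exists_isRestriction (h : LinkedChain M A B P pos) {m L : ℕ} (hL : 2 ≤ L) (hM : m + L ≤ M) :
    ∃ P' : FoundationalLinkage G L (chainBag A B m L) q,
      IsRestriction P P' (pos m) (pos (m + L - 1)) := by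
  have h1 := chainBag_inter h.chain hM (i := 0) (by omega)
  have h2 := chainBag_inter h.chain hM (i := L - 1) (by omega)
  rw [Nat.add_zero] at h1
  rw [Nat.sub_add_cancel (by omega), ← Nat.add_sub_assoc (by omega)] at h2
  have hle := h.pos_mono (a := m) (b := m + L - 1) (by omega) (by omega)
  have hlen := h.pos_le (m + L - 1) (by omega)
  obtain ⟨P', hP'⟩ := P.exists_restrict (X' := chainBag A B m L 0 ∩ chainBag A B m L 1)
    (Y' := chainBag A B m L (L - 1) ∩ chainBag A B m L L) (pos m) (pos (m + L - 1)) hle hlen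
    (fun j => by
      rw [h1]
      exact ⟨(h.mem_left m (by omega) j _ (h.pos_le m (by omega) j)).2 le_rfl,
        (h.mem_right m (by omega) j _ (h.pos_le m (by omega) j)).2 le_rfl⟩)
    (fun j => by
      rw [h2]
      exact ⟨(h.mem_left _ (by omega) j _ (hlen j)).2 le_rfl,
        (h.mem_right _ (by omega) j _ (hlen j)).2 le_rfl⟩)
  exact ⟨P', hle, hlen, fun j => (hP' j).1, fun j => (hP' j).2⟩

/-! ### Uniformity, stability and rerouting for the restricted linkage. -/

section Properties

variable {m L : ℕ} {P' : FoundationalLinkage G L (chainBag A B m L) q}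

/-- As `2 ≤ L`, the separations `m` and `m + L - 1` differ, and a path crossing both at the same
vertex is trivial as a whole. -/
theorem isTrivial_restriction_iff (h : LinkedChain M A B P pos) (hL : 2 ≤ L) (hM : m + L ≤ M)
    (hP' : IsRestriction P P' (pos m) (pos (m + L - 1))) {j : Fin q} :
    P'.IsTrivial j ↔ P.src j = P.tgt j := by
  have hle := hP'.le j
  rw [Linkage.isTrivial_iff_len, hP'.len_eq]
  constructor
  · intro h0
    exact h.trivial m (m + L - 1) (by omega) (by omega) j (by omega)
  · intro ht
    have := Linkage.isTrivial_iff_len.1 (Linkage.isTrivial_iff.2 ht)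
    have := hP'.le_len j
    omega

theorem verts_inter (h : LinkedChain M A B P pos) (hM : m + L ≤ M)
    (hP' : IsRestriction P P' (pos m) (pos (m + L - 1))) {i : ℕ} (hi : 1 ≤ i) (hiL : i < L)
    (j : Fin q) : P'.verts j ∩ chainBag A B m L i = P.verts j ∩ chainBag A B m L i := by
  refine (Set.inter_subset_inter_left _ (hP'.verts_subset j)).antisymm ?_
  rintro x ⟨hx, hxW⟩
  refine ⟨?_, hxW⟩
  obtain ⟨k, hk, rfl⟩ := Linkage.exists_vert hx
  rw [chainBag_of_lt hi hiL, h.mem_between (by omega) (by omega) hk] at hxW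
  have h1 := h.pos_mono (a := m) (b := m + i - 1) (by omega) (by omega) j
  have h2 := h.pos_mono (a := m + i) (b := m + L - 1) (by omega) (by omega) j
  exact hP'.mem_verts_iff.2 ⟨k, by omega, by omega, rfl⟩

theorem pathAdj_restriction_iff (h : LinkedChain M A B P pos) (hM : m + L ≤ M)
    (hP' : IsRestriction P P' (pos m) (pos (m + L - 1))) {i : ℕ} (hi : 1 ≤ i) (hiL : i < L)
    {j j' : Fin q} (hj : j ≠ j') : P'.BridgeAdjacent (chainBag A B m L i) j j' ↔
      PathAdj G P.verts (B (m + i - 1) ∩ A (m + i)) j j' := by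
  have hv := h.verts_inter hM hP' hi hiL
  rw [Linkage.bridgeAdjacent_iff hj]
  rw [chainBag_of_lt hi hiL] at hv ⊢
  exact ⟨fun h => h.congr hv, fun h => h.congr fun m => (hv m).symm⟩

theorem hasUniformAdjacency_restriction (h : LinkedChain M A B P pos) (hM : m + L ≤ M)
    (hadj : ∀ a b a' b', a < b → b ≤ M → a' < b' → b' ≤ M → ∀ i j,
      PathAdj G P.verts (B a ∩ A b) i j → PathAdj G P.verts (B a' ∩ A b') i j)
    (hP' : IsRestriction P P' (pos m) (pos (m + L - 1))) : P'.HasUniformAdjacency := by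
  rintro i j hij ⟨k, hk, hkL, hb⟩ k' hk' hkL'
  rw [h.pathAdj_restriction_iff hM hP' hk (by omega) hij] at hb
  rw [h.pathAdj_restriction_iff hM hP' hk' (by omega) hij]
  exact hadj _ _ _ _ (by omega) (by omega) (by omega) (by omega) i j hb

/-- Triviality in one section means crossing its two bounding separations at one vertex, which makes
the entire path trivial. -/
theorem hasUniformTriviality_restriction (h : LinkedChain M A B P pos) (hM : m + L ≤ M)
    (hP' : IsRestriction P P' (pos m) (pos (m + L - 1))) : P'.HasUniformTriviality := by
  rintro j ⟨i, hi, hiL, x, hx⟩ k hk hkL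
  have hmem : ∀ s, 1 ≤ s → s ≤ L - 1 → ∀ c, (c = m + s - 1 ∨ c = m + s) →
      P.vert j (pos c j) ∈ P.verts j ∩ chainBag A B m L s := by
    intro s hs hsL c hc
    refine ⟨P.vert_mem j _, ?_⟩
    rw [chainBag_of_lt hs (by omega),
      h.mem_between (by omega) (by omega) (h.pos_le c (by omega) j)]
    exact ⟨h.pos_mono (by omega) (by omega) j, h.pos_mono (by omega) (by omega) j⟩
  rw [h.verts_inter hM hP' hi (by omega)] at hx
  have h1 := hmem i hi hiL _ (.inl rfl)
  have h2 := hmem i hi hiL _ (.inr rfl)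
  rw [hx] at h1 h2
  have hpos := Linkage.vert_inj (h.pos_le _ (by omega) j) (h.pos_le _ (by omega) j)
    (h1.trans h2.symm)
  have ht := h.trivial _ _ (by omega) (by omega) j hpos
  refine ⟨P.src j, ?_⟩
  rw [h.verts_inter hM hP' hk (by omega)]
  have h3 := hmem k hk hkL _ (.inl rfl)
  refine Set.eq_singleton_iff_unique_mem.2 ⟨?_, fun y hy => Linkage.eq_src_of_mem ht hy.1⟩
  rwa [Linkage.eq_src_of_mem ht (P.vert_mem j _)] at h3

/-- An edge bridge of the given kind is a chord of the path. A component bridge consists, off the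
linkage, of vertices that are poor for the unrestricted linkage, because no walk off that linkage
leaves the section. -/
theorem isStable_restriction [Finite V] (h : LinkedChain M A B P pos) {p : ℕ}
    (hp : IsVertexConnected p G)
    (hmax : ∀ P' : Linkage G X Y q, P'.rich.ncard ≤ P.rich.ncard) (hL : 2 ≤ L) (hM : m + L ≤ M)
    (hP' : IsRestriction P P' (pos m) (pos (m + L - 1))) : P'.IsStable p := by
  rintro i hi hiL j hj ⟨D, hD, hDtriv, hDj, hDother⟩
  have hW := chainBag_of_lt (A := A) (B := B) (m := m) hi (show i < L by omega)
  have hv := h.verts_inter hM hP' hi (by omega)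
  have htriv : ∀ {t}, P'.IsTrivial t ↔ P.src t = P.tgt t :=
    h.isTrivial_restriction_iff hL hM hP'
  have hsupp : ∀ v ∈ chainBag A B m L i, v ∉ P'.support → v ∉ P.support := by
    intro v hvW hvs hvs'
    obtain ⟨t, ht⟩ := P.mem_support_iff.1 hvs'
    have : v ∈ P'.verts t ∩ chainBag A B m L i := by rw [hv]; exact ⟨ht, hvW⟩
    exact hvs (P'.mem_support_iff.2 ⟨t, this.1⟩)
  have hmain : p ≤ {t | P.src t = P.tgt t ∧
      PathAdj G P.verts (B (m + i - 1) ∩ A (m + i)) j t}.ncard + 2 := by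
    refine h.le_ncard_trivial hp hmax (by omega) (by omega) (fun hjt => hj (htriv.2 hjt)) ?_
    rcases hD with hD | hD
    · left
      obtain ⟨x, y, hxy, hK, hS, hxS, hyS, rfl⟩ := hD
      rw [SimpleGraph.Subgraph.verts_inf, Linkage.graph_verts] at hxS hyS
      rw [inducedOn_adj] at hK
      have hboth : ∀ u v (huv : G.Adj u v), G.subgraphOfAdj hxy = G.subgraphOfAdj huv →
          u ∈ P'.verts j → v ∈ P'.support → v ∈ P'.verts j := by
        intro u v huv heq hu hvs
        obtain ⟨t, ht⟩ := P'.mem_support_iff.1 hvs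
        by_cases htj : t = j
        · exact htj ▸ ht
        · by_cases htt : P'.IsTrivial t
          · exact absurd ⟨u, v, huv, t, htt, hu, ht, heq⟩ hDtriv
          · refine absurd ⟨v, ?_, ht⟩ (hDother t htj htt)
            rw [heq]
            simp
      have hxyj : x ∈ P'.verts j ∧ y ∈ P'.verts j := by
        obtain ⟨z, hz, hzj⟩ := hDj
        simp only [SimpleGraph.subgraphOfAdj_verts, Set.mem_insert_iff,
          Set.mem_singleton_iff] at hz
        rcases hz with rfl | rfl
        · exact ⟨hzj, hboth _ _ hxy rfl hzj hyS.1⟩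
        · exact ⟨hboth _ _ hxy.symm (SimpleGraph.subgraphOfAdj_symm hxy).symm hzj hxS.1, hzj⟩
      have hordered : ∀ k k', k < k' → pos m j ≤ k → k' ≤ pos (m + L - 1) j →
          P.vert j k ∈ chainBag A B m L i → P.vert j k' ∈ chainBag A B m L i →
          G.Adj (P.vert j k) (P.vert j k') →
          ¬ (P'.graph ⊓ inducedOn G (chainBag A B m L i)).Adj (P.vert j k) (P.vert j k') →
          ∃ α β, pos (m + i - 1) j ≤ α ∧ α + 1 < β ∧ β ≤ pos (m + i) j ∧
            G.Adj (P.vert j α) (P.vert j β) := by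
        intro k k' hkk' hk hk' hkW hkW' hadj hnot
        have hlen := hP'.le_len j
        have hkW2 := hkW
        have hkW2' := hkW'
        rw [hW, h.mem_between (by omega) (by omega) (by omega)] at hkW2 hkW2'
        refine ⟨k, k', hkW2.1, ?_, hkW2'.2, hadj⟩
        by_contra! hle
        obtain rfl : k' = k + 1 := by omega
        exact hnot ⟨Linkage.graph_adj.2 ⟨j, hP'.toSubgraph_adj hk (by omega)⟩,
          inducedOn_adj.2 ⟨hkW, hkW', hadj⟩⟩
      obtain ⟨k, hk1, hk2, rfl⟩ := hP'.mem_verts_iff.1 hxyj.1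
      obtain ⟨k', hk1', hk2', rfl⟩ := hP'.mem_verts_iff.1 hxyj.2
      rcases lt_trichotomy k k' with hlt | rfl | hlt
      · exact hordered k k' hlt hk1 hk2' hK.1 hK.2.1 hxy hS
      · exact absurd rfl hxy.ne
      · exact hordered k' k hlt hk1' hk2 hK.2.1 hK.1 hxy.symm fun hadj => hS hadj.symm
    · right
      obtain ⟨v, hvW, hverts, -⟩ := P'.isComponentBridge_iff.1 hD
      have hvP := hsupp v hvW.1 hvW.2
      have hset : chainBag A B m L i \ P'.support ⊆ P.supportᶜ := fun u hu =>
        hsupp u hu.1 hu.2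
      rw [hW] at hvW
      refine ⟨v, hvW.1, ⟨hvP, ?_⟩, ?_⟩
      · rintro t htj htt ⟨u, hu, hc⟩
        -- Where the walk first meets the path `t` it is still in the section, so this vertex is an
        -- attachment of `D`.
        obtain ⟨a, b, hva, hab, hbt, -⟩ := hc.exists_first (Y := P.verts t)
          (fun hvt => hvP (P.mem_support_iff.2 ⟨t, hvt⟩)) hu
        have hva' : ConnIn G P.supportᶜ v a := by
          refine hva.mono_set fun z hz hzs => ?_
          obtain ⟨s, hs⟩ := P.mem_support_iff.1 hzs
          by_cases hst : s = t
          exacts [hz.2 (hst ▸ hs), hz.1 s hst hs]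
        have hva'' := h.connIn_between (by omega) (by omega) hvW.1 hva'
        have hbW := h.between_of_adj (by omega) (by omega) hva''.right_mem.1 hva''.right_mem.2 hab
        rw [← hW] at hbW hva''
        refine hDother t htj (fun ht => htt (htriv.1 ht)) ⟨b, ?_, ?_⟩
        · rw [hverts]
          exact .inr ⟨a, hva''.mono_set fun z hz => ⟨hz.1, fun hz' => hz.2 (hP'.support_subset hz')⟩,
            inducedOn_adj.2 ⟨hbW, hva''.right_mem.1, hab.symm⟩⟩
        · have : b ∈ P'.verts t ∩ chainBag A B m L i := by rw [hv]; exact ⟨hbt, hbW⟩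
          exact this.1
      · obtain ⟨z, hz, hzj⟩ := hDj
        rw [hverts] at hz
        rcases hz with hz | ⟨u, hvu, hzu⟩
        · exact absurd (P'.mem_support_iff.2 ⟨j, hzj⟩) hz.right_mem.2
        · obtain ⟨k, hk, rfl⟩ := Linkage.exists_vert (hP'.verts_subset j hzj)
          exact ⟨u, hvu.mono_set hset, k, hk, (inducedOn_adj.1 hzu).2.2.symm⟩
  refine hmain.trans (Nat.add_le_add_right (Set.ncard_le_ncard ?_ (Set.toFinite _)) 2)
  rintro t ⟨ht, hjt⟩
  have hne : j ≠ t := by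
    rintro rfl
    exact hj (htriv.2 ht)
  exact ⟨htriv.2 ht, (h.pathAdj_restriction_iff hM hP' hi (by omega) hne).2 hjt⟩

/-- Menger is applied in the permitted graph `K`; a cut that is too small is refuted by
`exists_connIn_of_ncard_lt`. The margins of `2 * p` separations in both end bags are spent there. -/
theorem isReroutable_restriction [Finite V] (h : LinkedChain M A B P pos) {p : ℕ}
    (hp : IsVertexConnected p G)
    (hadj : ∀ a b a' b', a < b → b ≤ M → a' < b' → b' ≤ M → ∀ i j,
      PathAdj G P.verts (B a ∩ A b) i j → PathAdj G P.verts (B a' ∩ A b') i j)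
    (hL : 2 ≤ L) (hm : 2 * p ≤ m) (hM : m + L + 2 * p ≤ M)
    (hP' : IsRestriction P P' (pos m) (pos (m + L - 1))) : P'.IsReroutable p := by
  intro P₁ P₂ hsub hcard hnontriv
  have htriv : ∀ {t}, P'.IsTrivial t ↔ P.src t = P.tgt t :=
    h.isTrivial_restriction_iff hL (by omega) hP'
  set K : G.Subgraph := inducedOn G (chainBag A B m L 0 ∪ chainBag A B m L L) ⊔
    P'.graphOf {j | j ∉ P₂} with hK
  rcases menger K.spanningCoe
    (chainBag A B m L 0 ∩ chainBag A B m L 1 ∩ ⋃ j ∈ P₁, P'.verts j)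
    (chainBag A B m L (L - 1) ∩ chainBag A B m L L ∩ ⋃ j ∈ P₁, P'.verts j) P₁.card
    with ⟨⟨Q⟩⟩ | ⟨Z, hZ, hsep⟩
  · exact ⟨Q.mapLe K.spanningCoe_le, Q.graph_le_of_spanningCoe fun v hv =>
      .inl (.inl hv.1.1)⟩
  exfalso
  have hind : ∀ x y, G.Adj x y → x ∈ chainBag A B m L 0 ∪ chainBag A B m L L →
      y ∈ chainBag A B m L 0 ∪ chainBag A B m L L → K.spanningCoe.Adj x y := by
    intro x y hxy hx hy
    rw [SimpleGraph.Subgraph.spanningCoe_adj, hK, SimpleGraph.Subgraph.sup_adj]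
    exact .inl (inducedOn_adj.2 ⟨hx, hy, hxy⟩)
  have h0 := chainBag_zero (A := A) (B := B) (m := m) (show 1 ≤ L by omega)
  have hLast := chainBag_last (A := A) (B := B) (m := m) (show 1 ≤ L by omega)
  have h1 := chainBag_inter h.chain (m := m) (L := L) (by omega) (i := 0) (by omega)
  have h2 := chainBag_inter h.chain (m := m) (L := L) (by omega) (i := L - 1) (by omega)
  rw [Nat.add_zero] at h1
  rw [Nat.sub_add_cancel (by omega), ← Nat.add_sub_assoc (by omega)] at h2
  obtain ⟨j, hj, j', hj', hc⟩ := h.exists_connIn_of_ncard_lt hp hadj hm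
    (m' := m + L - 1) (by omega) (by omega) hcard (fun j hj ht => hnontriv j hj (htriv.2 ht))
    (H := K.spanningCoe)
    (fun x y hxy hx hy => hind x y hxy (.inl (by rwa [h0])) (.inl (by rwa [h0])))
    (fun x y hxy hx hy => hind x y hxy (.inr (by rwa [hLast])) (.inr (by rwa [hLast])))
    (fun j hj k hk hk' => by
      rw [SimpleGraph.Subgraph.spanningCoe_adj, hK, SimpleGraph.Subgraph.sup_adj]
      right
      simp only [Linkage.graphOf, SimpleGraph.Subgraph.iSup_adj]
      exact ⟨j, hj, hP'.toSubgraph_adj hk hk'⟩) hZ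
  have hle := hP'.le
  have hlen := hP'.le_len
  refine hsep _ ⟨?_, ?_⟩ _ ⟨?_, ?_⟩ hc
  · rw [h1]
    have := (hle j).trans (hlen j)
    exact ⟨(h.mem_left m (by omega) j _ this).2 le_rfl, (h.mem_right m (by omega) j _ this).2 le_rfl⟩
  · exact Set.mem_biUnion (show j ∈ (P₁ : Set (Fin q)) from hj)
      (hP'.mem_verts_iff.2 ⟨_, le_rfl, hle j, rfl⟩)
  · rw [h2]
    exact ⟨(h.mem_left _ (by omega) j' _ (hlen j')).2 le_rfl,
      (h.mem_right _ (by omega) j' _ (hlen j')).2 le_rfl⟩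
  · exact Set.mem_biUnion (show j' ∈ (P₁ : Set (Fin q)) from hj')
      (hP'.mem_verts_iff.2 ⟨_, hle j', le_rfl, rfl⟩)

end Properties

end LinkedChain

/-! ### Assembly of the theorem and the corollary. -/

theorem exists_minor_or_hasGoodLinearDecomposition (k l p w : ℕ) : ∃ N : ℕ, ∀ (V : Type u)
    [Fintype V] (G : SimpleGraph V), IsVertexConnected p G → TreewidthAtMost w G →
    N ≤ Fintype.card V →
      IsMinorOf (completeBipartiteGraph (Fin p) (Fin k)) G ∨ HasGoodLinearDecomposition p l w G := by
  -- Length at least 2 keeps the first and last separators distinct. Rerouting takes `2 * p`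
  -- separations at either end; the additional 1 in `m` leaves a separation before the first bag's
  -- boundary even if `p = 0`, as non-redundancy requires.
  let L := max l 2
  let m := 2 * p + 1
  choose Madj hMadj using fun q => exists_uniformly_adjacent_chain.{u} (m + L + 2 * p) q
  choose Mtriv hMtriv using fun q => exists_uniformly_trivial_chain.{u} (Madj q) q
  obtain ⟨Mlink, hMlink⟩ := exists_linked_chain.{u} ((Finset.range (w + 1)).sup Mtriv) w
  obtain ⟨N, hN⟩ := exists_minor_or_sepChain.{u} p k w Mlink
  refine ⟨N, fun V _ G hp hw hV => ?_⟩
  rcases hN V G hp hw (by rwa [Nat.card_eq_fintype_card]) with hminor | ⟨A₀, B₀, hAB₀, hcard₀⟩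
  · exact .inl hminor
  right
  obtain ⟨A₁, B₁, q, hqw, hAB₁, hcard₁, hP₁⟩ := hMlink V G A₀ B₀ hAB₀ hcard₀
  -- The value of `q` emerges only here, so the linked chain was made long enough for every order up
  -- to `w`.
  have hle : Mtriv q ≤ (Finset.range (w + 1)).sup Mtriv :=
    Finset.le_sup (f := Mtriv) (Finset.mem_range.2 (by omega))
  obtain ⟨A₂, B₂, hcard₂, X, Y, ⟨P₀⟩, hlinked⟩ := hMtriv q _ hle V G A₁ B₁ hAB₁ hcard₁ hP₁
  -- The extremal linkage is fixed between the two thinnings: `hlinked` serves every linkage from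
  -- `X` to `Y`, while adjacency is made uniform for `P` alone.
  obtain ⟨P, hmax⟩ := P₀.exists_rich_max
  obtain ⟨pos₂, hpos₂⟩ := hlinked P
  obtain ⟨φ, hφ, hφM, hadj⟩ := hMadj q V G A₂ B₂ X Y P pos₂ hpos₂
  have h := hpos₂.comp hφ hφM
  have hL : 2 ≤ L := le_max_right _ _
  have hcard : ∀ i ≤ m + L, ((A₂ ∘ φ) i ∩ (B₂ ∘ φ) i).ncard = q := fun i hi =>
    hcard₂ _ ((hφ.monotone (by omega)).trans hφM)
  have hchain : SepChain G (m + L) (A₂ ∘ φ) (B₂ ∘ φ) :=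
    hpos₂.chain.comp hφ ((hφ.monotone (by omega)).trans hφM)
  obtain ⟨P', hP'⟩ := h.exists_isRestriction (m := m) hL (by omega)
  exact ⟨L, q, chainBag (A₂ ∘ φ) (B₂ ∘ φ) m L, P', by omega, le_max_left _ _, hqw,
    isLinearDecomposition_chainBag hchain le_rfl, hasAdhesion_chainBag hchain le_rfl hcard,
    isNonredundant_chainBag hchain (by omega) le_rfl hcard,
    h.isStable_restriction hp hmax hL (by omega) hP',
    h.hasUniformTriviality_restriction (by omega) hP',
    h.hasUniformAdjacency_restriction (by omega) hadj hP',
    h.isReroutable_restriction hp hadj hL (by omega) le_rfl hP'⟩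

/-- Contracting a perfect matching of the complete bipartite graph leaves a complete graph. -/
theorem isMinorOf_top_of_completeBipartiteGraph {V : Type*} {G : SimpleGraph V} {n : ℕ}
    (h : IsMinorOf (completeBipartiteGraph (Fin n) (Fin n)) G) :
    IsMinorOf (⊤ : SimpleGraph (Fin n)) G := by
  obtain ⟨branch, hconn, hdisj, hadj⟩ := h
  refine ⟨fun a => branch (.inl a) ∪ branch (.inr a), fun a => ?_, fun a b hab => ?_,
    fun a b _ => ?_⟩
  · obtain ⟨x, hx, y, hy, hxy⟩ := hadj (.inl a) (.inr a) (by simp)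
    refine connected_induce_of_connIn (u := x) (.inl hx) ?_
    rintro v (hv | hv)
    · exact (connIn_of_connected_induce (hconn _) hx hv).mono_set Set.subset_union_left
    · exact ((connIn_of_connected_induce (hconn _) hy hv).mono_set Set.subset_union_right).head hxy
        (.inl hx)
  · simp only [Set.disjoint_union_left, Set.disjoint_union_right]
    exact ⟨⟨hdisj _ _ (by simpa using hab), hdisj _ _ (by simp)⟩, hdisj _ _ (by simp),
      hdisj _ _ (by simpa using hab)⟩
  · obtain ⟨x, hx, y, hy, hxy⟩ := hadj (.inl a) (.inr b) (by simp)
    exact ⟨x, .inl hx, y, .inr hy, hxy⟩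

theorem theorem3p8 :
    (∀ k l p w : ℕ, ∃ N : ℕ, ∀ (V : Type*) [Fintype V] (G : SimpleGraph V),
      IsVertexConnected p G → TreewidthAtMost w G → N ≤ Fintype.card V →
        IsMinorOf (completeBipartiteGraph (Fin p) (Fin k)) G ∨
          HasGoodLinearDecomposition p l w G) ∧
    (∀ l w : ℕ, ∃ N : ℕ, ∀ (V : Type*) [Fintype V] (G : SimpleGraph V),
      IsVertexConnected 6 G → TreewidthAtMost w G → N ≤ Fintype.card V →
        IsMinorOf (⊤ : SimpleGraph (Fin 6)) G ∨ HasGoodLinearDecomposition 6 l w G) := by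
  refine ⟨fun k l p w => exists_minor_or_hasGoodLinearDecomposition k l p w, fun l w => ?_⟩
  obtain ⟨N, hN⟩ := exists_minor_or_hasGoodLinearDecomposition 6 l 6 w
  exact ⟨N, fun V _ G hp hw hV =>
    (hN V G hp hw hV).imp_left isMinorOf_top_of_completeBipartiteGraph⟩
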